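/- Let $0\le l\le n-1$, let $\Omega\subset\subset\mathbb C^n$ be a bounded pseudoconvex domain (i.e. one that carries a smooth strictly plurisubharmonic exhaustion function), and let $z^0\in b\Omega$. Assume that in an open neighborhood $V$ of $z^0$ the boundary $b\Omega$ is smooth (near each point $q\in b\Omega\cap V$ there is a $C^\infty$ function $r$ with $\Omega=\{r<0\}$, $b\Omega=\{r=0\}$ and $dr\ne0$ on $b\Omega$), and that for every $q\in b\Omega\cap V$ the Levi form $\sum_{j,k}\frac{\partial^2 r(q)}{\partial z_j\partial\bar z_k}X_j\overline{Y}_k$, restricted to $T^{1,0}_q(b\Omega)=\{X:\sum_j \frac{\partial r}{\partial z_j}(q)X_j=0\}$, has rank $n-l-1$. Write $\zeta=(\zeta_1,\zeta',\zeta'')$ with $\zeta'=(\zeta_2,\dots,\zeta_{n-l})$, $\zeta''=(\zeta_{n-l+1},\dots,\zeta_n)$. Then there are an open neighborhood $U\subset\subset V$ of $z^0$, constants $C$ and $0<\varepsilon\le1$, and for each $p\in b\Omega\cap U$ an open set $N_p$ with $U\subset N_p\subset\subset V$, a biholomorphic map $\Phi_p$ from $N_p$ onto the unit ball $B(0,1)$,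 and positive numbers $\lambda_j(p)$, $2\le j\le n-l$, such that 1. $\Phi_p(p)=0$; 2. $\Phi_p$ depends smoothly on $p$: the map $(p,z)\mapsto\Phi_p(z)$ is $C^\infty$ on $\{(p,z):p\in b\Omega\cap U,\ z\in N_p\}$, and $(p,\zeta)\mapsto\Phi_p^{-1}(\zeta)$ is $C^\infty$ on $(b\Omega\cap U)\times B(0,1)$; 3. each $\lambda_j$ is $C^\infty$ on $b\Omega\cap U$, and for each $p\in b\Omega\cap U$ there is a $C^\infty$ function $\rho$ on $B(0,\varepsilon)$ such that, in $B(0,\varepsilon)$, $\Phi_p(\Omega\cap N_p)=\{\rho<0\}$, $\Phi_p(b\Omega\cap N_p)=\{\rho=0\}$, $d\rho\neq0$ on $\{\rho=0\}$, and $$\Big|\rho(\zeta)-\operatorname{Re}\zeta_1-\sum_{j=2}^{n-l}\lambda_j(p)|\zeta_j|^2\Big|\le C\big(|\zeta'|^2|\zeta''|+|\zeta'|^3+|\operatorname{Im}\zeta_1||\zeta|\big),\qquad \zeta\in B(0,\varepsilon).$$ -/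

import Mathlib

open Set Metric Module
open scoped ContDiff ComplexConjugate

noncomputable section

namespace LeviFoliation

/-- `ℂⁿ` with its Euclidean norm; the coordinates `z₁, …, zₙ` are indexed by `0, …, n - 1`. -/
abbrev Cn (n : ℕ) := EuclideanSpace ℂ (Fin n)

/-- The Wirtinger derivative `∂f/∂z_j = (∂f/∂x_j - i ∂f/∂y_j) / 2`. -/
def dz {n : ℕ} (j : Fin n) (f : Cn n → ℂ) (z : Cn n) : ℂ :=
  (1 / 2 : ℂ) * (fderiv ℝ f z (EuclideanSpace.single j 1)
    - Complex.I * fderiv ℝ f z (EuclideanSpace.single j Complex.I))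

/-- The Wirtinger derivative `∂f/∂z̄_j = (∂f/∂x_j + i ∂f/∂y_j) / 2`. -/
def dzbar {n : ℕ} (j : Fin n) (f : Cn n → ℂ) (z : Cn n) : ℂ :=
  (1 / 2 : ℂ) * (fderiv ℝ f z (EuclideanSpace.single j 1)
    + Complex.I * fderiv ℝ f z (EuclideanSpace.single j Complex.I))

/-- The complex Hessian `∂²r/∂z_j ∂z̄_k` at `z`. -/
def complexHessian {n : ℕ} (r : Cn n → ℝ) (z : Cn n) (j k : Fin n) : ℂ :=
  dz j (dzbar k (fun w => (r w : ℂ))) z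

/-- The Levi form `L_r(z; X, Y) = ∑_{j,k} (∂²r/∂z_j∂z̄_k)(z) X_j conj(Y_k)`, as a sesquilinear form
on `ℂⁿ` (linear in `X`, conjugate linear in `Y`). -/
def leviForm {n : ℕ} (r : Cn n → ℝ) (z : Cn n) : Cn n →ₗ[ℂ] Cn n →ₗ⋆[ℂ] ℂ :=
  LinearMap.mk₂'ₛₗ (RingHom.id ℂ) (starRingEnd ℂ)
    (fun X Y => ∑ j, ∑ k, complexHessian r z j k * X j * conj (Y k))
    (by
      intro X X' Y
      simp only [PiLp.add_apply, ← Finset.sum_add_distrib]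
      exact Finset.sum_congr rfl fun _ _ => Finset.sum_congr rfl fun _ _ => by ring)
    (by
      intro c X Y
      simp only [PiLp.smul_apply, smul_eq_mul, RingHom.id_apply, Finset.mul_sum]
      exact Finset.sum_congr rfl fun _ _ => Finset.sum_congr rfl fun _ _ => by ring)
    (by
      intro X Y Y'
      simp only [PiLp.add_apply, map_add, ← Finset.sum_add_distrib]
      exact Finset.sum_congr rfl fun _ _ => Finset.sum_congr rfl fun _ _ => by ring)
    (by
      intro c X Y
      simp only [PiLp.smul_apply, smul_eq_mul, map_mul, Finset.mul_sum]
      exact Finset.sum_congr rfl fun _ _ => Finset.sum_congr rfl fun _ _ => by ring)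

/-- The complex tangent space `T^{1,0}` at `z` of the level set of `r` through `z`:
the vectors `X` with `∑_j (∂r/∂z_j)(z) X_j = 0`. -/
def complexTangent {n : ℕ} (r : Cn n → ℝ) (z : Cn n) : Submodule ℂ (Cn n) where
  carrier := {X | ∑ j, dz j (fun w => (r w : ℂ)) z * X j = 0}
  add_mem' := by
    intro X Y hX hY
    simp only [mem_ofPred_eq, PiLp.add_apply, mul_add, Finset.sum_add_distrib] at *
    rw [hX, hY, add_zero]
  zero_mem' := by simp
  smul_mem' := by
    intro c X hX
    simp only [mem_ofPred_eq, PiLp.smul_apply, smul_eq_mul] at *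
    rw [← mul_zero c, ← hX, Finset.mul_sum]
    exact Finset.sum_congr rfl fun _ _ => by ring

/-- The rank of the (Hermitian) Levi form restricted to the complex tangent space, that is, the
number of its nonzero eigenvalues. -/
def leviRank {n : ℕ} (r : Cn n → ℝ) (z : Cn n) : ℕ :=
  finrank ℂ (LinearMap.range
    ((leviForm r z).domRestrict₁₂ (complexTangent r z) (complexTangent r z)))

/-- In the region `W`, the smooth function `r` defines the open side `D` and the hypersurface `S`:
`D = {r < 0}`, `S = {r = 0}`, and `dr ≠ 0` on `S`. -/
structure IsDefiningFunctionOn {n : ℕ} (W D S : Set (Cn n)) (r : Cn n → ℝ) : Prop where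
  smooth : ContDiffOn ℝ ∞ r W
  side : D ∩ W = {z ∈ W | r z < 0}
  hypersurface : S ∩ W = {z ∈ W | r z = 0}
  fderiv_ne_zero : ∀ z ∈ S ∩ W, fderiv ℝ r z ≠ 0

/-- The boundary of `Ω` is smooth in `V`: it has a smooth local defining function near each of its
points in `V`. -/
def SmoothBoundaryIn {n : ℕ} (Ω V : Set (Cn n)) : Prop :=
  ∀ q ∈ frontier Ω ∩ V, ∃ (W : Set (Cn n)) (r : Cn n → ℝ), IsOpen W ∧ q ∈ W ∧
    IsDefiningFunctionOn W Ω (frontier Ω) r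

/-- The boundary of `Ω` has Levi rank `k` at `q`. (The rank does not depend on the local defining
function.) -/
def HasLeviRank {n : ℕ} (Ω : Set (Cn n)) (q : Cn n) (k : ℕ) : Prop :=
  ∃ (W : Set (Cn n)) (r : Cn n → ℝ), IsOpen W ∧ q ∈ W ∧
    IsDefiningFunctionOn W Ω (frontier Ω) r ∧ leviRank r q = k

/-- An open set is pseudoconvex if it carries a smooth strictly plurisubharmonic exhaustion
function. -/
def IsPseudoconvex {n : ℕ} (Ω : Set (Cn n)) : Prop :=
  IsOpen Ω ∧ ∃ φ : Cn n → ℝ, ContDiffOn ℝ ∞ φ Ω ∧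
    (∀ z ∈ Ω, ∀ X : Cn n, X ≠ 0 → 0 < (leviForm φ z X X).re) ∧
    ∀ c : ℝ, IsCompact {z ∈ Ω | φ z ≤ c}

/-- `Φ` is a biholomorphic map from the open set `A` onto the open set `B`, with inverse `Ψ`. -/
structure IsBiholomorphic {n : ℕ} (Φ Ψ : Cn n → Cn n) (A B : Set (Cn n)) : Prop where
  isOpen_source : IsOpen A
  isOpen_target : IsOpen B
  mapsTo : MapsTo Φ A B
  mapsTo_inv : MapsTo Ψ B A
  invOn : InvOn Ψ Φ A B
  holomorphic : DifferentiableOn ℂ Φ A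
  holomorphic_inv : DifferentiableOn ℂ Ψ B

/-- The positions `2, …, n - l` of `ζ' = (ζ₂, …, ζ_{n-l})`. -/
def primeIdx (n l : ℕ) : Finset (Fin n) :=
  Finset.univ.filter fun j => 0 < j.val ∧ j.val + l < n

/-- The positions `n - l + 1, …, n` of `ζ'' = (ζ_{n-l+1}, …, ζ_n)`. -/
def doublePrimeIdx (n l : ℕ) : Finset (Fin n) :=
  Finset.univ.filter fun j => n ≤ j.val + l

/-- The Euclidean norm of the coordinates of `ζ` at the positions in `s`. -/
def partNorm {n : ℕ} (s : Finset (Fin n)) (ζ : Cn n) : ℝ :=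
  √(∑ j ∈ s, ‖ζ j‖ ^ 2)

end LeviFoliation

end

/-!
The construction is local. Near `z₀` the boundary has a defining function `r` that is affine in a
transversal direction (`exists_normalized_definingFunction`, `exists_boundary_function`). Its level
sets are then translates of the boundary, so that the Levi form of `r` has nullity `l` on all of
them and every statement can be proved on an open set instead of on the boundary. Pseudoconvexity is
used once: holomorphic discs and the maximum principle for the strictly plurisubharmonic exhaustion
show that the Levi form is positive semidefinite at `z₀` (`leviReal_nonneg_of_isPseudoconvex`).
Therefore linear coordinates exist in which it is the identity on the span of the `ζ'` directions
and has null space the span of the `ζ''` directions (`exists_isAdapted`).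

The Levi null spaces are the kernels of the closed two-form `d(dr ∘ i)` on the complex tangent
spaces. Closedness makes them an involutive distribution (`lieBracket_mem_nullSpace`), and they are
complex subspaces, so that they are tangent to a foliation of the level sets by complex manifolds of
dimension `l`. Their holomorphic parametrisations `G(p, ζ'')`, which depend smoothly on `p`, are
obtained from a Frobenius theorem with parameters (`exists_leaf_parametrization`,
`IsAdapted.exists_leaves`), proved by the implicit function theorem in a space of paths. Moreover
`∂r(v) / ∂r(e)` satisfies the Cauchy–Riemann equations along the null directions
(`fderiv_gauss_I_smul`), so that the complex tangent spaces vary holomorphically along a leaf.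

Consequently the map `Ψ_p(ζ) = G(p, ζ'') + (M_p ζ')ᵀ + (ζ₁ / 2∂r(p)(e) + b_p(ζ')) e` is holomorphic
in `ζ`. Here `uᵀ` is the tangential part of `u` at the point `G(p, ζ'')` of the leaf, `M_p` turns
the Levi form at `p` into `|ζ'|²` (`IsAdapted.exists_levi_normalization`, by the inverse of a square
root in a Banach algebra, which is smooth in `p`), and the quadratic polynomial `b_p` removes the
complex bilinear part of the Hessian at `p`. The inverse of `Ψ_p` is given by an explicit formula of
the same kind (`chart`).

In these coordinates `r ∘ Ψ_p` vanishes for `ζ₁ = 0`, `ζ' = 0`, has no first order terms in `ζ'` at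
the points of the leaf, and at `p` its second order part in `ζ'` is `|ζ'|²`; on the leaf that part
changes by `O(|ζ''| |ζ'|²)`. This gives the bound `O(|ζ'|²|ζ''| + |ζ'|³)` on the model hypersurface
`ζ₁ = -|ζ'|²` (`exists_third_order_bound`). To have no error term with the factor `Re ζ₁`, one
passes to a defining function `τ` with `τ(ζ + s e₁) = τ(ζ) + s` for real `s`. Its `Im ζ₁` derivative
vanishes at `0`, which produces the error `O(|Im ζ₁| |ζ|)` (`normal_form_bound`). Finally the
dilation by a small `δ`, the same for all `p`, makes the charts map onto the unit ball, with all
`λ_j` equal to `δ` (`IsAdapted.exists_scaled_charts`).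

Statements about germs are phrased with `∀ᶠ` near the base point, so that one neighbourhood is
chosen only at the end.
-/

noncomputable section

namespace LeviFoliation

open Filter Topology

/-! ### Smooth inverse functions and superposition operators on path spaces -/

section InverseFunction

variable {E F G : Type*} [NormedAddCommGroup E] [NormedSpace ℝ E] [CompleteSpace E]
  [NormedAddCommGroup F] [NormedSpace ℝ F] [CompleteSpace F]
  [NormedAddCommGroup G] [NormedSpace ℝ G] [CompleteSpace G]

omit [CompleteSpace F] in
/-- Inverse function theorem for germs of smooth maps: the inverse is smooth on a whole
neighbourhood, not only at the image point. -/
theorem exists_smooth_inverse {f : E → F} {a : E} {f' : E ≃L[ℝ] F}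
    (hf : ∀ᶠ x in 𝓝 a, ContDiffAt ℝ ∞ f x) (hf' : HasFDerivAt f (f' : E →L[ℝ] F) a) :
    ∃ e : OpenPartialHomeomorph E F, a ∈ e.source ∧ ⇑e = f ∧
      ∀ᶠ y in 𝓝 (f a), ContDiffAt ℝ ∞ e.symm y := by
  have hfa := hf.self_of_nhds
  refine ⟨hfa.toOpenPartialHomeomorph f hf' (by simp),
    hfa.mem_toOpenPartialHomeomorph_source hf' (by simp), rfl, ?_⟩
  set e := hfa.toOpenPartialHomeomorph f hf' (by simp) with he
  have hmem : a ∈ e.source := hfa.mem_toOpenPartialHomeomorph_source hf' (by simp)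
  have hsymm : Tendsto e.symm (𝓝 (f a)) (𝓝 a) := by
    have := e.continuousAt_symm (e.map_source hmem)
    rw [ContinuousAt, e.left_inv hmem] at this
    exact this
  have hequiv : ∀ᶠ x in 𝓝 a, ∃ g : E ≃L[ℝ] F, (g : E →L[ℝ] F) = fderiv ℝ f x := by
    have hc : ContinuousAt (fderiv ℝ f) a := hfa.continuousAt_fderiv (by simp)
    have hn : range ((↑) : (E ≃L[ℝ] F) → E →L[ℝ] F) ∈ 𝓝 (fderiv ℝ f a) := by
      rw [hf'.fderiv]; exact ContinuousLinearEquiv.nhds f'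
    exact hc.eventually hn
  filter_upwards [hsymm.eventually (hf.and hequiv), e.open_target.mem_nhds (e.map_source hmem)]
    with y ⟨hy1, g, hg⟩ hy2
  refine e.contDiffAt_symm (f₀' := g) hy2 ?_ hy1
  rw [hg]
  exact (hy1.differentiableAt (by simp)).hasFDerivAt

omit [CompleteSpace G] in
/-- Implicit function theorem for germs of smooth maps, with smoothness of the implicit function on
a whole neighbourhood. -/
theorem exists_smooth_implicit {f : E × F → G} {u : E × F}
    (hf : ∀ᶠ v in 𝓝 u, ContDiffAt ℝ ∞ f v) {f₂ : F ≃L[ℝ] G}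
    (h₂ : fderiv ℝ f u ∘L .inr ℝ E F = f₂) :
    ∃ φ : E → F, φ u.1 = u.2 ∧ (∀ᶠ x in 𝓝 u.1, ContDiffAt ℝ ∞ φ x) ∧
      ∀ᶠ v in 𝓝 u, f v = f u ↔ φ v.1 = v.2 := by
  let f₁ : E →L[ℝ] G := fderiv ℝ f u ∘L .inl ℝ E F
  have hfu := hf.self_of_nhds
  have hsplit : ∀ x y, fderiv ℝ f u (x, y) = f₁ x + f₂ y := by
    intro x y
    have e1 : f₁ x = fderiv ℝ f u (x, 0) := rfl
    have e2 : f₂ y = fderiv ℝ f u (0, y) := by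
      have := congrArg (fun L => L y) h₂
      simpa using this.symm
    rw [e1, e2, ← map_add]
    simp
  let g' : (E × F) ≃L[ℝ] (E × G) := ContinuousLinearEquiv.equivOfInverse
    ((ContinuousLinearMap.fst ℝ E F).prod (fderiv ℝ f u))
    ((ContinuousLinearMap.fst ℝ E G).prod
      ((f₂.symm : G →L[ℝ] F) ∘L (ContinuousLinearMap.snd ℝ E G - f₁ ∘L .fst ℝ E G)))
    (by
      rintro ⟨x, y⟩
      simp [hsplit])
    (by
      rintro ⟨x, y⟩
      simp [hsplit])
  have hg : ∀ᶠ v in 𝓝 u, ContDiffAt ℝ ∞ (fun v : E × F => (v.1, f v)) v := by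
    filter_upwards [hf] with v hv
    exact contDiffAt_fst.prodMk hv
  have hg' : HasFDerivAt (fun v : E × F => (v.1, f v)) (g' : E × F →L[ℝ] E × G) u :=
    hasFDerivAt_fst.prodMk (hfu.differentiableAt (by simp)).hasFDerivAt
  obtain ⟨e, hu, he, hsm⟩ := exists_smooth_inverse hg hg'
  have htgt : (u.1, f u) ∈ e.target := by
    have := e.map_source hu
    rwa [he] at this
  have hinv : e.symm (u.1, f u) = u := by
    have := e.left_inv hu
    rwa [he] at this
  have htend : Tendsto (fun x : E => (x, f u)) (𝓝 u.1) (𝓝 (u.1, f u)) :=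
    (Continuous.prodMk_left (f u)).tendsto _
  refine ⟨fun x => (e.symm (x, f u)).2, by simp [hinv], ?_, ?_⟩
  · filter_upwards [htend.eventually hsm] with x hx
    exact contDiffAt_snd.comp x (hx.comp x (contDiffAt_id.prodMk contDiffAt_const))
  · have h1 : ∀ᶠ v : E × F in 𝓝 u, (v.1, f u) ∈ e.target :=
      (htend.comp continuous_fst.continuousAt.tendsto).eventually
        (e.open_target.mem_nhds htgt)
    have hs : ∀ᶠ v : E × F in 𝓝 u, v ∈ e.source := e.open_source.mem_nhds hu
    filter_upwards [h1, hs] with v hv1 hv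
    have hev : e v = (v.1, f v) := by rw [he]
    constructor
    · intro h
      have := e.left_inv hv
      rw [hev, h] at this
      simp [this]
    · intro h
      have h3 := e.right_inv hv1
      have h4 : e (e.symm (v.1, f u)) = _ := congrFun he _
      rw [h3] at h4
      have h5 : e.symm (v.1, f u) = v := Prod.ext (by simpa using (congrArg Prod.fst h4).symm) h
      rw [h5] at h4
      exact (congrArg Prod.snd h4).symm

end InverseFunction

section Paths

open unitInterval

variable {E G A : Type} [NormedAddCommGroup A] [NormedSpace ℝ A]
  [NormedAddCommGroup E] [NormedSpace ℝ E]
  [NormedAddCommGroup G] [NormedSpace ℝ G]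

/-- The Banach space of continuous paths `[0, 1] → E` with the supremum norm. It is a copy of
`C(I, E)` whose topology and module structure are by definition those of the norm. -/
def PathSpace (E : Type) [NormedAddCommGroup E] : Type := C(I, E)

instance : NormedAddCommGroup (PathSpace E) := inferInstanceAs (NormedAddCommGroup C(I, E))

instance : NormedSpace ℝ (PathSpace E) := inferInstanceAs (NormedSpace ℝ C(I, E))

instance [CompleteSpace E] : CompleteSpace (PathSpace E) := inferInstanceAs (CompleteSpace C(I, E))

instance : FunLike (PathSpace E) I E := inferInstanceAs (FunLike C(I, E) I E)

namespace PathSpace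

omit [NormedSpace ℝ E] in
@[fun_prop] theorem continuous (γ : PathSpace E) : Continuous γ := ContinuousMap.continuous γ

/-- The path given by a continuous function. -/
def mk (f : I → E) (hf : Continuous f) : PathSpace E := (⟨f, hf⟩ : C(I, E))

omit [NormedSpace ℝ E] in
@[simp] theorem mk_apply (f : I → E) (hf : Continuous f) (t : I) : mk f hf t = f t := rfl

omit [NormedSpace ℝ E] in
@[ext] theorem ext {γ γ' : PathSpace E} (h : ∀ t, γ t = γ' t) : γ = γ' := ContinuousMap.ext h

omit [NormedSpace ℝ E] in
@[simp] theorem add_apply (γ γ' : PathSpace E) (t : I) : (γ + γ') t = γ t + γ' t := rfl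

omit [NormedSpace ℝ E] in
@[simp] theorem sub_apply (γ γ' : PathSpace E) (t : I) : (γ - γ') t = γ t - γ' t := rfl

omit [NormedSpace ℝ E] in
@[simp] theorem neg_apply (γ : PathSpace E) (t : I) : (-γ) t = -γ t := rfl

omit [NormedSpace ℝ E] in
@[simp] theorem zero_apply (t : I) : (0 : PathSpace E) t = 0 := rfl

@[simp] theorem smul_apply (c : ℝ) (γ : PathSpace E) (t : I) : (c • γ) t = c • γ t := rfl

omit [NormedSpace ℝ E] in
theorem norm_le {γ : PathSpace E} {C : ℝ} (hC : 0 ≤ C) : ‖γ‖ ≤ C ↔ ∀ t, ‖γ t‖ ≤ C :=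
  ContinuousMap.norm_le (f := (γ : C(I, E))) hC

omit [NormedSpace ℝ E] in
theorem norm_apply_le (γ : PathSpace E) (t : I) : ‖γ t‖ ≤ ‖γ‖ :=
  ContinuousMap.norm_coe_le_norm (f := (γ : C(I, E))) t

/-- The path constantly equal to a point. -/
def const : E →L[ℝ] PathSpace E :=
  LinearMap.mkContinuous
    { toFun := fun x => mk (fun _ => x) continuous_const
      map_add' := fun _ _ => rfl
      map_smul' := fun _ _ => rfl } 1
    (fun x => (norm_le (by positivity)).2 fun _ => (one_mul ‖x‖).ge)

@[simp] theorem const_apply (x : E) (t : I) : const x t = x := rfl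

/-- Evaluation of paths at a time. -/
def eval (t : I) : PathSpace E →L[ℝ] E :=
  LinearMap.mkContinuous
    { toFun := fun γ => γ t
      map_add' := fun _ _ => rfl
      map_smul' := fun _ _ => rfl } 1
    (fun γ => (norm_apply_le γ t).trans (one_mul _).ge)

@[simp] theorem eval_apply (γ : PathSpace E) (t : I) : eval t γ = γ t := rfl

end PathSpace

/-- Pointwise evaluation of a bounded bilinear map on two paths, as a bounded bilinear operation on
the spaces of continuous paths. -/
def pathBilin (B : A →L[ℝ] E →L[ℝ] G) : PathSpace A →L[ℝ] PathSpace E →L[ℝ] PathSpace G :=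
  LinearMap.mkContinuous₂
    (LinearMap.mk₂ ℝ (fun (α : PathSpace A) (γ : PathSpace E) =>
      PathSpace.mk (fun t => B (α t) (γ t)) (by fun_prop))
      (by intros; ext; simp) (by intros; ext; simp) (by intros; ext; simp) (by intros; ext; simp))
    ‖B‖ (by
      intro α γ
      rw [PathSpace.norm_le (by positivity)]
      intro t
      simp only [LinearMap.mk₂_apply, PathSpace.mk_apply]
      refine (B.le_opNorm₂ _ _).trans ?_
      gcongr
      · exact α.norm_apply_le t
      · exact γ.norm_apply_le t)

@[simp] theorem pathBilin_apply (B : A →L[ℝ] E →L[ℝ] G) (α : PathSpace A) (γ : PathSpace E)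
    (t : I) : pathBilin B α γ t = B (α t) (γ t) := rfl

theorem contDiff_pathBilin (B : A →L[ℝ] E →L[ℝ] G) {X : Type} [NormedAddCommGroup X]
    [NormedSpace ℝ X] {m : WithTop ℕ∞} {φ : X → PathSpace A} (hφ : ContDiff ℝ m φ) :
    ContDiff ℝ m fun x => pathBilin B (φ x) :=
  (pathBilin B).contDiff.comp hφ

/-- The superposition operator `γ ↦ f ∘ γ` on continuous paths. -/
def superposition (f : C(E, G)) (γ : PathSpace E) : PathSpace G :=
  PathSpace.mk (fun t => f (γ t)) (by fun_prop)

omit [NormedSpace ℝ E] [NormedSpace ℝ G] in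
@[simp] theorem superposition_apply (f : C(E, G)) (γ : PathSpace E) (t : I) :
    superposition f γ t = f (γ t) := rfl

omit [NormedSpace ℝ E] [NormedSpace ℝ G] in
theorem continuous_superposition (f : C(E, G)) : Continuous (superposition f) :=
  ContinuousMap.continuous_postcomp (X := I) f

theorem hasFDerivAt_superposition (B : A →L[ℝ] E →L[ℝ] G) (f : C(E, G)) (f' : C(E, A))
    (hf : ∀ x, HasFDerivAt f (B (f' x)) x) (γ : PathSpace E) :
    HasFDerivAt (superposition f) (pathBilin B (superposition f' γ)) γ := by
  rw [hasFDerivAt_iff_isLittleO_nhds_zero, Asymptotics.isLittleO_iff]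
  intro c hc
  have hB : 0 < ‖B‖ + 1 := by positivity
  obtain ⟨δ, hδ, hδ'⟩ := Metric.continuous_iff.1 (continuous_superposition f') γ (c / (‖B‖ + 1))
    (by positivity)
  filter_upwards [ball_mem_nhds (0 : PathSpace E) hδ] with h hh
  rw [PathSpace.norm_le (by positivity)]
  intro t
  have hseg : ∀ y ∈ segment ℝ (γ t) (γ t + h t), ‖B (f' y) - B (f' (γ t))‖ ≤ c := by
    intro y hy
    rw [segment_eq_image'] at hy
    obtain ⟨s, hs, rfl⟩ := hy
    have h1 : dist (superposition f' (γ + s • h)) (superposition f' γ) < c / (‖B‖ + 1) := by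
      apply hδ'
      rw [dist_eq_norm, add_sub_cancel_left, norm_smul, Real.norm_of_nonneg hs.1]
      rw [mem_ball_zero_iff] at hh
      calc s * ‖h‖ ≤ 1 * ‖h‖ := by gcongr; exact hs.2
        _ < δ := by simpa using hh
    have h2 := (PathSpace.norm_apply_le (superposition f' (γ + s • h) - superposition f' γ) t).trans
      ((dist_eq_norm _ _).symm.le.trans h1.le)
    have h3 : ‖f' (γ t + s • (γ t + h t - γ t)) - f' (γ t)‖ ≤ c / (‖B‖ + 1) := by
      simpa using h2
    rw [← map_sub]
    calc _ ≤ ‖B‖ * (c / (‖B‖ + 1)) := (B.le_opNorm _).trans (by gcongr)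
      _ ≤ (‖B‖ + 1) * (c / (‖B‖ + 1)) := by gcongr; linarith
      _ = c := by field_simp
  have hconv := convex_segment (𝕜 := ℝ) (γ t) (γ t + h t)
  have key := hconv.norm_image_sub_le_of_norm_hasFDerivWithin_le' (f := f)
    (f' := fun x => B (f' x)) (φ := B (f' (γ t))) (fun x _ => (hf x).hasFDerivWithinAt)
    hseg (left_mem_segment ℝ _ _) (right_mem_segment ℝ _ _)
  have h3 : ‖h t‖ ≤ ‖h‖ := h.norm_apply_le t
  have h4 : (superposition f (γ + h) - superposition f γ - (pathBilin B (superposition f' γ)) h) t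
      = f (γ t + h t) - f (γ t) - B (f' (γ t)) (γ t + h t - γ t) := by
    simp
  rw [h4]
  exact key.trans (by simpa using mul_le_mul_of_nonneg_left h3 hc.le)

/-- The superposition operator inherits the smoothness of `f`, because its derivative is again given
by a superposition operator, that of the derivative of `f`. -/
theorem contDiff_superposition_nat (m : ℕ) :
    ∀ {G : Type} [NormedAddCommGroup G] [NormedSpace ℝ G] (f : C(E, G)) (_ : ContDiff ℝ m f),
    ContDiff ℝ m (superposition f) := by
  induction m with
  | zero =>
    intro G _ _ f _
    exact contDiff_zero.2 (continuous_superposition f)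
  | succ m ih =>
    intro G _ _ f hf
    obtain ⟨f', hf', hd⟩ := contDiff_succ_iff_hasFDerivAt.1 (by exact_mod_cast hf)
    let f₁ : C(E, E →L[ℝ] G) := ⟨f', hf'.continuous⟩
    have h1 : ContDiff ℝ m (superposition f₁) := ih f₁ hf'
    let B : (E →L[ℝ] G) →L[ℝ] E →L[ℝ] G := ContinuousLinearMap.id ℝ (E →L[ℝ] G)
    have h2 : ContDiff ℝ m fun γ => pathBilin B (superposition f₁ γ) := contDiff_pathBilin B h1
    have h3 : ∀ γ, HasFDerivAt (superposition f) (pathBilin B (superposition f₁ γ)) γ :=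
      fun γ => hasFDerivAt_superposition B f f₁ hd γ
    have h2 : ContDiff ℝ (m + 1) (superposition f) :=
      contDiff_succ_iff_hasFDerivAt.2 ⟨_, h2, h3⟩
    exact_mod_cast h2

theorem contDiff_superposition (f : C(E, G)) (hf : ContDiff ℝ ∞ f) :
    ContDiff ℝ ∞ (superposition f) :=
  contDiff_infty.2 fun m => contDiff_superposition_nat m f (contDiff_infty.1 hf m)

theorem exists_hasFDerivAt_superposition (f : C(E, G)) (hf : ContDiff ℝ ∞ f) (γ : PathSpace E) :
    ∃ L : PathSpace E →L[ℝ] PathSpace G, HasFDerivAt (superposition f) L γ ∧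
      ∀ δ t, L δ t = fderiv ℝ f (γ t) (δ t) := by
  let f₁ : C(E, E →L[ℝ] G) := ⟨fderiv ℝ f, hf.continuous_fderiv (by simp)⟩
  let B : (E →L[ℝ] G) →L[ℝ] E →L[ℝ] G := ContinuousLinearMap.id ℝ (E →L[ℝ] G)
  exact ⟨_, hasFDerivAt_superposition B f f₁
    (fun x => ((hf.differentiable (by simp)) x).hasFDerivAt) γ, fun _ _ => rfl⟩

/-- Integration `γ ↦ (t ↦ ∫₀ᵗ γ)` as a bounded operator on continuous paths. -/
def pathIntegral [CompleteSpace E] : PathSpace E →L[ℝ] PathSpace E :=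
  LinearMap.mkContinuous
    { toFun := fun γ => PathSpace.mk (fun t => ∫ s in (0 : ℝ)..t, IccExtend zero_le_one γ s) (by
        have h : Continuous (IccExtend zero_le_one γ : ℝ → E) := γ.continuous.Icc_extend'
        have := intervalIntegral.continuous_primitive (μ := MeasureTheory.volume)
          (fun a b => h.intervalIntegrable a b) 0
        exact this.comp continuous_subtype_val)
      map_add' := by
        intro γ γ'
        ext t
        have h : Continuous (IccExtend zero_le_one γ : ℝ → E) := γ.continuous.Icc_extend'
        have h' : Continuous (IccExtend zero_le_one γ' : ℝ → E) := γ'.continuous.Icc_extend'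
        exact intervalIntegral.integral_add (h.intervalIntegrable _ _) (h'.intervalIntegrable _ _)
      map_smul' := by
        intro c γ
        ext t
        exact intervalIntegral.integral_smul c _ }
    1 (by
      intro γ
      rw [PathSpace.norm_le (by positivity)]
      intro t
      simp only [LinearMap.coe_mk, AddHom.coe_mk, PathSpace.mk_apply, one_mul]
      have := intervalIntegral.norm_integral_le_of_norm_le_const (a := 0) (b := (t : ℝ)) (C := ‖γ‖)
        (f := IccExtend zero_le_one γ) (fun x _ => γ.norm_apply_le _)
      refine this.trans ?_
      rw [sub_zero, abs_of_nonneg t.2.1]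
      exact mul_le_of_le_one_right (norm_nonneg _) t.2.2)

theorem pathIntegral_apply [CompleteSpace E] (γ : PathSpace E) (t : I) :
    pathIntegral γ t = ∫ s in (0 : ℝ)..t, IccExtend zero_le_one γ s := rfl

end Paths

/-! ### The Frobenius theorem with smooth dependence on the initial point -/

section Frobenius

open unitInterval

/-- A smooth germ extends to a globally smooth function, by a cutoff. -/
theorem exists_contDiff_eventuallyEq {E G : Type*} [NormedAddCommGroup E] [NormedSpace ℝ E]
    [FiniteDimensional ℝ E] [NormedAddCommGroup G] [NormedSpace ℝ G] {f : E → G} {x₀ : E}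
    (hf : ∀ᶠ x in 𝓝 x₀, ContDiffAt ℝ ∞ f x) :
    ∃ g : E → G, ContDiff ℝ ∞ g ∧ g =ᶠ[𝓝 x₀] f := by
  obtain ⟨R, hR, hRf⟩ := Metric.eventually_nhds_iff_ball.1 hf
  let χ : ContDiffBump x₀ := ⟨R / 3, R / 2, by positivity, by linarith⟩
  refine ⟨fun x => χ x • f x, ?_, ?_⟩
  · rw [contDiff_iff_contDiffAt]
    intro x
    by_cases hx : x ∈ ball x₀ R
    · exact χ.contDiff.contDiffAt.smul (hRf x hx)
    · have hx' : x ∈ (closedBall x₀ (R / 2))ᶜ := by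
        simp only [mem_compl_iff, mem_closedBall, mem_ball, not_le, not_lt] at *
        linarith
      have : (fun x => χ x • f x) =ᶠ[𝓝 x] fun _ => 0 := by
        filter_upwards [isClosed_closedBall.isOpen_compl.mem_nhds hx'] with y hy
        have : χ y = 0 := χ.zero_of_le_dist (by
          simp only [mem_compl_iff, mem_closedBall, not_le] at hy
          exact hy.le)
        simp [this]
      exact contDiffAt_const.congr_of_eventuallyEq this
  · filter_upwards [χ.eventuallyEq_one] with x hx
    simp [hx]

variable {E : Type} [NormedAddCommGroup E] [NormedSpace ℝ E] [CompleteSpace E]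

/-- The defect of the path `γ` as a solution of `γ' = F(γ) v`, `γ(0) = p`, in integrated form. -/
def pathEquation (F : C(E, E →L[ℝ] E)) (x : (E × E) × PathSpace E) : PathSpace E :=
  x.2 - PathSpace.const x.1.1 -
    pathIntegral (pathBilin (.id ℝ (E →L[ℝ] E)) (superposition F x.2) (PathSpace.const x.1.2))

theorem contDiff_pathEquation {F : C(E, E →L[ℝ] E)} (hF : ContDiff ℝ ∞ F) :
    ContDiff ℝ ∞ (pathEquation F) := by
  have h1 : ContDiff ℝ ∞ fun x : (E × E) × PathSpace E => superposition F x.2 :=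
    (contDiff_superposition F hF).comp contDiff_snd
  have h2 : ContDiff ℝ ∞ fun x : (E × E) × PathSpace E => PathSpace.const x.1.2 :=
    PathSpace.const.contDiff.comp (contDiff_snd.comp contDiff_fst)
  have h3 : ContDiff ℝ ∞ fun x : (E × E) × PathSpace E => PathSpace.const x.1.1 :=
    PathSpace.const.contDiff.comp (contDiff_fst.comp contDiff_fst)
  have h4 := (contDiff_pathBilin (.id ℝ (E →L[ℝ] E)) h1).clm_apply h2
  exact (contDiff_snd.sub h3).sub (pathIntegral.contDiff.comp h4)

theorem fderiv_pathEquation {F : C(E, E →L[ℝ] E)} (hF : ContDiff ℝ ∞ F)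
    (x y : (E × E) × PathSpace E) :
    fderiv ℝ (pathEquation F) x y = y.2 - PathSpace.const y.1.1 -
      pathIntegral (PathSpace.mk
        (fun t => fderiv ℝ F (x.2 t) (y.2 t) x.1.2 + F (x.2 t) y.1.2) (by
          have := hF.continuous_fderiv (by simp)
          fun_prop)) := by
  obtain ⟨L, hL, hL'⟩ := exists_hasFDerivAt_superposition F hF x.2
  have h1 : HasFDerivAt (fun x : (E × E) × PathSpace E => superposition F x.2)
      (L ∘L .snd ℝ (E × E) (PathSpace E)) x := hL.comp x hasFDerivAt_snd
  have h2 : HasFDerivAt (fun x : (E × E) × PathSpace E => PathSpace.const x.1.2)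
      (PathSpace.const ∘L .snd ℝ E E ∘L .fst ℝ (E × E) (PathSpace E)) x :=
    (PathSpace.const ∘L .snd ℝ E E ∘L .fst ℝ (E × E) (PathSpace E)).hasFDerivAt
  have h3 : HasFDerivAt (fun x : (E × E) × PathSpace E => PathSpace.const x.1.1)
      (PathSpace.const ∘L .fst ℝ E E ∘L .fst ℝ (E × E) (PathSpace E)) x :=
    (PathSpace.const ∘L .fst ℝ E E ∘L .fst ℝ (E × E) (PathSpace E)).hasFDerivAt
  have h4 := (pathBilin (.id ℝ (E →L[ℝ] E))).hasFDerivAt_of_bilinear h1 h2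
  have h5 : HasFDerivAt (pathEquation F) _ x :=
    (hasFDerivAt_snd.sub h3).sub (pathIntegral.hasFDerivAt.comp x h4)
  rw [h5.fderiv]
  change y.2 - PathSpace.const y.1.1 - pathIntegral _ = _
  congr 2
  ext t
  change F (x.2 t) y.1.2 + L y.2 t x.1.2 = _
  rw [add_comm, PathSpace.mk_apply, hL']

/-- A path solving the linearised equation along a leaf: if `γ' = F(γ) v` and the fields
`F(·) v` and `F(·) w` commute along `γ`, then `t ↦ t F(γ(t)) w` solves the equation obtained by
varying `v` in the direction `w`. -/
theorem fderiv_pathEquation_eq_zero {F : C(E, E →L[ℝ] E)} (hF : ContDiff ℝ ∞ F) {p v w : E}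
    {γ : PathSpace E} (hγ : pathEquation F ((p, v), γ) = 0)
    (hcomm : ∀ t, fderiv ℝ F (γ t) (F (γ t) v) w = fderiv ℝ F (γ t) (F (γ t) w) v) :
    fderiv ℝ (pathEquation F) ((p, v), γ)
      ((0, w), PathSpace.mk (fun t => (t : ℝ) • F (γ t) w) (by fun_prop)) = 0 := by
  rw [fderiv_pathEquation hF]
  ext t
  simp only [PathSpace.sub_apply, PathSpace.mk_apply, PathSpace.const_apply, sub_zero,
    PathSpace.zero_apply, pathIntegral_apply]
  set γe : ℝ → E := IccExtend zero_le_one γ with hγe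
  have hγec : Continuous γe := γ.continuous.Icc_extend'
  let c : ℝ → E := fun s => p + ∫ u in (0 : ℝ)..s, F (γe u) v
  have hc : ∀ s, HasDerivAt c (F (γe s) v) s := fun s =>
    (intervalIntegral.integral_hasDerivAt_right
      (((F.continuous.comp hγec).clm_apply continuous_const).intervalIntegrable _ _)
      (((F.continuous.comp hγec).clm_apply
        continuous_const).aestronglyMeasurable.stronglyMeasurableAtFilter)
      ((F.continuous.comp hγec).clm_apply continuous_const).continuousAt).const_add p
  have hce : ∀ s ∈ Icc (0 : ℝ) 1, c s = γe s := by
    intro s hs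
    have h := congrArg (fun γ => γ ⟨s, hs⟩) hγ
    simp only [pathEquation, PathSpace.sub_apply, PathSpace.const_apply, PathSpace.zero_apply,
      pathIntegral_apply] at h
    have h2 : γe s = γ ⟨s, hs⟩ := IccExtend_of_mem _ _ hs
    rw [h2]
    rw [sub_sub, sub_eq_zero] at h
    exact h.symm
  have hd : ∀ s ∈ uIcc (0 : ℝ) t, HasDerivAt (fun s => s • F (c s) w)
      (IccExtend zero_le_one (fun u : I =>
        fderiv ℝ F (γ u) ((u : ℝ) • F (γ u) w) v + F (γ u) w) s) s := by
    intro s hs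
    rw [uIcc_of_le t.2.1] at hs
    have hs1 : s ∈ Icc (0 : ℝ) 1 := ⟨hs.1, hs.2.trans t.2.2⟩
    have h2 : γe s = γ ⟨s, hs1⟩ := IccExtend_of_mem _ _ hs1
    have h3 : HasDerivAt (fun s => F (c s)) (fderiv ℝ F (c s) (F (γe s) v)) s :=
      ((hF.differentiable (by simp)) (c s)).hasFDerivAt.comp_hasDerivAt s (hc s)
    have h4 := (hasDerivAt_id s).smul (h3.clm_apply (hasDerivAt_const s w))
    refine h4.congr_deriv ?_
    rw [IccExtend_of_mem _ _ hs1, hce s hs1, h2]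
    simp [hcomm]
  have hcont : Continuous (IccExtend zero_le_one (fun u : I =>
        fderiv ℝ F (γ u) ((u : ℝ) • F (γ u) w) v + F (γ u) w)) := by
    refine Continuous.Icc_extend' ?_
    have := hF.continuous_fderiv (by simp)
    fun_prop
  have key := intervalIntegral.integral_eq_sub_of_hasDerivAt hd (hcont.intervalIntegrable _ _)
  have h2 : γe t = γ t := IccExtend_val _ _ t
  rw [hce t t.2, h2, zero_smul, sub_zero] at key
  exact sub_eq_zero.2 key.symm

/-- Local Frobenius theorem with smooth dependence on the initial point, for a distribution given
as the range of `F(q)`: when the fields `F(·) v` commute, the system `D_v G = F(G)`, `G(p, 0) = p`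
has a solution that is smooth in `(p, v)`. -/
theorem exists_leaf_parametrization {E : Type} [NormedAddCommGroup E] [NormedSpace ℝ E]
    [FiniteDimensional ℝ E] {F : E → E →L[ℝ] E} {z₀ : E}
    (hF : ∀ᶠ q in 𝓝 z₀, ContDiffAt ℝ ∞ F q)
    (hcomm : ∀ᶠ q in 𝓝 z₀, ∀ v w, fderiv ℝ F q (F q v) w = fderiv ℝ F q (F q w) v) :
    ∃ G : E × E → E, (∀ᶠ x in 𝓝 (z₀, (0 : E)), ContDiffAt ℝ ∞ G x) ∧
      (∀ᶠ p in 𝓝 z₀, G (p, 0) = p) ∧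
      ∀ᶠ x in 𝓝 (z₀, (0 : E)), HasFDerivAt (fun v => G (x.1, v)) (F (G x)) x.2 := by
  have : CompleteSpace E := FiniteDimensional.complete ℝ E
  obtain ⟨F₁, hF₁, hFF⟩ := exists_contDiff_eventuallyEq hF
  let Fc : C(E, E →L[ℝ] E) := ⟨F₁, hF₁.continuous⟩
  have hFc : ContDiff ℝ ∞ Fc := hF₁
  have hsm := contDiff_pathEquation hFc
  let u : (E × E) × PathSpace E := ((z₀, 0), PathSpace.const z₀)
  have hconst : ∀ p, pathEquation Fc ((p, 0), PathSpace.const p) = 0 := by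
    intro p
    simp [pathEquation]
  have hu : pathEquation Fc u = 0 := hconst z₀
  have h₂ : fderiv ℝ (pathEquation Fc) u ∘L .inr ℝ (E × E) (PathSpace E) =
      (ContinuousLinearEquiv.refl ℝ (PathSpace E) : PathSpace E →L[ℝ] PathSpace E) := by
    ext1 y
    rw [ContinuousLinearMap.comp_apply, fderiv_pathEquation hFc]
    have : (PathSpace.mk (fun t => fderiv ℝ Fc (u.2 t) (y t) u.1.2 + Fc (u.2 t) (0 : E)) (by
          have := hFc.continuous_fderiv (by simp)
          fun_prop)) = 0 := by
      ext t
      simp [u]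
    simp only [ContinuousLinearMap.inr_apply, Prod.fst_zero, Prod.snd_zero]
    rw [this]
    simp
  -- at `v = 0` the equation is `γ = p`, whose derivative in `γ` is the identity: solve for `γ`
  obtain ⟨φ, hφ0, hφs, hφ⟩ := exists_smooth_implicit
    (Eventually.of_forall fun v => hsm.contDiffAt) h₂
  rw [hu] at hφ
  have hφc : Tendsto φ (𝓝 (z₀, 0)) (𝓝 (PathSpace.const z₀)) := by
    have := hφs.self_of_nhds.continuousAt
    rw [ContinuousAt, hφ0] at this
    exact this
  have hφt : Tendsto (fun x => (x, φ x)) (𝓝 (z₀, 0)) (𝓝 u) := by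
    rw [show 𝓝 u = 𝓝 (z₀, (0 : E)) ×ˢ 𝓝 (PathSpace.const z₀) from nhds_prod_eq]
    exact tendsto_id.prodMk hφc
  have hsol : ∀ᶠ x in 𝓝 (z₀, (0 : E)), pathEquation Fc (x, φ x) = 0 := by
    filter_upwards [hφt.eventually hφ] with x hx
    exact hx.2 rfl
  -- near the constant path at `z₀` the linearised equation has only the zero solution
  have hinj : ∀ᶠ x in 𝓝 (z₀, (0 : E)), ∀ y,
      fderiv ℝ (pathEquation Fc) (x, φ x) ((0 : E × E), y) = 0 → y = 0 := by
    have hc : Continuous fun x => fderiv ℝ (pathEquation Fc) x ∘L .inr ℝ (E × E) (PathSpace E) :=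
      (hsm.continuous_fderiv (by simp)).clm_comp continuous_const
    have hn : range ((↑) : (PathSpace E ≃L[ℝ] PathSpace E) → PathSpace E →L[ℝ] PathSpace E) ∈
        𝓝 (fderiv ℝ (pathEquation Fc) u ∘L .inr ℝ (E × E) (PathSpace E)) := by
      rw [h₂]; exact ContinuousLinearEquiv.nhds _
    filter_upwards [((hc.tendsto u).comp hφt).eventually hn] with x hx y hy
    obtain ⟨g, hg⟩ := hx
    have h3 : g y = 0 := by
      have := congrArg (fun L => L y) hg
      exact this.trans hy
    simpa using h3
  -- paths close to the constant path stay where `F` is smooth and the fields commute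
  have hclose : ∀ᶠ x in 𝓝 (z₀, (0 : E)), ∀ t, F₁ =ᶠ[𝓝 (φ x t)] F ∧
      ∀ v w, fderiv ℝ F (φ x t) (F (φ x t) v) w = fderiv ℝ F (φ x t) (F (φ x t) w) v := by
    obtain ⟨R, hR, h⟩ := Metric.eventually_nhds_iff_ball.1 (hFF.eventually_nhds.and hcomm)
    filter_upwards [hφc.eventually (ball_mem_nhds _ hR)] with x hx t
    refine h _ ?_
    rw [dist_eq_norm] at hx
    rw [mem_ball_iff_norm]
    exact (PathSpace.norm_apply_le (φ x - PathSpace.const z₀) t).trans_lt hx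
  refine ⟨fun x => PathSpace.eval 1 (φ x), ?_, ?_, ?_⟩
  · filter_upwards [hφs] with x hx
    exact (PathSpace.eval 1).contDiff.contDiffAt.comp x hx
  · have ht : Tendsto (fun p : E => (((p, 0), PathSpace.const p) : (E × E) × PathSpace E))
        (𝓝 z₀) (𝓝 u) := by
      refine Continuous.tendsto' (f := fun p : E =>
        (((p, 0), PathSpace.const p) : (E × E) × PathSpace E)) ?_ _ _ rfl
      have := (PathSpace.const (E := E)).continuous
      fun_prop
    filter_upwards [ht.eventually hφ] with p hp
    rw [hp.1 (hconst p)]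
    simp
  · filter_upwards [hφs, hsol.eventually_nhds, hinj, hclose] with x hx1 hx2 hx3 hx4
    have hd : HasFDerivAt φ (fderiv ℝ φ x) x := (hx1.differentiableAt (by simp)).hasFDerivAt
    -- the derivative of the solution solves the linearised equation
    have hzero : ∀ y, fderiv ℝ (pathEquation Fc) (x, φ x) (y, fderiv ℝ φ x y) = 0 := by
      intro y
      have h1 : HasFDerivAt (fun x => pathEquation Fc (x, φ x)) _ x :=
        HasFDerivAt.comp (g := pathEquation Fc) (f := fun x => (x, φ x)) x
          ((hsm.differentiable (by simp)) (x, φ x)).hasFDerivAt ((hasFDerivAt_id x).prodMk hd)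
      have h2 : HasFDerivAt (fun x => pathEquation Fc (x, φ x)) (0 : E × E →L[ℝ] PathSpace E) x :=
        (hasFDerivAt_const (0 : PathSpace E) x).congr_of_eventuallyEq hx2
      have := congrArg (fun L => L y) (h1.unique h2)
      simpa using this
    -- so does `t ↦ t F(γ(t)) w`, and solutions are unique; `G` is the value at time `1`
    have hval : ∀ w, fderiv ℝ φ x (0, w) =
        PathSpace.mk (fun t => (t : ℝ) • Fc (φ x t) w) (by fun_prop) := by
      intro w
      have h1 := fderiv_pathEquation_eq_zero hFc (p := x.1) (v := x.2) (w := w) (γ := φ x)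
        hx2.self_of_nhds (by
          intro t
          obtain ⟨h1, h2⟩ := hx4 t
          have h3 : Fc (φ x t) = F (φ x t) := h1.self_of_nhds
          have h4 : fderiv ℝ Fc (φ x t) = fderiv ℝ F (φ x t) := h1.fderiv_eq
          rw [h3, h4]
          exact h2 _ _)
      have h2 := hzero (0, w)
      rw [← sub_eq_zero]
      apply hx3
      rw [show ((0 : E × E), fderiv ℝ φ x (0, w) - PathSpace.mk (fun t => (t : ℝ) • Fc (φ x t) w)
          (by fun_prop)) = ((0, w), fderiv ℝ φ x (0, w)) - ((0, w), PathSpace.mk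
          (fun t => (t : ℝ) • Fc (φ x t) w) (by fun_prop)) by simp, map_sub, h2, sub_eq_zero]
      exact h1.symm
    have hd2 : HasFDerivAt (fun v => PathSpace.eval 1 (φ (x.1, v))) _ x.2 :=
      (PathSpace.eval 1).hasFDerivAt.comp x.2
        (HasFDerivAt.comp (g := φ) x.2 hd (hasFDerivAt_prodMk_right x.1 x.2))
    refine hd2.congr_fderiv ?_
    ext w
    have h3 : Fc (φ x 1) = F (φ x 1) := (hx4 1).1.self_of_nhds
    simp [hval, h3]

end Frobenius

/-! ### Normalised defining functions and a uniform Taylor bound -/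

section NormalizedDefiningFunction

variable {X : Type*} [NormedAddCommGroup X] [NormedSpace ℝ X]

/-- A function that increases in the direction `e` can be replaced by a defining function `τ` of
the same hypersurface which satisfies `τ (x + s e) = τ x + s`: `τ x` is the parameter `t` at which
the line `t ↦ x - t e` meets the hypersurface. -/
theorem exists_normalized_definingFunction [CompleteSpace X] {R : X → ℝ} {x₀ e : X}
    (hR : ∀ᶠ x in 𝓝 x₀, ContDiffAt ℝ ∞ R x) (h0 : R x₀ = 0) (he : 0 < fderiv ℝ R x₀ e) :
    ∃ τ : X → ℝ, τ x₀ = 0 ∧ (∀ᶠ x in 𝓝 x₀, ContDiffAt ℝ ∞ τ x) ∧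
      (∃ c > 0, ∀ᶠ x in 𝓝 x₀, ∃ k, c ≤ k ∧ R x = k * τ x) ∧
      (∀ᶠ y in 𝓝 (x₀, (0 : ℝ)), τ (y.1 + y.2 • e) = τ y.1 + y.2) ∧
      ∀ᶠ x in 𝓝 x₀, τ x = 0 → ∀ v, fderiv ℝ R x e * fderiv ℝ τ x v = fderiv ℝ R x v := by
  let σ : X × ℝ → X := fun y => y.1 - y.2 • e
  have hσ : ContDiff ℝ ∞ σ := contDiff_fst.sub (contDiff_snd.smul contDiff_const)
  have hσ0 : σ (x₀, 0) = x₀ := by simp [σ]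
  have hσt : Tendsto σ (𝓝 (x₀, 0)) (𝓝 x₀) := hσ.continuous.tendsto' _ _ hσ0
  have hσd : ∀ y, HasFDerivAt σ (.fst ℝ X ℝ - (ContinuousLinearMap.snd ℝ X ℝ).smulRight e) y :=
    fun y => (ContinuousLinearMap.fst ℝ X ℝ -
      (ContinuousLinearMap.snd ℝ X ℝ).smulRight e).hasFDerivAt
  have hf : ∀ᶠ y in 𝓝 (x₀, (0 : ℝ)), ContDiffAt ℝ ∞ (fun y => R (σ y)) y := by
    filter_upwards [hσt.eventually hR] with y hy
    exact hy.comp y hσ.contDiffAt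
  have hR0 := hR.self_of_nhds
  have hfd : fderiv ℝ (fun y => R (σ y)) (x₀, 0) =
      fderiv ℝ R x₀ ∘L (.fst ℝ X ℝ - (ContinuousLinearMap.snd ℝ X ℝ).smulRight e) := by
    have h1 : HasFDerivAt R (fderiv ℝ R x₀) (σ (x₀, 0)) := by
      rw [hσ0]; exact (hR0.differentiableAt (by simp)).hasFDerivAt
    exact (h1.comp (x₀, (0 : ℝ)) (hσd _)).fderiv
  let f₂ : ℝ ≃L[ℝ] ℝ := ContinuousLinearEquiv.unitsEquivAut ℝ
    (Units.mk0 (-fderiv ℝ R x₀ e) (by linarith [he]))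
  obtain ⟨τ, hτ0, hτs, hτ⟩ := exists_smooth_implicit (u := (x₀, (0 : ℝ))) hf (f₂ := f₂) (by
    rw [hfd]
    ext
    simp [f₂])
  simp only [hσ0, h0] at hτ hτ0 hτs
  have hτt : Tendsto τ (𝓝 x₀) (𝓝 0) := by
    have := hτs.self_of_nhds.continuousAt
    rwa [ContinuousAt, hτ0] at this
  have hgr : Tendsto (fun x => (x, τ x)) (𝓝 x₀) (𝓝 (x₀, 0)) := by
    rw [nhds_prod_eq]; exact tendsto_id.prodMk hτt
  have hsol : ∀ᶠ x in 𝓝 x₀, R (x - τ x • e) = 0 := by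
    filter_upwards [hgr.eventually hτ] with x hx
    exact hx.2 rfl
  refine ⟨τ, hτ0, hτs, ⟨fderiv ℝ R x₀ e / 2, by linarith, ?_⟩, ?_, ?_⟩
  · have hc : ContinuousAt (fderiv ℝ R) x₀ := hR0.continuousAt_fderiv (by simp)
    have h1 : ∀ᶠ x in 𝓝 x₀, fderiv ℝ R x₀ e / 2 < fderiv ℝ R x e :=
      (hc.clm_apply continuousAt_const).eventually (lt_mem_nhds (by linarith))
    obtain ⟨r, hr, hball⟩ := Metric.eventually_nhds_iff_ball.1 (hR.and h1)
    filter_upwards [ball_mem_nhds x₀ hr, (hσt.comp hgr).eventually (ball_mem_nhds x₀ hr), hsol]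
      with x hx1 hx2 hx3
    obtain ⟨z, hz, hz'⟩ := domain_mvt (f := R) (f' := fderiv ℝ R) (s := ball x₀ r)
      (x := x - τ x • e) (y := x)
      (fun y hy => ((hball y hy).1.differentiableAt (by simp)).hasFDerivAt.hasFDerivWithinAt)
      (convex_ball x₀ r) hx2 hx1
    refine ⟨fderiv ℝ R z e, (hball z ((convex_ball x₀ r).segment_subset hx2 hx1 hz)).2.le, ?_⟩
    rw [hx3, sub_zero, sub_sub_cancel, map_smul, smul_eq_mul] at hz'
    rw [hz', mul_comm]
  · have ht : Tendsto (fun y : X × ℝ => (y.1 + y.2 • e, τ y.1 + y.2)) (𝓝 (x₀, 0))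
        (𝓝 (x₀, 0)) := by
      have h1 : Tendsto (fun y : X × ℝ => y.1 + y.2 • e) (𝓝 (x₀, 0)) (𝓝 x₀) :=
        Continuous.tendsto' (by fun_prop) _ _ (by simp)
      have h2 : Tendsto (fun y : X × ℝ => τ y.1 + y.2) (𝓝 (x₀, 0)) (𝓝 0) := by
        have h3 : Tendsto (fun y : X × ℝ => y.1) (𝓝 (x₀, 0)) (𝓝 x₀) :=
          continuous_fst.tendsto' _ _ rfl
        have h4 : Tendsto (fun y : X × ℝ => y.2) (𝓝 (x₀, 0)) (𝓝 0) :=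
          continuous_snd.tendsto' _ _ rfl
        simpa using (hτt.comp h3).add h4
      exact (nhds_prod_eq (x := x₀) (y := (0 : ℝ))) ▸ h1.prodMk h2
    have hfst : Tendsto (fun y : X × ℝ => y.1) (𝓝 (x₀, 0)) (𝓝 x₀) := continuous_fst.tendsto' _ _ rfl
    filter_upwards [ht.eventually hτ, hfst.eventually hsol] with y hy1 hy2
    refine hy1.1 ?_
    rw [← hy2]
    congr 1
    simp only [σ]
    module
  · filter_upwards [hR, hτs, hsol.eventually_nhds] with x hRx hτx hx h0x v
    have hd : HasFDerivAt τ (fderiv ℝ τ x) x := (hτx.differentiableAt (by simp)).hasFDerivAt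
    have h1 : HasFDerivAt R (fderiv ℝ R x) (x - τ x • e) := by
      rw [h0x, zero_smul, sub_zero]; exact (hRx.differentiableAt (by simp)).hasFDerivAt
    have h2 : HasFDerivAt (fun x => R (x - τ x • e)) _ x :=
      h1.comp x ((hasFDerivAt_id x).sub (hd.smul_const e))
    have h3 : HasFDerivAt (fun x => R (x - τ x • e)) (0 : X →L[ℝ] ℝ) x :=
      (hasFDerivAt_const (0 : ℝ) x).congr_of_eventuallyEq hx
    have := congrArg (fun L => L v) (h2.unique h3)
    simp at this
    linarith

/-- Second order Taylor expansion with a remainder that is uniform in the base point. -/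
theorem exists_taylor_bound {f : X → ℝ} {z₀ : X} (hf : ContDiffAt ℝ ∞ f z₀) :
    ∃ C > 0, ∀ᶠ y in 𝓝 (z₀, (0 : X)), |f (y.1 + y.2) - f y.1 - fderiv ℝ f y.1 y.2 -
      1 / 2 * fderiv ℝ (fderiv ℝ f) y.1 y.2 y.2| ≤ C * ‖y.2‖ ^ 3 := by
  have h3 : ∀ᶠ z in 𝓝 z₀, ContDiffAt ℝ 3 f z :=
    ContDiffAt.eventually (by exact_mod_cast contDiffAt_infty.1 hf 3) (by simp)
  have hd2 : ContDiffAt ℝ 1 (fderiv ℝ (fderiv ℝ f)) z₀ :=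
    (h3.self_of_nhds.fderiv_right (m := 2) (by norm_num)).fderiv_right (by norm_num)
  obtain ⟨K, s, hs, hK⟩ := hd2.exists_lipschitzOnWith
  obtain ⟨R, hR, hball⟩ := Metric.eventually_nhds_iff_ball.1 (h3.and hs)
  refine ⟨K + 1, by positivity, ?_⟩
  rw [nhds_prod_eq]
  filter_upwards [prod_mem_prod (ball_mem_nhds z₀ (half_pos hR))
    (ball_mem_nhds (0 : X) (half_pos hR))]
  rintro ⟨z, t⟩ ⟨hz, ht⟩
  simp only at hz ht ⊢
  rw [mem_ball_zero_iff] at ht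
  have hmem : ∀ u ∈ closedBall (0 : X) ‖t‖, z + u ∈ ball z₀ R := by
    intro u hu
    rw [mem_closedBall_zero_iff] at hu
    rw [mem_ball_iff_norm] at hz ⊢
    calc ‖z + u - z₀‖ = ‖(z - z₀) + u‖ := by congr 1; abel
      _ ≤ ‖z - z₀‖ + ‖u‖ := norm_add_le _ _
      _ < R := by linarith
  have hz' : z ∈ ball z₀ R := by simpa using hmem 0 (by simp)
  set Q := fderiv ℝ (fderiv ℝ f) z with hQ
  have hsym : ∀ u v, Q u v = Q v u := fun u v =>
    ((hball z hz').1.isSymmSndFDerivAt (by simp; norm_num)).eq u v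
  -- first the gradient, then the function
  have hgrad : ∀ u ∈ closedBall (0 : X) ‖t‖, ‖fderiv ℝ f (z + u) - fderiv ℝ f z - Q u‖ ≤
      K * ‖t‖ * ‖t‖ := by
    intro u hu
    have hder : ∀ v ∈ closedBall (0 : X) ‖t‖, HasFDerivWithinAt
        (fun u => fderiv ℝ f (z + u) - fderiv ℝ f z - Q u)
        (fderiv ℝ (fderiv ℝ f) (z + v) - Q) (closedBall 0 ‖t‖) v := by
      intro v hv
      have h1 : HasFDerivAt (fderiv ℝ f) (fderiv ℝ (fderiv ℝ f) (z + v)) (z + v) :=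
        (((hball _ (hmem v hv)).1.fderiv_right (m := 2) (by norm_num)).differentiableAt
          (by norm_num)).hasFDerivAt
      have h2 : HasFDerivAt (fun u => fderiv ℝ f (z + u)) (fderiv ℝ (fderiv ℝ f) (z + v)) v := by
        rwa [hasFDerivAt_comp_add_left]
      exact ((h2.sub_const _).sub Q.hasFDerivAt).hasFDerivWithinAt
    have hbd : ∀ v ∈ closedBall (0 : X) ‖t‖,
        ‖fderiv ℝ (fderiv ℝ f) (z + v) - Q‖ ≤ K * ‖t‖ := by
      intro v hv
      have := hK.dist_le_mul (z + v) (hball _ (hmem v hv)).2 z (hball z hz').2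
      rw [dist_eq_norm, dist_eq_norm, add_sub_cancel_left] at this
      rw [mem_closedBall_zero_iff] at hv
      exact this.trans (by gcongr)
    have := (convex_closedBall (0 : X) ‖t‖).norm_image_sub_le_of_norm_hasFDerivWithin_le hder hbd
      (mem_closedBall_self (norm_nonneg t)) hu
    rw [mem_closedBall_zero_iff] at hu
    simp only [add_zero, sub_self, map_zero, sub_zero] at this
    exact this.trans (by gcongr)
  have hder : ∀ v ∈ closedBall (0 : X) ‖t‖, HasFDerivWithinAt
      (fun u => f (z + u) - fderiv ℝ f z u - 1 / 2 * Q u u)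
      (fderiv ℝ f (z + v) - fderiv ℝ f z - Q v) (closedBall 0 ‖t‖) v := by
    intro v hv
    have h1 : HasFDerivAt f (fderiv ℝ f (z + v)) (z + v) :=
      ((hball _ (hmem v hv)).1.differentiableAt (by norm_num)).hasFDerivAt
    have h2 : HasFDerivAt (fun u => f (z + u)) (fderiv ℝ f (z + v)) v := by
      rwa [hasFDerivAt_comp_add_left]
    have h4 : HasFDerivAt (fun u => Q u u) _ v := Q.hasFDerivAt.clm_apply (hasFDerivAt_id v)
    have h5 := (h2.sub (fderiv ℝ f z).hasFDerivAt).sub (h4.const_mul (1 / 2))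
    refine (h5.congr_fderiv ?_).hasFDerivWithinAt
    ext w
    simp [hsym w v]
    ring
  have := (convex_closedBall (0 : X) ‖t‖).norm_image_sub_le_of_norm_hasFDerivWithin_le hder hgrad
    (mem_closedBall_self (norm_nonneg t)) (mem_closedBall_zero_iff.2 le_rfl)
  simp only [add_zero, map_zero, sub_zero, mul_zero] at this
  rw [Real.norm_eq_abs] at this
  calc _ = |f (z + t) - fderiv ℝ f z t - 1 / 2 * Q t t - f z| := by congr 1; ring
    _ ≤ K * ‖t‖ * ‖t‖ * ‖t‖ := this
    _ ≤ (K + 1) * ‖t‖ ^ 3 := by nlinarith [pow_nonneg (norm_nonneg t) 3]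

end NormalizedDefiningFunction

/-! ### The Levi form and its null space through real derivatives -/

section RealForms

variable {E : Type*} [NormedAddCommGroup E] [NormedSpace ℂ E] [NormedSpace ℝ E]
  [IsScalarTower ℝ ℂ E]

theorem complex_smul_eq (c : ℂ) (v : E) : c • v = c.re • v + c.im • (Complex.I • v) := by
  conv_lhs => rw [← Complex.re_add_im c, add_smul, mul_smul]
  rw [← algebraMap_smul ℂ c.re v, ← algebraMap_smul ℂ c.im (Complex.I • v)]
  rfl

omit [NormedSpace ℝ E] [IsScalarTower ℝ ℂ E] in
theorem I_smul_I_smul (v : E) : Complex.I • Complex.I • v = -v := by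
  rw [smul_smul, Complex.I_mul_I, neg_one_smul]

/-- The complex linear form `2 ∂f` at `z`, that is `v ↦ df(v) - i df(iv)`. -/
def theta (f : E → ℝ) (z : E) : E →ₗ[ℂ] ℂ where
  toFun v := (fderiv ℝ f z v : ℂ) - Complex.I * fderiv ℝ f z (Complex.I • v)
  map_add' u v := by
    simp only [smul_add, map_add, Complex.ofReal_add]
    ring
  map_smul' c v := by
    have h1 : c • v = c.re • v + c.im • (Complex.I • v) := complex_smul_eq c v
    have h2 : Complex.I • c • v = c.re • (Complex.I • v) - c.im • v := by
      rw [h1, smul_add, smul_comm Complex.I c.re, smul_comm Complex.I c.im, I_smul_I_smul, smul_neg]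
      abel
    rw [h2, h1]
    simp only [map_add, map_sub, map_smul, smul_eq_mul, RingHom.id_apply, Complex.ofReal_add,
      Complex.ofReal_sub, Complex.ofReal_mul]
    conv_rhs => rw [← Complex.re_add_im c]
    linear_combination ((c.im : ℂ) * (fderiv ℝ f z (Complex.I • v) : ℂ)) * Complex.I_sq

theorem theta_apply (f : E → ℝ) (z v : E) :
    theta f z v = (fderiv ℝ f z v : ℂ) - Complex.I * fderiv ℝ f z (Complex.I • v) := rfl

theorem theta_re (f : E → ℝ) (z v : E) : (theta f z v).re = fderiv ℝ f z v := by
  simp [theta_apply]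

theorem theta_eq_zero_iff {f : E → ℝ} {z v : E} :
    theta f z v = 0 ↔ fderiv ℝ f z v = 0 ∧ fderiv ℝ f z (Complex.I • v) = 0 := by
  rw [theta_apply, Complex.ext_iff]
  simp

/-- The real symmetric form `Q(u, v) + Q(iu, iv)`, where `Q` is the real Hessian of `f` at `z`. It
is four times the real part of the Levi form. -/
def leviReal (f : E → ℝ) (z u v : E) : ℝ :=
  fderiv ℝ (fderiv ℝ f) z u v + fderiv ℝ (fderiv ℝ f) z (Complex.I • u) (Complex.I • v)

omit [IsScalarTower ℝ ℂ E] in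
theorem leviReal_I_I (f : E → ℝ) (z u v : E) :
    leviReal f z (Complex.I • u) (Complex.I • v) = leviReal f z u v := by
  simp only [leviReal, I_smul_I_smul, map_neg, neg_apply, neg_neg]
  ring

omit [IsScalarTower ℝ ℂ E] in
theorem leviReal_I_left (f : E → ℝ) (z u v : E) :
    leviReal f z (Complex.I • u) v = -leviReal f z u (Complex.I • v) := by
  rw [← leviReal_I_I f z u, I_smul_I_smul]
  simp only [leviReal, smul_neg, map_neg]
  ring

omit [IsScalarTower ℝ ℂ E] in
theorem leviReal_add_left (f : E → ℝ) (z u u' v : E) :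
    leviReal f z (u + u') v = leviReal f z u v + leviReal f z u' v := by
  simp only [leviReal, smul_add, map_add, add_apply]
  ring

omit [IsScalarTower ℝ ℂ E] in
theorem leviReal_add_right (f : E → ℝ) (z u v v' : E) :
    leviReal f z u (v + v') = leviReal f z u v + leviReal f z u v' := by
  simp only [leviReal, smul_add, map_add]
  ring

theorem leviReal_smul_left (f : E → ℝ) (z : E) (c : ℝ) (u v : E) :
    leviReal f z (c • u) v = c * leviReal f z u v := by
  simp only [leviReal, smul_comm Complex.I c, map_smul, smul_apply, smul_eq_mul]
  ring

theorem leviReal_smul_right (f : E → ℝ) (z : E) (c : ℝ) (u v : E) :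
    leviReal f z u (c • v) = c * leviReal f z u v := by
  simp only [leviReal, smul_comm Complex.I c, map_smul, smul_eq_mul]
  ring

omit [IsScalarTower ℝ ℂ E] in
theorem leviReal_comm {f : E → ℝ} {z : E} (hf : ContDiffAt ℝ 2 f z) (u v : E) :
    leviReal f z u v = leviReal f z v u := by
  have h := hf.isSymmSndFDerivAt (by simp)
  rw [leviReal, leviReal, h.eq u v, h.eq (Complex.I • u)]

/-- The Levi form as a sesquilinear form, expressed through the real Hessian. -/
def leviSesq (f : E → ℝ) (z : E) : E →ₗ[ℂ] E →ₗ⋆[ℂ] ℂ :=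
  LinearMap.mk₂'ₛₗ (RingHom.id ℂ) (starRingEnd ℂ)
    (fun u v => (1 / 4 : ℂ) * (leviReal f z u v + Complex.I * leviReal f z u (Complex.I • v)))
    (by
      intro u u' v
      simp only [leviReal_add_left, Complex.ofReal_add]
      ring)
    (by
      intro c u v
      have h : c • u = c.re • u + c.im • (Complex.I • u) := complex_smul_eq c u
      rw [h]
      simp only [leviReal_add_left, leviReal_smul_left, leviReal_I_left,
        Complex.ofReal_add, Complex.ofReal_mul, I_smul_I_smul, Complex.ofReal_neg,
        RingHom.id_apply, smul_eq_mul]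
      conv_rhs => rw [← Complex.re_add_im c]
      have h2 : leviReal f z u (-v) = - leviReal f z u v := by
        rw [← neg_one_smul ℝ v, leviReal_smul_right]; ring
      rw [h2]
      push_cast
      linear_combination (-(1 / 4 : ℂ) * c.im * leviReal f z u (Complex.I • v)) * Complex.I_sq)
    (by
      intro u v v'
      simp only [leviReal_add_right, smul_add, Complex.ofReal_add]
      ring)
    (by
      intro c u v
      have h1 : c • v = c.re • v + c.im • (Complex.I • v) := complex_smul_eq c v
      have h2 : Complex.I • c • v = c.re • (Complex.I • v) + (-c.im) • v := by
        rw [h1, smul_add, smul_comm Complex.I c.re, smul_comm Complex.I c.im, I_smul_I_smul,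
          smul_neg, neg_smul]
      have h3 : conj c = c.re - c.im * Complex.I := by
        conv_lhs => rw [← Complex.re_add_im c]
        simp only [map_add, map_mul, Complex.conj_ofReal, Complex.conj_I]
        ring
      rw [h2, h1, h3]
      simp only [leviReal_add_right, leviReal_smul_right,
        Complex.ofReal_add, Complex.ofReal_mul, Complex.ofReal_neg, smul_eq_mul]
      linear_combination ((1 / 4 : ℂ) * c.im * leviReal f z u (Complex.I • v)) * Complex.I_sq)

theorem leviSesq_apply (f : E → ℝ) (z u v : E) : leviSesq f z u v =
    (1 / 4 : ℂ) * (leviReal f z u v + Complex.I * leviReal f z u (Complex.I • v)) := rfl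

/-- The null space of the Levi form of `f` at `z` on the complex tangent space. -/
def nullSpace (f : E → ℝ) (z : E) : Submodule ℂ E where
  carrier := {u | theta f z u = 0 ∧ ∀ v, theta f z v = 0 → leviSesq f z u v = 0}
  add_mem' := by
    rintro u u' ⟨h1, h2⟩ ⟨h1', h2'⟩
    refine ⟨by simp [h1, h1'], fun v hv => by simp [h2 v hv, h2' v hv]⟩
  zero_mem' := by simp
  smul_mem' := by
    rintro c u ⟨h1, h2⟩
    refine ⟨by simp [h1], fun v hv => by simp [h2 v hv]⟩

theorem mem_nullSpace_iff {f : E → ℝ} {z u : E} : u ∈ nullSpace f z ↔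
    theta f z u = 0 ∧ ∀ v, theta f z v = 0 → leviReal f z u v = 0 := by
  refine and_congr Iff.rfl ⟨fun h v hv => ?_, fun h v hv => ?_⟩
  · have := h v hv
    rw [leviSesq_apply, Complex.ext_iff] at this
    simpa using this.1
  · rw [leviSesq_apply, h v hv, h (Complex.I • v) (by simp [hv])]
    simp

theorem nullSpace_congr {f g : E → ℝ} {z w : E} (h1 : fderiv ℝ f z = fderiv ℝ g w)
    (h2 : fderiv ℝ (fderiv ℝ f) z = fderiv ℝ (fderiv ℝ g) w) : nullSpace f z = nullSpace g w := by
  ext u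
  simp only [mem_nullSpace_iff, theta_apply, leviReal, h1, h2]

omit [NormedSpace ℂ E] [IsScalarTower ℝ ℂ E] in
/-- A function that vanishes on a hypersurface `{r = 0}` has a differential proportional to that
of `r` along it. -/
theorem exists_fderiv_eq_smul_of_eqOn_zero [CompleteSpace E] {r f : E → ℝ} {m : E}
    (hr : ContDiffAt ℝ 1 r m) (hf : ContDiffAt ℝ 1 f m) (h0 : r m = 0) (hd : fderiv ℝ r m ≠ 0)
    (hz : ∀ᶠ w in 𝓝 m, r w = 0 → f w = 0) : ∃ c : ℝ, fderiv ℝ f m = c • fderiv ℝ r m := by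
  have hext : IsLocalExtrOn f {x | r x = r m} m := by
    refine Or.inl ?_
    filter_upwards [self_mem_nhdsWithin, mem_nhdsWithin_of_mem_nhds hz] with w hw1 hw2
    rw [hz.self_of_nhds h0, hw2 (by rw [← h0]; exact hw1)]
  obtain ⟨a, b, hab, h⟩ := hext.exists_multipliers_of_hasStrictFDerivAt_1d
    (hr.hasStrictFDerivAt (by simp)) (hf.hasStrictFDerivAt (by simp))
  have hb : b ≠ 0 := by
    rintro rfl
    have ha : a ≠ 0 := by
      rintro rfl
      exact hab rfl
    simp only [zero_smul, add_zero, smul_eq_zero] at h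
    exact h.elim ha hd
  refine ⟨-(b⁻¹ * a), ?_⟩
  have h2 : b • fderiv ℝ f m = -(a • fderiv ℝ r m) := by
    rw [eq_neg_iff_add_eq_zero, add_comm]; exact h
  calc fderiv ℝ f m = b⁻¹ • b • fderiv ℝ f m := by rw [smul_smul, inv_mul_cancel₀ hb, one_smul]
    _ = _ := by rw [h2, smul_neg, smul_smul, neg_smul]

/-- The Levi null space does not depend on the choice of the defining function: on the real tangent
space the real Hessians of two defining functions are proportional. -/
theorem nullSpace_eq_of_common_zero_set [CompleteSpace E] {r f : E → ℝ} {m : E}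
    (hr : ContDiffAt ℝ 2 r m) (hf : ContDiffAt ℝ 2 f m) (h0 : r m = 0)
    (hrd : fderiv ℝ r m ≠ 0) (hfd : fderiv ℝ f m ≠ 0)
    (hz : ∀ᶠ w in 𝓝 m, r w = 0 → f w = 0) : nullSpace f m = nullSpace r m := by
  obtain ⟨e, he⟩ : ∃ e, fderiv ℝ r m e ≠ 0 := by
    by_contra! h
    exact hrd (ContinuousLinearMap.ext h)
  obtain ⟨c, hc⟩ := exists_fderiv_eq_smul_of_eqOn_zero (hr.of_le (by norm_num))
    (hf.of_le (by norm_num)) h0 hrd hz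
  have hc0 : c ≠ 0 := by
    rintro rfl
    exact hfd (by simpa using hc)
  have hr1 : ContDiffAt ℝ 1 (fderiv ℝ r) m := hr.fderiv_right (by norm_num)
  have hf1 : ContDiffAt ℝ 1 (fderiv ℝ f) m := hf.fderiv_right (by norm_num)
  have hprop : ∀ᶠ w in 𝓝 m, r w = 0 → ∃ c : ℝ, fderiv ℝ f w = c • fderiv ℝ r w := by
    filter_upwards [hr.eventually (by simp), hf.eventually (by simp), hz.eventually_nhds,
      hr1.continuousAt.eventually_ne hrd] with w h1 h2 h3 h4 h5
    exact exists_fderiv_eq_smul_of_eqOn_zero (h1.of_le (by norm_num)) (h2.of_le (by norm_num))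
      h5 h4 h3
  -- differentiate the proportionality `df(v) dr(e) = df(e) dr(v)`, valid along the hypersurface, in
  -- a tangential direction `u`
  have hQ : ∀ u v, fderiv ℝ r m u = 0 → fderiv ℝ r m v = 0 →
      fderiv ℝ (fderiv ℝ f) m u v = c * fderiv ℝ (fderiv ℝ r) m u v := by
    intro u v hu hv
    let g : E → ℝ := fun w => fderiv ℝ f w v * fderiv ℝ r w e - fderiv ℝ f w e * fderiv ℝ r w v
    have hg : ContDiffAt ℝ 1 g m :=
      ((hf1.clm_apply contDiffAt_const).mul (hr1.clm_apply contDiffAt_const)).sub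
        ((hf1.clm_apply contDiffAt_const).mul (hr1.clm_apply contDiffAt_const))
    obtain ⟨d, hd⟩ := exists_fderiv_eq_smul_of_eqOn_zero (hr.of_le (by norm_num)) hg h0 hrd (by
      filter_upwards [hprop] with w hw h
      obtain ⟨c', hc'⟩ := hw h
      simp only [g, hc', smul_apply, smul_eq_mul]
      ring)
    have hr2 : HasFDerivAt (fderiv ℝ r) _ m := (hr1.differentiableAt (by simp)).hasFDerivAt
    have hf2 : HasFDerivAt (fderiv ℝ f) _ m := (hf1.differentiableAt (by simp)).hasFDerivAt
    have key : HasFDerivAt g _ m :=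
      ((hf2.clm_apply (hasFDerivAt_const v m)).mul (hr2.clm_apply (hasFDerivAt_const e m))).sub
        ((hf2.clm_apply (hasFDerivAt_const e m)).mul (hr2.clm_apply (hasFDerivAt_const v m)))
    have h3 := congrArg (fun L => L u) (key.fderiv.symm.trans hd)
    simp [hu, hv, hc] at h3
    have h4 : fderiv ℝ r m e * (fderiv ℝ (fderiv ℝ f) m u v - c * fderiv ℝ (fderiv ℝ r) m u v)
        = 0 := by linarith
    linarith [(mul_eq_zero.1 h4).resolve_left he]
  have hT : ∀ u, theta f m u = 0 ↔ theta r m u = 0 := by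
    intro u
    simp [theta_eq_zero_iff, hc, hc0]
  ext u
  rw [mem_nullSpace_iff, mem_nullSpace_iff, hT]
  refine and_congr_right fun hu => forall_congr' fun v => ?_
  rw [hT]
  refine imp_congr_right fun hv => ?_
  rw [theta_eq_zero_iff] at hu hv
  rw [leviReal, leviReal, hQ _ _ hu.1 hv.1, hQ _ _ hu.2 hv.2, ← mul_add]
  simp [hc0]

/-- The Levi null spaces of a function that is affine in the direction `e` are invariant under
translation along `e`. -/
theorem nullSpace_add_smul {r : E → ℝ} {m e : E} {s : ℝ}
    (h : ∀ᶠ w in 𝓝 m, r (w + s • e) = r w + s) : nullSpace r (m + s • e) = nullSpace r m := by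
  have h1 : ∀ᶠ w in 𝓝 m, fderiv ℝ r (w + s • e) = fderiv ℝ r w := by
    filter_upwards [h.eventually_nhds] with w hw
    rw [← fderiv_comp_add_right (s • e), Filter.EventuallyEq.fderiv_eq hw, fderiv_add_const]
  refine nullSpace_congr h1.self_of_nhds ?_
  rw [← fderiv_comp_add_right (s • e), Filter.EventuallyEq.fderiv_eq h1]

end RealForms

section Coordinates

variable {n : ℕ}

theorem single_I (j : Fin n) :
    (EuclideanSpace.single j Complex.I : Cn n) = Complex.I • EuclideanSpace.single j (1 : ℂ) := by
  ext i
  simp [PiLp.single_apply]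

theorem fderiv_ofReal_comp {f : Cn n → ℝ} {z : Cn n} (hf : DifferentiableAt ℝ f z) (v : Cn n) :
    fderiv ℝ (fun w => (f w : ℂ)) z v = (fderiv ℝ f z v : ℂ) := by
  have h : HasFDerivAt (fun w => (f w : ℂ)) _ z :=
    Complex.ofRealCLM.hasFDerivAt.comp z hf.hasFDerivAt
  rw [h.fderiv]
  rfl

theorem dz_eq {f : Cn n → ℝ} {z : Cn n} (hf : DifferentiableAt ℝ f z) (j : Fin n) :
    dz j (fun w => (f w : ℂ)) z = 1 / 2 * theta f z (EuclideanSpace.single j 1) := by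
  rw [dz, fderiv_ofReal_comp hf, fderiv_ofReal_comp hf, theta_apply, single_I]

theorem complexHessian_eq {f : Cn n → ℝ} {z : Cn n} (hf : ContDiffAt ℝ 2 f z) (j k : Fin n) :
    complexHessian f z j k =
      leviSesq f z (EuclideanSpace.single j 1) (EuclideanSpace.single k 1) := by
  set ek : Cn n := EuclideanSpace.single k 1 with hek
  set ej : Cn n := EuclideanSpace.single j 1 with hej
  have h1 : (fun w => dzbar k (fun w => (f w : ℂ)) w) =ᶠ[𝓝 z] fun w =>
      (1 / 2 : ℂ) * ((fderiv ℝ f w ek : ℂ) + Complex.I * (fderiv ℝ f w (Complex.I • ek) : ℂ)) := by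
    filter_upwards [hf.eventually (by simp)] with w hw
    have hw' := hw.differentiableAt (by simp)
    rw [dzbar, fderiv_ofReal_comp hw', fderiv_ofReal_comp hw', single_I]
  have hd : HasFDerivAt (fderiv ℝ f) _ z :=
    ((hf.fderiv_right (m := 1) (by norm_num)).differentiableAt (by simp)).hasFDerivAt
  have h2 : ∀ v : Cn n, HasFDerivAt (fun w => (fderiv ℝ f w v : ℂ)) _ z := fun v =>
    Complex.ofRealCLM.hasFDerivAt.comp z (hd.clm_apply (hasFDerivAt_const v z))
  have h3 := ((h2 ek).add ((h2 (Complex.I • ek)).const_mul Complex.I)).const_mul (1 / 2 : ℂ)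
  have h4 := (h3.congr_of_eventuallyEq h1).fderiv
  rw [complexHessian, dz]
  have h5 : ∀ v, fderiv ℝ (dzbar k fun w => (f w : ℂ)) z v = (1 / 2 : ℂ) *
      ((fderiv ℝ (fderiv ℝ f) z v ek : ℂ) +
        Complex.I * (fderiv ℝ (fderiv ℝ f) z v (Complex.I • ek) : ℂ)) := by
    intro v
    have := congrArg (fun L => L v) h4
    refine this.trans ?_
    simp
    ring
  rw [h5, h5, single_I, leviSesq_apply, leviReal, leviReal, I_smul_I_smul]
  simp only [map_neg]
  push_cast
  linear_combination (-(1 / 4 : ℂ) *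
    (fderiv ℝ (fderiv ℝ f) z (Complex.I • ej) (Complex.I • ek))) * Complex.I_sq

/-- The Levi form defined by Wirtinger derivatives agrees with the one defined by the real Hessian.
-/
theorem leviForm_eq {f : Cn n → ℝ} {z : Cn n} (hf : ContDiffAt ℝ 2 f z) :
    leviForm f z = leviSesq f z := by
  refine (EuclideanSpace.basisFun (Fin n) ℂ).toBasis.ext fun j => ?_
  refine (EuclideanSpace.basisFun (Fin n) ℂ).toBasis.ext fun k => ?_
  have : leviForm f z ((EuclideanSpace.basisFun (Fin n) ℂ).toBasis j)
      ((EuclideanSpace.basisFun (Fin n) ℂ).toBasis k) = complexHessian f z j k := by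
    simp [leviForm]
  rw [this, complexHessian_eq hf]
  simp

theorem mem_complexTangent_iff {f : Cn n → ℝ} {z : Cn n} (hf : DifferentiableAt ℝ f z)
    {X : Cn n} : X ∈ complexTangent f z ↔ theta f z X = 0 := by
  have h1 : theta f z X = ∑ j, X j * theta f z (EuclideanSpace.single j 1) := by
    conv_lhs => rw [← (EuclideanSpace.basisFun (Fin n) ℂ).sum_repr X]
    simp
  have h2 : (X ∈ complexTangent f z) ↔ ∑ j, dz j (fun w => (f w : ℂ)) z * X j = 0 := Iff.rfl
  have h3 : ∑ j, dz j (fun w => (f w : ℂ)) z * X j = 1 / 2 * theta f z X := by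
    rw [h1, Finset.mul_sum]
    refine Finset.sum_congr rfl fun j _ => ?_
    rw [dz_eq hf]
    ring
  rw [h2, h3]
  simp

/-- Rank and nullity of the Levi form on the `(n - 1)`-dimensional complex tangent space add up. -/
theorem finrank_nullSpace {f : Cn n → ℝ} {z : Cn n} (hf : ContDiffAt ℝ 2 f z)
    (hd : fderiv ℝ f z ≠ 0) : finrank ℂ (nullSpace f z) + leviRank f z + 1 = n := by
  have hfd := hf.differentiableAt (by simp)
  set T := complexTangent f z with hT
  set B := (leviForm f z).domRestrict₁₂ T T with hB
  have hnull : nullSpace f z = (LinearMap.ker B).map T.subtype := by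
    ext X
    simp only [Submodule.mem_map, LinearMap.mem_ker, Submodule.subtype_apply]
    constructor
    · rintro ⟨h1, h2⟩
      refine ⟨⟨X, (mem_complexTangent_iff hfd).2 h1⟩, ?_, rfl⟩
      ext Y
      rw [hB, LinearMap.domRestrict₁₂_apply, leviForm_eq hf]
      exact h2 Y ((mem_complexTangent_iff hfd).1 Y.2)
    · rintro ⟨X, h1, rfl⟩
      refine ⟨(mem_complexTangent_iff hfd).1 X.2, fun Y hY => ?_⟩
      have := congrArg (fun L => L ⟨Y, (mem_complexTangent_iff hfd).2 hY⟩) h1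
      simpa [hB, LinearMap.domRestrict₁₂_apply, leviForm_eq hf] using this
  have h1 : finrank ℂ (nullSpace f z) = finrank ℂ (LinearMap.ker B) := by
    rw [hnull, Submodule.finrank_map_subtype_eq]
  have h2 : leviRank f z + finrank ℂ (LinearMap.ker B) = finrank ℂ T :=
    LinearMap.finrank_range_add_finrank_ker B
  have h3 : T = LinearMap.ker (theta f z) := by
    ext X
    rw [mem_complexTangent_iff hfd, LinearMap.mem_ker]
  have h4 := LinearMap.finrank_range_add_finrank_ker (theta f z)
  have h5 : LinearMap.range (theta f z) = ⊤ := by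
    rw [LinearMap.range_eq_top]
    obtain ⟨v, hv⟩ : ∃ v, fderiv ℝ f z v ≠ 0 := by
      by_contra! h
      exact hd (ContinuousLinearMap.ext h)
    have hv' : theta f z v ≠ 0 := by
      intro h
      exact hv (theta_eq_zero_iff.1 h).1
    intro c
    refine ⟨(c / theta f z v) • v, ?_⟩
    rw [map_smul, smul_eq_mul, div_mul_cancel₀ _ hv']
  rw [h5, finrank_top, finrank_self, finrank_euclideanSpace, Fintype.card_fin] at h4
  have h6 : finrank ℂ T = finrank ℂ (LinearMap.ker (theta f z)) := by rw [h3]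
  omega

end Coordinates

/-! ### Second order tests and boundary functions -/

section HolomorphicHessian

variable {E : Type*} [NormedAddCommGroup E] [NormedSpace ℂ E] [NormedSpace ℝ E]
  [IsScalarTower ℝ ℂ E]

/-- The complex bilinear part `(u, v) ↦ ∑ (∂²f/∂z_j∂z_k) u_j v_k` of the real Hessian. -/
def holHess (f : E → ℝ) (z : E) : E →ₗ[ℂ] E →ₗ[ℂ] ℂ :=
  let Q := fderiv ℝ (fderiv ℝ f) z
  LinearMap.mk₂ ℂ
    (fun u v => (1 / 4 : ℂ) * ((Q u v : ℂ) - Q (Complex.I • u) (Complex.I • v)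
      - Complex.I * (Q u (Complex.I • v) + Q (Complex.I • u) v)))
    (by
      intro u u' v
      simp only [smul_add, map_add, add_apply, Complex.ofReal_add]
      ring)
    (by
      intro c u v
      have h1 : c • u = c.re • u + c.im • (Complex.I • u) := complex_smul_eq c u
      have h2 : Complex.I • c • u = c.re • (Complex.I • u) + (-c.im) • u := by
        rw [h1, smul_add, smul_comm Complex.I c.re, smul_comm Complex.I c.im, I_smul_I_smul,
          smul_neg, neg_smul]
      rw [h2, h1]
      simp only [map_add, map_smul, add_apply, smul_apply, smul_eq_mul, Complex.ofReal_add,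
        Complex.ofReal_mul, Complex.ofReal_neg]
      conv_rhs => rw [← Complex.re_add_im c]
      linear_combination ((1 / 4 : ℂ) * c.im *
        (Q u (Complex.I • v) + Q (Complex.I • u) v)) * Complex.I_sq)
    (by
      intro u v v'
      simp only [smul_add, map_add, Complex.ofReal_add]
      ring)
    (by
      intro c u v
      have h1 : c • v = c.re • v + c.im • (Complex.I • v) := complex_smul_eq c v
      have h2 : Complex.I • c • v = c.re • (Complex.I • v) + (-c.im) • v := by
        rw [h1, smul_add, smul_comm Complex.I c.re, smul_comm Complex.I c.im, I_smul_I_smul,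
          smul_neg, neg_smul]
      rw [h2, h1]
      simp only [map_add, map_smul, smul_eq_mul, Complex.ofReal_add,
        Complex.ofReal_mul, Complex.ofReal_neg]
      conv_rhs => rw [← Complex.re_add_im c]
      linear_combination ((1 / 4 : ℂ) * c.im *
        (Q u (Complex.I • v) + Q (Complex.I • u) v)) * Complex.I_sq)

theorem holHess_apply (f : E → ℝ) (z u v : E) : holHess f z u v =
    (1 / 4 : ℂ) * ((fderiv ℝ (fderiv ℝ f) z u v : ℂ)
      - fderiv ℝ (fderiv ℝ f) z (Complex.I • u) (Complex.I • v)
      - Complex.I * (fderiv ℝ (fderiv ℝ f) z u (Complex.I • v)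
        + fderiv ℝ (fderiv ℝ f) z (Complex.I • u) v)) := rfl

/-- The real Hessian is the sum of its Hermitian part and of the real part of its complex bilinear
part. -/
theorem half_hessian_eq (f : E → ℝ) (z u : E) :
    1 / 2 * fderiv ℝ (fderiv ℝ f) z u u = 1 / 4 * leviReal f z u u + (holHess f z u u).re := by
  rw [holHess_apply, leviReal]
  simp
  ring

theorem leviReal_smul_smul {f : E → ℝ} {z : E} (c : ℂ) (u : E) :
    leviReal f z (c • u) (c • u) = ‖c‖ ^ 2 * leviReal f z u u := by
  have h : ∀ w, leviReal f z w w = 4 * (leviSesq f z w w).re := by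
    intro w
    rw [leviSesq_apply]
    have h1 := leviReal_I_left f z w w
    simp
  rw [h, h, map_smul (leviSesq f z) c u, LinearMap.smul_apply,
    LinearMap.map_smulₛₗ (leviSesq f z u) c u, smul_eq_mul, smul_eq_mul, ← mul_assoc,
    Complex.mul_conj, Complex.re_ofReal_mul, Complex.normSq_eq_norm_sq]
  ring

end HolomorphicHessian

section MaximumPrinciple

variable {E : Type*} [NormedAddCommGroup E] [NormedSpace ℝ E]

/-- Second order condition at a local maximum along a parabola. -/
theorem second_order_of_isLocalMax {g : E → ℝ} {A B D : E} (hg : ContDiffAt ℝ ∞ g A)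
    (hmax : IsLocalMax (fun s : ℝ => g (A + (s • B + s ^ 2 • D))) 0) :
    fderiv ℝ (fderiv ℝ g) A B B + 2 * fderiv ℝ g A D ≤ 0 := by
  obtain ⟨C, hC, hT⟩ := exists_taylor_bound hg
  set Q := fderiv ℝ (fderiv ℝ g) A
  have ht : Tendsto (fun s : ℝ => (A, s • B + s ^ 2 • D)) (𝓝 0) (𝓝 (A, 0)) :=
    Continuous.tendsto' (by fun_prop) _ _ (by simp)
  have h1 := ht.eventually hT
  have h2 : ∀ᶠ s : ℝ in 𝓝 0, |g (A + (s • B + s ^ 2 • D)) - g A - fderiv ℝ g A (s • B + s ^ 2 • D)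
      - 1 / 2 * Q (s • B + s ^ 2 • D) (s • B + s ^ 2 • D)| ≤ C * (‖B‖ + ‖D‖) ^ 3 * |s| ^ 3 := by
    filter_upwards [h1, Metric.ball_mem_nhds (0 : ℝ) one_pos] with s hs hs1
    refine hs.trans ?_
    rw [mem_ball_zero_iff, Real.norm_eq_abs] at hs1
    have : ‖s • B + s ^ 2 • D‖ ≤ (‖B‖ + ‖D‖) * |s| := by
      refine (norm_add_le _ _).trans ?_
      rw [norm_smul, norm_smul, norm_pow, Real.norm_eq_abs]
      have : |s| ^ 2 ≤ |s| := by nlinarith [abs_nonneg s]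
      nlinarith [mul_le_mul_of_nonneg_right this (norm_nonneg D)]
    calc C * ‖s • B + s ^ 2 • D‖ ^ 3 ≤ C * ((‖B‖ + ‖D‖) * |s|) ^ 3 := by gcongr
      _ = _ := by ring
  have hneg : Tendsto (fun s : ℝ => -s) (𝓝 0) (𝓝 0) := by
    simpa using (continuous_neg (G := ℝ)).tendsto 0
  have hmax' : ∀ᶠ s : ℝ in 𝓝 0, g (A + (s • B + s ^ 2 • D)) ≤ g A := by
    have := hmax
    simp only [IsLocalMax, IsMaxFilter] at this
    simpa using this
  have key : ∀ᶠ s : ℝ in 𝓝[≠] 0, Q B B + 2 * fderiv ℝ g A D ≤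
      2 * (C * (‖B‖ + ‖D‖) ^ 3) * |s| - s ^ 2 * Q D D := by
    filter_upwards [h2.filter_mono nhdsWithin_le_nhds,
      (hneg.eventually h2).filter_mono nhdsWithin_le_nhds, hmax'.filter_mono nhdsWithin_le_nhds,
      (hneg.eventually hmax').filter_mono nhdsWithin_le_nhds, self_mem_nhdsWithin]
      with s a1 a2 a3 a4 a5
    have hs : 0 < |s| := abs_pos.2 a5
    have b1 := (abs_le.1 a1).1
    have b2 := (abs_le.1 a2).1
    simp only [map_add, map_smul, add_apply, smul_apply, smul_eq_mul, abs_neg, neg_sq] at b1 b2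
    simp only [neg_sq] at a4
    have hs2 : |s| ^ 2 = s ^ 2 := sq_abs s
    have : |s| ^ 2 * (Q B B + 2 * fderiv ℝ g A D) ≤
        |s| ^ 2 * (2 * (C * (‖B‖ + ‖D‖) ^ 3) * |s| - s ^ 2 * Q D D) := by
      have e1 : |s| ^ 2 * (2 * (C * (‖B‖ + ‖D‖) ^ 3) * |s| - s ^ 2 * Q D D) =
        2 * (C * (‖B‖ + ‖D‖) ^ 3 * |s| ^ 3) - s ^ 2 * s ^ 2 * Q D D := by rw [← hs2]; ring
      rw [e1, hs2]
      linarith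
    exact le_of_mul_le_mul_left this (by positivity)
  have hlim : Tendsto (fun s : ℝ => 2 * (C * (‖B‖ + ‖D‖) ^ 3) * |s| - s ^ 2 * Q D D) (𝓝[≠] 0)
      (𝓝 0) :=
    (Continuous.tendsto' (by fun_prop) _ _ (by simp)).mono_left nhdsWithin_le_nhds
  exact ge_of_tendsto hlim key

/-- The Levi form of a function is nonpositive in the direction of a holomorphic parabola on which
the function has a local maximum. -/
theorem leviReal_nonpos_of_isLocalMax {E : Type*} [NormedAddCommGroup E] [NormedSpace ℂ E]
    [NormedSpace ℝ E] [IsScalarTower ℝ ℂ E] {g : E → ℝ} {A B D : E} (hg : ContDiffAt ℝ ∞ g A)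
    (hmax : IsLocalMax (fun s : ℂ => g (A + (s • B + s ^ 2 • D))) 0) :
    leviReal g A B B ≤ 0 := by
  have h1 : fderiv ℝ (fderiv ℝ g) A B B + 2 * fderiv ℝ g A D ≤ 0 := by
    refine second_order_of_isLocalMax hg ?_
    have ht : Tendsto (fun s : ℝ => (s : ℂ)) (𝓝 0) (𝓝 0) :=
      Complex.continuous_ofReal.tendsto' _ _ (by simp)
    filter_upwards [ht.eventually hmax] with s hs
    rw [← algebraMap_smul ℂ s B, ← algebraMap_smul ℂ (s ^ 2) D]
    simpa using hs
  -- along the imaginary axis the quadratic term `s² D` changes sign, so that it cancels in the sum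
  have h2 : fderiv ℝ (fderiv ℝ g) A (Complex.I • B) (Complex.I • B) +
      2 * fderiv ℝ g A (-D) ≤ 0 := by
    refine second_order_of_isLocalMax hg ?_
    have ht : Tendsto (fun s : ℝ => (s : ℂ) * Complex.I) (𝓝 0) (𝓝 0) :=
      (Complex.continuous_ofReal.mul continuous_const).tendsto' _ _ (by simp)
    filter_upwards [ht.eventually hmax] with s hs
    rw [← algebraMap_smul ℂ s (Complex.I • B), ← algebraMap_smul ℂ (s ^ 2) (-D)]
    simpa [mul_pow, mul_smul] using hs
  rw [leviReal]
  rw [map_neg] at h2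
  linarith

end MaximumPrinciple

section Boundary

variable {n : ℕ}

/-- Near a smooth boundary point there is a defining function that is affine in a transversal
direction `e`. As its level sets are translates of the boundary, the Levi form has the same
nullity on all of them. -/
theorem exists_boundary_function {l : ℕ} (hl : l < n) {Ω V : Set (Cn n)} {z₀ : Cn n}
    (hz₀ : z₀ ∈ frontier Ω) (hV : IsOpen V) (hz₀V : z₀ ∈ V) (hsmooth : SmoothBoundaryIn Ω V)
    (hrank : ∀ q ∈ frontier Ω ∩ V, HasLeviRank Ω q (n - l - 1)) :
    ∃ (r : Cn n → ℝ) (e : Cn n), r z₀ = 0 ∧ fderiv ℝ r z₀ e = 1 ∧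
      (∀ᶠ z in 𝓝 z₀, ContDiffAt ℝ ∞ r z) ∧
      (∀ᶠ z in 𝓝 z₀, z ∈ Ω ↔ r z < 0) ∧ (∀ᶠ z in 𝓝 z₀, z ∈ frontier Ω ↔ r z = 0) ∧
      (∀ᶠ y in 𝓝 (z₀, (0 : ℝ)), r (y.1 + y.2 • e) = r y.1 + y.2) ∧
      ∀ᶠ z in 𝓝 z₀, finrank ℂ (nullSpace r z) = l := by
  obtain ⟨W, r₀, hW, hz₀W, hr₀⟩ := hsmooth z₀ ⟨hz₀, hz₀V⟩
  have hs₀ : ∀ z ∈ W, ContDiffAt ℝ ∞ r₀ z := fun z hz => hr₀.smooth.contDiffAt (hW.mem_nhds hz)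
  have hr₀0 : r₀ z₀ = 0 := (hr₀.hypersurface.subset ⟨hz₀, hz₀W⟩).2
  obtain ⟨e, he⟩ : ∃ e, 0 < fderiv ℝ r₀ z₀ e := by
    by_contra! h
    refine hr₀.fderiv_ne_zero z₀ ⟨hz₀, hz₀W⟩ (ContinuousLinearMap.ext fun v => le_antisymm (h v) ?_)
    have := h (-v)
    rw [map_neg] at this
    simpa using this
  obtain ⟨r, hr0, hrs, ⟨c, hc, hk⟩, htr, hfd⟩ := exists_normalized_definingFunction
    (Filter.eventually_of_mem (hW.mem_nhds hz₀W) hs₀) hr₀0 he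
  have hre : fderiv ℝ r z₀ e = 1 := by
    have := hfd.self_of_nhds hr0 e
    exact mul_left_cancel₀ he.ne' (by linarith)
  have hW' := hW.mem_nhds hz₀W
  have hfront : ∀ᶠ z in 𝓝 z₀, z ∈ frontier Ω ↔ r z = 0 := by
    filter_upwards [hk, hW'] with z ⟨k, hk, hkz⟩ hz
    have h1 : z ∈ frontier Ω ↔ r₀ z = 0 := by
      have := Set.ext_iff.1 hr₀.hypersurface z
      simpa [hz] using this
    rw [h1, hkz, mul_eq_zero]
    exact or_iff_right (hc.trans_le hk).ne'
  refine ⟨r, e, hr0, hre, hrs, ?_, hfront, htr, ?_⟩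
  · filter_upwards [hk, hW'] with z ⟨k, hk, hkz⟩ hz
    have h1 : z ∈ Ω ↔ r₀ z < 0 := by
      have := Set.ext_iff.1 hr₀.side z
      simpa [hz] using this
    rw [h1, hkz, mul_neg_iff]
    have := hc.trans_le hk
    constructor
    · rintro (h | h)
      · exact h.2
      · exact absurd h.1 this.not_gt
    · exact fun h => Or.inl ⟨this, h⟩
  · have hrd : ∀ᶠ z in 𝓝 z₀, fderiv ℝ r z ≠ 0 := by
      refine (hrs.self_of_nhds.continuousAt_fderiv (by simp)).eventually_ne ?_
      intro h
      rw [h] at hre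
      simp at hre
    -- on the boundary itself the nullity is given by the Levi rank
    have hgood : ∀ᶠ m in 𝓝 z₀, r m = 0 → finrank ℂ (nullSpace r m) = l := by
      filter_upwards [hfront.eventually_nhds, hrs, hrd, hV.mem_nhds hz₀V] with m h1 h2 h3 h4 h5
      obtain ⟨W', r', hW'o, hmW', hr', hrk⟩ := hrank m ⟨h1.self_of_nhds.2 h5, h4⟩
      have hs' : ContDiffAt ℝ ∞ r' m := hr'.smooth.contDiffAt (hW'o.mem_nhds hmW')
      have hd' := hr'.fderiv_ne_zero m ⟨h1.self_of_nhds.2 h5, hmW'⟩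
      have hle : (2 : WithTop ℕ∞) ≤ ∞ := ENat.LEInfty.out
      rw [← nullSpace_eq_of_common_zero_set (h2.of_le hle) (hs'.of_le hle) h5 h3 hd' (by
        filter_upwards [h1, hW'o.mem_nhds hmW'] with w hw1 hw2 hw3
        exact (hr'.hypersurface.subset ⟨hw1.2 hw3, hw2⟩).2)]
      have := finrank_nullSpace (hs'.of_le hle) hd'
      omega
    -- other points `z` are reduced to the boundary point `z - r(z) e`
    have hrt : Tendsto r (𝓝 z₀) (𝓝 0) := by
      have := hrs.self_of_nhds.continuousAt
      rwa [ContinuousAt, hr0] at this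
    have ht : Tendsto (fun z => (z - r z • e, r z)) (𝓝 z₀) (𝓝 (z₀, 0)) := by
      rw [nhds_prod_eq]
      refine Tendsto.prodMk ?_ hrt
      simpa using tendsto_id.sub (hrt.smul_const e)
    have ht1 : Tendsto (fun z => z - r z • e) (𝓝 z₀) (𝓝 z₀) := by
      simpa using tendsto_id.sub (hrt.smul_const e)
    filter_upwards [ht1.eventually hgood, ht.eventually htr.eventually_nhds] with z h1 h2
    have h3 := h2.self_of_nhds
    simp only [sub_add_cancel] at h3
    have h4 : ∀ᶠ w in 𝓝 (z - r z • e), r (w + r z • e) = r w + r z := by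
      have : Tendsto (fun w => (w, r z)) (𝓝 (z - r z • e)) (𝓝 (z - r z • e, r z)) :=
        (Continuous.prodMk_left (r z)).tendsto _
      exact this.eventually h2
    have h5 := nullSpace_add_smul h4
    rw [sub_add_cancel] at h5
    rw [h5]
    exact h1 (by linarith)

end Boundary

/-! ### Levi pseudoconvexity of pseudoconvex domains -/

section Pseudoconvexity

variable {n : ℕ}

/-- On the holomorphic parabola `t ↦ z + tX + t²κe`, where `κ` cancels the pluriharmonic part of
the second order jet, a function with `f(z) = 0` is negative for small `t ≠ 0` if its Levi form is
negative at the tangent vector `X`. -/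
theorem parabola_bound {E : Type*} [NormedAddCommGroup E] [NormedSpace ℂ E]
    [NormedSpace ℝ E] [IsScalarTower ℝ ℂ E] {f : E → ℝ} {z X e : E} {κ : ℂ}
    (hf : ContDiffAt ℝ ∞ f z) (h0 : f z = 0) (hX : theta f z X = 0)
    (hκ : κ * theta f z e = -holHess f z X X) (hneg : leviReal f z X X < 0) :
    ∀ᶠ t in 𝓝[≠] (0 : ℂ), f (z + (t • X + t ^ 2 • κ • e)) < 0 := by
  obtain ⟨C, hC, hT⟩ := exists_taylor_bound hf
  set Q := fderiv ℝ (fderiv ℝ f) z with hQ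
  set D := κ • e with hD
  set K := C * (‖X‖ + ‖D‖) ^ 3 + ‖Q‖ * (‖X‖ * ‖D‖) + 1 / 2 * (‖Q‖ * ‖D‖ ^ 2) with hK
  have hK0 : 0 ≤ K := by positivity
  have ht : Tendsto (fun t : ℂ => (z, t • X + t ^ 2 • D)) (𝓝 0) (𝓝 (z, 0)) :=
    Continuous.tendsto' (by fun_prop) _ _ (by simp)
  have hsmall : ∀ᶠ t : ℂ in 𝓝 0, ‖t‖ * K < -leviReal f z X X / 4 := by
    have : Tendsto (fun t : ℂ => ‖t‖ * K) (𝓝 0) (𝓝 0) :=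
      Continuous.tendsto' (by fun_prop) _ _ (by simp)
    exact this.eventually (gt_mem_nhds (by linarith))
  filter_upwards [(ht.eventually hT).filter_mono nhdsWithin_le_nhds,
    hsmall.filter_mono nhdsWithin_le_nhds,
    mem_nhdsWithin_of_mem_nhds (ball_mem_nhds (0 : ℂ) one_pos), self_mem_nhdsWithin]
    with t h1 h2 h3 h4
  have ht0 : 0 < ‖t‖ := norm_pos_iff.2 h4
  rw [mem_ball_zero_iff] at h3
  have hsym : ∀ u v, Q u v = Q v u := fun u v =>
    ((hf.of_le (m := 2) ENat.LEInfty.out).isSymmSndFDerivAt (by simp)).eq u v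
  have ht2 : ‖t‖ ^ 2 ≤ ‖t‖ := by nlinarith
  have hn1 : ‖t • X + t ^ 2 • D‖ ≤ ‖t‖ * (‖X‖ + ‖D‖) := by
    refine (norm_add_le _ _).trans ?_
    rw [norm_smul, norm_smul, norm_pow]
    nlinarith [mul_le_mul_of_nonneg_right ht2 (norm_nonneg D)]
  have hlin : fderiv ℝ f z (t • X + t ^ 2 • D) + 1 / 2 * Q (t • X) (t • X) =
      1 / 4 * ‖t‖ ^ 2 * leviReal f z X X := by
    rw [hQ, half_hessian_eq, leviReal_smul_smul, ← theta_re, map_add, map_smul, map_smul, hX, hD,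
      map_smul, map_smul, map_smul, LinearMap.smul_apply]
    simp only [smul_eq_mul]
    rw [hκ]
    simp only [mul_zero, zero_add]
    have : t * (t * holHess f z X X) = -(t ^ 2 * -holHess f z X X) := by ring
    rw [this, Complex.neg_re]
    ring
  have hq1 : |Q (t • X) (t ^ 2 • D)| ≤ ‖t‖ ^ 3 * (‖Q‖ * (‖X‖ * ‖D‖)) := by
    refine (Q.le_opNorm₂ _ _).trans (le_of_eq ?_)
    rw [norm_smul, norm_smul, norm_pow]
    ring
  have hq2 : |Q (t ^ 2 • D) (t ^ 2 • D)| ≤ ‖t‖ ^ 3 * (‖Q‖ * ‖D‖ ^ 2) := by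
    refine (Q.le_opNorm₂ _ _).trans ?_
    rw [norm_smul, norm_pow]
    have : ‖t‖ ^ 4 ≤ ‖t‖ ^ 3 := by
      calc ‖t‖ ^ 4 = ‖t‖ ^ 2 * ‖t‖ ^ 2 := by ring
        _ ≤ ‖t‖ * ‖t‖ ^ 2 := by gcongr
        _ = ‖t‖ ^ 3 := by ring
    nlinarith [mul_le_mul_of_nonneg_right this (by positivity : 0 ≤ ‖Q‖ * ‖D‖ ^ 2)]
  have hexp : Q (t • X + t ^ 2 • D) (t • X + t ^ 2 • D) =
      Q (t • X) (t • X) + 2 * Q (t • X) (t ^ 2 • D) + Q (t ^ 2 • D) (t ^ 2 • D) := by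
    simp only [map_add, add_apply]
    rw [hsym (t ^ 2 • D) (t • X)]
    ring
  have hC3 : C * ‖t • X + t ^ 2 • D‖ ^ 3 ≤ ‖t‖ ^ 3 * (C * (‖X‖ + ‖D‖) ^ 3) := by
    calc _ ≤ C * (‖t‖ * (‖X‖ + ‖D‖)) ^ 3 := by gcongr
      _ = _ := by ring
  have h5 := (abs_le.1 h1).2
  simp only [h0] at h5
  rw [hexp] at h5
  have h6 : f (z + (t • X + t ^ 2 • D)) ≤ ‖t‖ ^ 2 * (1 / 4 * leviReal f z X X + ‖t‖ * K) := by
    have e1 := (abs_le.1 hq1).2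
    have e2 := (abs_le.1 hq2).2
    have e3 : ‖t‖ ^ 2 * (1 / 4 * leviReal f z X X + ‖t‖ * K) =
      1 / 4 * ‖t‖ ^ 2 * leviReal f z X X + (‖t‖ ^ 3 * (C * (‖X‖ + ‖D‖) ^ 3) +
        ‖t‖ ^ 3 * (‖Q‖ * (‖X‖ * ‖D‖)) + 1 / 2 * (‖t‖ ^ 3 * (‖Q‖ * ‖D‖ ^ 2))) := by
      rw [hK]; ring
    linarith
  refine h6.trans_lt ?_
  exact mul_neg_of_pos_of_neg (by positivity) (by linarith)

/-- A smooth boundary point of a pseudoconvex domain is Levi pseudoconvex: otherwise a family of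
holomorphic discs would approach the boundary point from inside with boundaries in a compact subset
of the domain, against the maximum principle for the exhaustion function. -/
theorem leviReal_nonneg_of_isPseudoconvex {Ω : Set (Cn n)} (hΩ : IsPseudoconvex Ω)
    {z₀ e : Cn n} {r : Cn n → ℝ} (hz₀ : z₀ ∈ frontier Ω) (hr : ContDiffAt ℝ ∞ r z₀)
    (h0 : r z₀ = 0) (he : fderiv ℝ r z₀ e = 1)
    (hside : ∀ᶠ z in 𝓝 z₀, z ∈ Ω ↔ r z < 0)
    (htr : ∀ᶠ y in 𝓝 (z₀, (0 : ℝ)), r (y.1 + y.2 • e) = r y.1 + y.2)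
    {X : Cn n} (hX : theta r z₀ X = 0) : 0 ≤ leviReal r z₀ X X := by
  by_contra! hneg
  obtain ⟨hΩo, φ, hφ, hpsh, hexh⟩ := hΩ
  have hz₀Ω : z₀ ∉ Ω := by
    rw [hΩo.frontier_eq] at hz₀
    exact hz₀.2
  have hθe : theta r z₀ e ≠ 0 := by
    intro h
    have := (theta_eq_zero_iff.1 h).1
    rw [he] at this
    exact one_ne_zero this
  set κ : ℂ := -holHess r z₀ X X / theta r z₀ e with hκ
  have hpar := parabola_bound hr h0 hX (κ := κ) (e := e) (by rw [hκ, div_mul_cancel₀ _ hθe]) hneg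
  have hX0 : X ≠ 0 := by
    rintro rfl
    simp [leviReal] at hneg
  let d : ℂ × ℝ → Cn n := fun y => z₀ + (y.1 • X + y.1 ^ 2 • κ • e) + (-y.2) • e
  have hdc : Continuous d := by fun_prop
  -- the discs stay in `Ω` except for the centre of the limiting one
  obtain ⟨t₁, ht₁, hin⟩ : ∃ t₁ > 0, ∀ t : ℂ, ∀ δ : ℝ, ‖t‖ ≤ t₁ → 0 ≤ δ → δ ≤ t₁ →
      (t ≠ 0 ∨ δ ≠ 0) → d (t, δ) ∈ Ω := by
    have h1 : Tendsto d (𝓝 (0, 0)) (𝓝 z₀) := hdc.tendsto' _ _ (by simp [d])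
    have h2 : Tendsto (fun y : ℂ × ℝ => (z₀ + (y.1 • X + y.1 ^ 2 • κ • e), -y.2)) (𝓝 (0, 0))
        (𝓝 (z₀, 0)) := Continuous.tendsto' (by fun_prop) _ _ (by simp)
    have h3 : ∀ᶠ t in 𝓝 (0 : ℂ), t ≠ 0 → r (z₀ + (t • X + t ^ 2 • κ • e)) < 0 :=
      eventually_nhdsWithin_iff.1 hpar
    have h4 : Tendsto (fun y : ℂ × ℝ => y.1) (𝓝 (0, 0)) (𝓝 0) := continuous_fst.tendsto' _ _ rfl
    obtain ⟨R, hR, hball⟩ := Metric.eventually_nhds_iff_ball.1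
      ((h1.eventually hside).and ((h2.eventually htr).and (h4.eventually h3)))
    refine ⟨R / 2, half_pos hR, fun t δ ht hδ0 hδ h => ?_⟩
    obtain ⟨a1, a2, a3⟩ := hball (t, δ) (by
      rw [mem_ball, dist_eq_norm, Prod.norm_def]
      simp only [Prod.fst_sub, Prod.snd_sub, sub_zero, max_lt_iff, Real.norm_eq_abs,
        abs_of_nonneg hδ0]
      constructor <;> linarith)
    refine a1.2 ?_
    simp only at a2 a3
    change r (z₀ + (t • X + t ^ 2 • κ • e) + (-δ) • e) < 0
    rw [a2]
    by_cases ht0 : t = 0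
    · subst ht0
      have : 0 < δ := lt_of_le_of_ne hδ0 (h.resolve_left (by simp)).symm
      simp [h0, this]
    · linarith [a3 ht0]
  -- the boundaries of the discs lie in a compact subset of `Ω`
  have hKc : IsCompact (d '' (sphere (0 : ℂ) t₁ ×ˢ Icc (0 : ℝ) t₁)) :=
    ((isCompact_sphere _ _).prod isCompact_Icc).image hdc
  have hKΩ : d '' (sphere (0 : ℂ) t₁ ×ˢ Icc (0 : ℝ) t₁) ⊆ Ω := by
    rintro _ ⟨⟨t, δ⟩, ⟨ht, hδ⟩, rfl⟩
    rw [mem_sphere_zero_iff_norm] at ht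
    simp only at ht hδ
    refine hin t δ ht.le hδ.1 hδ.2 (Or.inl ?_)
    rintro rfl
    rw [norm_zero] at ht
    exact ht₁.ne ht
  obtain ⟨M, hM⟩ := (hKc.image_of_continuousOn (hφ.continuousOn.mono hKΩ)).bddAbove
  -- by the maximum principle the centres of the discs lie in one sublevel set of `φ`
  have hcen : ∀ δ : ℝ, 0 < δ → δ ≤ t₁ → d (0, δ) ∈ {z ∈ Ω | φ z ≤ M} := by
    intro δ hδ hδ1
    have hdΩ : ∀ t ∈ closedBall (0 : ℂ) t₁, d (t, δ) ∈ Ω := fun t ht =>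
      hin t δ (mem_closedBall_zero_iff.1 ht) hδ.le hδ1 (Or.inr hδ.ne')
    have hdδ : Continuous fun t => d (t, δ) := by fun_prop
    refine ⟨hdΩ 0 (by simp [ht₁.le]), ?_⟩
    obtain ⟨t, ht, hmax⟩ := (isCompact_closedBall (0 : ℂ) t₁).exists_isMaxOn
      ⟨0, by simp [ht₁.le]⟩ (f := fun t => φ (d (t, δ)))
      (hφ.continuousOn.comp hdδ.continuousOn hdΩ)
    have hle : φ (d (0, δ)) ≤ φ (d (t, δ)) := hmax (by simp [ht₁.le])
    by_cases hts : ‖t‖ = t₁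
    · refine hle.trans (hM ⟨d (t, δ), ⟨(t, δ), ⟨?_, hδ.le, hδ1⟩, rfl⟩, rfl⟩)
      exact mem_sphere_zero_iff_norm.2 hts
    · exfalso
      have htb : t ∈ ball (0 : ℂ) t₁ := by
        rw [mem_ball_zero_iff]
        exact lt_of_le_of_ne (mem_closedBall_zero_iff.1 ht) hts
      have hφs : ContDiffAt ℝ ∞ φ (d (t, δ)) := hφ.contDiffAt (hΩo.mem_nhds (hdΩ t ht))
      have hexp : ∀ s : ℂ, d (t + s, δ) =
          d (t, δ) + (s • (X + (2 * t * κ) • e) + s ^ 2 • κ • e) := by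
        intro s
        simp only [d]
        module
      have hloc : IsLocalMax (fun s : ℂ =>
          φ (d (t, δ) + (s • (X + (2 * t * κ) • e) + s ^ 2 • κ • e))) 0 := by
        have h1 : Tendsto (fun s => t + s) (𝓝 0) (𝓝 t) :=
          Continuous.tendsto' (by fun_prop) _ _ (by simp)
        filter_upwards [h1.eventually (isOpen_ball.mem_nhds htb)] with s hs
        rw [← hexp, ← hexp, add_zero]
        exact hmax (ball_subset_closedBall hs)
      have h1 := leviReal_nonpos_of_isLocalMax hφs hloc
      have hB : X + (2 * t * κ) • e ≠ 0 := by
        intro h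
        have h2 := congrArg (theta r z₀) h
        rw [map_add, map_smul, hX, map_zero, zero_add, smul_eq_mul, mul_eq_zero] at h2
        have h3 := h2.resolve_right hθe
        rw [h3, zero_smul, add_zero] at h
        exact hX0 h
      have h2 := hpsh _ (hdΩ t ht) _ hB
      rw [leviForm_eq (hφs.of_le ENat.LEInfty.out), leviSesq_apply] at h2
      simp at h2
      linarith
  -- the centres converge to `z₀ ∉ Ω`, while the sublevel set is closed
  have hcl := (hexh M).isClosed
  have hlim : Tendsto (fun δ : ℝ => d (0, δ)) (𝓝[>] 0) (𝓝 z₀) :=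
    (Continuous.tendsto' (by fun_prop) _ _ (by simp [d])).mono_left nhdsWithin_le_nhds
  refine hz₀Ω (hcl.mem_of_tendsto hlim ?_).1
  filter_upwards [Ioc_mem_nhdsGT ht₁] with δ hδ
  exact hcen δ hδ.1 hδ.2

end Pseudoconvexity

/-! ### Adapted linear coordinates -/

section Unitary

/-- A positive definite Hermitian form on a finite-dimensional space has an orthonormal basis
indexed by any type of the right cardinality. -/
theorem exists_orthonormal_basis_of_posDef {V ι : Type*} [AddCommGroup V] [Module ℂ V]
    [FiniteDimensional ℂ V] [Fintype ι] [DecidableEq ι] (hι : Fintype.card ι = finrank ℂ V)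
    (s : V →ₗ[ℂ] V →ₗ⋆[ℂ] ℂ)
    (hs : ∀ u v, s u v = conj (s v u)) (hp : ∀ v, v ≠ 0 → 0 < (s v v).re) :
    ∃ b : ι → V, ∀ i j, s (b i) (b j) = if i = j then 1 else 0 := by
  let core : InnerProductSpace.Core ℂ V :=
    { inner := fun u v => s v u
      conj_inner_symm := fun u v => (hs v u).symm
      re_inner_nonneg := fun v => by
        by_cases hv : v = 0
        · simp [hv]
        · exact (hp v hv).le
      add_left := fun u v w => by simp
      smul_left := fun u v c => by
        rw [LinearMap.map_smulₛₗ, smul_eq_mul]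
      definite := fun v hv => by
        by_contra h
        have := hp v h
        change s v v = 0 at hv
        rw [hv] at this
        simp at this }
  let _ : NormedAddCommGroup V := core.toNormedAddCommGroup
  let _ : InnerProductSpace ℂ V := InnerProductSpace.ofCore core.toCore
  let b := (stdOrthonormalBasis ℂ V).reindex (Fintype.equivFinOfCardEq hι).symm
  refine ⟨b, fun i j => ?_⟩
  have h : inner ℂ (b j) (b i) = if j = i then (1 : ℂ) else 0 :=
    orthonormal_iff_ite.1 b.orthonormal j i
  simp only [eq_comm (a := i)]
  exact h

end Unitary

section AdaptedCoordinates

variable {n l : ℕ}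

theorem mem_primeIdx {j : Fin n} : j ∈ primeIdx n l ↔ 0 < j.val ∧ j.val + l < n := by
  simp [primeIdx]

theorem mem_doublePrimeIdx {j : Fin n} : j ∈ doublePrimeIdx n l ↔ n ≤ j.val + l := by
  simp [doublePrimeIdx]

theorem card_primeIdx (n l : ℕ) : (primeIdx n l).card = n - l - 1 := by
  have : (primeIdx n l).map Fin.valEmbedding = Finset.Ico 1 (n - l) := by
    ext i
    simp only [Finset.mem_map, mem_primeIdx, Fin.valEmbedding_apply, Finset.mem_Ico]
    constructor
    · rintro ⟨j, hj, rfl⟩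
      omega
    · intro h
      exact ⟨⟨i, by omega⟩, by simp only; omega, rfl⟩
  rw [← Finset.card_map Fin.valEmbedding, this, Nat.card_Ico]

theorem card_doublePrimeIdx (hl : l ≤ n) : (doublePrimeIdx n l).card = l := by
  have : (doublePrimeIdx n l).map Fin.valEmbedding = Finset.Ico (n - l) n := by
    ext i
    simp only [Finset.mem_map, mem_doublePrimeIdx, Fin.valEmbedding_apply, Finset.mem_Ico]
    constructor
    · rintro ⟨j, hj, rfl⟩
      omega
    · intro h
      exact ⟨⟨i, by omega⟩, by simp only; omega, rfl⟩
  rw [← Finset.card_map Fin.valEmbedding, this, Nat.card_Ico]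
  omega

theorem leviSesq_re {E : Type*} [NormedAddCommGroup E] [NormedSpace ℂ E] [NormedSpace ℝ E]
    [IsScalarTower ℝ ℂ E] (f : E → ℝ) (z u v : E) :
    (leviSesq f z u v).re = 1 / 4 * leviReal f z u v := by
  rw [leviSesq_apply]
  simp

theorem leviSesq_comm {E : Type*} [NormedAddCommGroup E] [NormedSpace ℂ E] [NormedSpace ℝ E]
    [IsScalarTower ℝ ℂ E] {f : E → ℝ} {z : E} (hf : ContDiffAt ℝ 2 f z) (u v : E) :
    leviSesq f z u v = conj (leviSesq f z v u) := by
  have h1 : leviReal f z v (Complex.I • u) = -leviReal f z u (Complex.I • v) := by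
    rw [leviReal_comm hf, leviReal_I_left]
  have h2 : conj (1 / 4 : ℂ) = 1 / 4 := by
    have := Complex.conj_ofReal (1 / 4)
    push_cast at this
    exact this
  rw [leviSesq_apply, leviSesq_apply, h1, leviReal_comm hf v u]
  simp only [map_mul, map_add, Complex.conj_ofReal, Complex.conj_I, h2]
  push_cast
  ring

/-- A positive semidefinite Levi form is definite modulo its null space. -/
theorem mem_nullSpace_of_leviReal_eq_zero {E : Type*} [NormedAddCommGroup E] [NormedSpace ℂ E]
    [NormedSpace ℝ E] [IsScalarTower ℝ ℂ E] {f : E → ℝ} {z u : E} (hf : ContDiffAt ℝ 2 f z)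
    (hpos : ∀ v, theta f z v = 0 → 0 ≤ leviReal f z v v) (hu : theta f z u = 0)
    (h : leviReal f z u u = 0) : u ∈ nullSpace f z := by
  refine mem_nullSpace_iff.2 ⟨hu, fun v hv => ?_⟩
  have key : ∀ t : ℝ, 0 ≤ 2 * t * leviReal f z u v + t ^ 2 * leviReal f z v v := by
    intro t
    have h1 := hpos (u + (t : ℂ) • v) (by simp [hu, hv])
    rw [show ((t : ℂ) • v) = t • v from algebraMap_smul ℂ t v] at h1
    simp only [leviReal_add_left, leviReal_add_right, leviReal_smul_left, leviReal_smul_right] at h1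
    rw [h, leviReal_comm hf v u] at h1
    nlinarith
  have hv0 := hpos v hv
  set b := leviReal f z u v
  set a := leviReal f z v v
  have h2 := key (-b / (a + 1))
  have h3 : 2 * (-b / (a + 1)) * b + (-b / (a + 1)) ^ 2 * a = -(b ^ 2 * (a + 2)) / (a + 1) ^ 2 := by
    field_simp
    ring
  rw [h3, neg_div, Left.nonneg_neg_iff] at h2
  have h4 : b ^ 2 * (a + 2) ≤ 0 := by
    by_contra! h5
    exact absurd h2 (not_le.2 (by positivity))
  have : b ^ 2 ≤ 0 := by nlinarith [sq_nonneg b]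
  exact pow_eq_zero_iff (two_ne_zero) |>.1 (le_antisymm this (sq_nonneg b))

/-- Linear coordinates in which the complex tangent space at `z₀` is `{w₁ = 0}`, the Levi null space
is spanned by the last `l` coordinate vectors, and the Levi form is the identity on the span of the
others. -/
theorem exists_adapted_coordinates (hl : l < n) {r : Cn n → ℝ} {z₀ e : Cn n}
    (hr : ContDiffAt ℝ 2 r z₀) (he : fderiv ℝ r z₀ e = 1)
    (hnull : finrank ℂ (nullSpace r z₀) = l)
    (hpos : ∀ X, theta r z₀ X = 0 → 0 ≤ leviReal r z₀ X X) :
    ∃ L : Cn n ≃L[ℂ] Cn n,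
      (∀ j : Fin n, theta r z₀ (L (EuclideanSpace.single j 1)) = 0 ↔ j.val ≠ 0) ∧
      (∀ j ∈ doublePrimeIdx n l, L (EuclideanSpace.single j 1) ∈ nullSpace r z₀) ∧
      ∀ j ∈ primeIdx n l, ∀ k ∈ primeIdx n l,
        leviSesq r z₀ (L (EuclideanSpace.single j 1)) (L (EuclideanSpace.single k 1)) =
          if j = k then 1 else 0 := by
  set K := nullSpace r z₀ with hK
  set T := LinearMap.ker (theta r z₀) with hT
  have hθe : theta r z₀ e ≠ 0 := by
    intro h
    have := (theta_eq_zero_iff.1 h).1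
    rw [he] at this
    exact one_ne_zero this
  have hKT : K ≤ T := fun X hX => hX.1
  -- a complement of the null space in the complex tangent space
  obtain ⟨K', hK'⟩ := (K.comap T.subtype).exists_isCompl
  have hdimT : finrank ℂ T + 1 = n := by
    have h4 := LinearMap.finrank_range_add_finrank_ker (theta r z₀)
    have h5 : LinearMap.range (theta r z₀) = ⊤ := by
      rw [LinearMap.range_eq_top]
      intro c
      exact ⟨(c / theta r z₀ e) • e, by rw [map_smul, smul_eq_mul, div_mul_cancel₀ _ hθe]⟩
    rw [h5, finrank_top, finrank_self, finrank_euclideanSpace, Fintype.card_fin, add_comm] at h4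
    exact h4
  have hdimK' : finrank ℂ K' = n - l - 1 := by
    have h1 := Submodule.finrank_add_eq_of_isCompl hK'
    have h2 : finrank ℂ (K.comap T.subtype) = finrank ℂ K :=
      (Submodule.comapSubtypeEquivOfLe hKT).finrank_eq
    omega
  obtain ⟨b', hb'⟩ := exists_orthonormal_basis_of_posDef (V := K') (ι := primeIdx n l)
    (by rw [Fintype.card_coe, card_primeIdx, hdimK'])
    (((leviSesq r z₀).domRestrict₁₂ T T).domRestrict₁₂ K' K') (fun u v => leviSesq_comm hr _ _) (by
      intro v hv
      change 0 < (leviSesq r z₀ (v : T) (v : T)).re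
      rw [leviSesq_re]
      have hvT : theta r z₀ ((v : T) : Cn n) = 0 := (v : T).2
      refine mul_pos (by norm_num) (lt_of_le_of_ne (hpos _ hvT) fun h => hv ?_)
      have h1 := mem_nullSpace_of_leviReal_eq_zero hr hpos hvT h.symm
      have h2 : (v : T) ∈ K.comap T.subtype ⊓ K' := ⟨h1, v.2⟩
      rw [hK'.inf_eq_bot, Submodule.mem_bot] at h2
      exact Subtype.ext h2)
  have hb'' : Fintype.card (doublePrimeIdx n l) = finrank ℂ K := by
    rw [Fintype.card_coe, card_doublePrimeIdx hl.le, hnull]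
  let b'' : Basis (doublePrimeIdx n l) ℂ K :=
    (finBasis ℂ K).reindex (Fintype.equivFinOfCardEq hb'').symm
  -- the new basis: `e`, then an orthonormal basis of the complement, then a basis of the null space
  let v : Fin n → Cn n := fun j =>
    if h : j ∈ primeIdx n l then ((b' ⟨j, h⟩ : T) : Cn n)
    else if h : j ∈ doublePrimeIdx n l then (b'' ⟨j, h⟩ : Cn n) else e
  have hv' : ∀ j (h : j ∈ primeIdx n l), v j = ((b' ⟨j, h⟩ : T) : Cn n) := fun j h => by
    simp only [v, dif_pos h]
  have hdisj : ∀ j : Fin n, j ∈ doublePrimeIdx n l → j ∉ primeIdx n l := by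
    intro j h h'
    rw [mem_doublePrimeIdx] at h
    rw [mem_primeIdx] at h'
    omega
  have hv'' : ∀ j (h : j ∈ doublePrimeIdx n l), v j = (b'' ⟨j, h⟩ : Cn n) := fun j h => by
    simp only [v, dif_neg (hdisj j h), dif_pos h]
  have hv0 : ∀ j : Fin n, j.val = 0 → v j = e := by
    intro j hj
    have h1 : j ∉ primeIdx n l := by rw [mem_primeIdx]; omega
    have h2 : j ∉ doublePrimeIdx n l := by rw [mem_doublePrimeIdx]; omega
    simp only [v, dif_neg h1, dif_neg h2]
  have hcases : ∀ j : Fin n, j.val ≠ 0 → j ∈ primeIdx n l ∨ j ∈ doublePrimeIdx n l := by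
    intro j hj
    rw [mem_primeIdx, mem_doublePrimeIdx]
    omega
  have hθv : ∀ j : Fin n, theta r z₀ (v j) = 0 ↔ j.val ≠ 0 := by
    intro j
    constructor
    · intro h hj
      rw [hv0 j hj] at h
      exact hθe h
    · intro hj
      rcases hcases j hj with h | h
      · rw [hv' j h]; exact (b' ⟨j, h⟩ : T).2
      · rw [hv'' j h]; exact (b'' ⟨j, h⟩).2.1
  have hKv : ∀ j ∈ doublePrimeIdx n l, v j ∈ K := fun j h => by
    rw [hv'' j h]; exact (b'' ⟨j, h⟩).2
  have hΛv : ∀ j ∈ primeIdx n l, ∀ k ∈ primeIdx n l,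
      leviSesq r z₀ (v j) (v k) = if j = k then 1 else 0 := by
    intro j hj k hk
    rw [hv' j hj, hv' k hk]
    have := hb' ⟨j, hj⟩ ⟨k, hk⟩
    simp only [Subtype.mk.injEq] at this
    exact this
  let A : Cn n →ₗ[ℂ] Cn n := ∑ j, (EuclideanSpace.proj j : Cn n →L[ℂ] ℂ).toLinearMap.smulRight (v j)
  have hA : ∀ w, A w = ∑ j, w j • v j := by
    intro w
    simp [A, LinearMap.sum_apply]
  have hAinj : Function.Injective A := by
    rw [← LinearMap.ker_eq_bot, LinearMap.ker_eq_bot']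
    intro w hw
    rw [hA] at hw
    have h0 : ∀ j : Fin n, j.val = 0 → w j = 0 := by
      intro j hj
      have h1 := congrArg (theta r z₀) hw
      rw [map_sum, map_zero, Finset.sum_eq_single j] at h1
      · rw [map_smul, smul_eq_mul, mul_eq_zero] at h1
        refine h1.resolve_right ?_
        rw [hv0 j hj]
        exact hθe
      · intro k _ hk
        rw [map_smul, (hθv k).2 (fun h => hk (Fin.ext (by omega))), smul_zero]
      · simp
    have h1 : ∀ k ∈ primeIdx n l, w k = 0 := by
      intro k hk
      have hk0 : theta r z₀ (v k) = 0 := (hθv k).2 (by rw [mem_primeIdx] at hk; omega)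
      have h1 := congrArg (fun u => leviSesq r z₀ u (v k)) hw
      simp only [map_sum, LinearMap.sum_apply, map_zero, LinearMap.zero_apply] at h1
      rw [Finset.sum_eq_single k] at h1
      · rw [map_smul, LinearMap.smul_apply, hΛv k hk k hk] at h1
        simpa using h1
      · intro j _ hj
        rw [map_smul, LinearMap.smul_apply]
        by_cases hj0 : j.val = 0
        · rw [h0 j hj0, zero_smul]
        · rcases hcases j hj0 with h | h
          · rw [hΛv j h k hk, if_neg hj, smul_zero]
          · rw [(hKv j h).2 _ hk0, smul_zero]
      · simp
    have h2 : ∑ j : doublePrimeIdx n l, w j • b'' j = 0 := by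
      apply Subtype.ext
      rw [Submodule.coe_sum, Submodule.coe_zero, ← hw]
      rw [← Finset.sum_subset (Finset.subset_univ (doublePrimeIdx n l)),
        ← Finset.sum_coe_sort (doublePrimeIdx n l)]
      · refine Finset.sum_congr rfl fun j _ => ?_
        rw [hv'' j j.2]
        rfl
      · intro j _ hj
        by_cases hj0 : j.val = 0
        · rw [h0 j hj0, zero_smul]
        · rw [h1 j ((hcases j hj0).resolve_right hj), zero_smul]
    have h3 := Fintype.linearIndependent_iff.1 b''.linearIndependent _ h2
    ext j
    by_cases hj0 : j.val = 0
    · exact h0 j hj0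
    · rcases hcases j hj0 with h | h
      · exact h1 j h
      · exact h3 ⟨j, h⟩
  let L : Cn n ≃L[ℂ] Cn n := (LinearEquiv.ofInjectiveEndo A hAinj).toContinuousLinearEquiv
  have hL : ∀ j, L (EuclideanSpace.single j 1) = v j := by
    intro j
    change A (EuclideanSpace.single j 1) = v j
    rw [hA, Finset.sum_eq_single j]
    · simp
    · intro k _ hk
      simp [hk]
    · simp
  refine ⟨L, fun j => by rw [hL]; exact hθv j, fun j hj => by rw [hL]; exact hKv j hj,
    fun j hj k hk => by rw [hL, hL]; exact hΛv j hj k hk⟩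

end AdaptedCoordinates

/-! ### Involutivity of the Levi null distribution and holomorphy of the complex gradient -/

section Involutivity

variable {E : Type*} [NormedAddCommGroup E] [NormedSpace ℂ E] [NormedSpace ℝ E]
  [IsScalarTower ℝ ℂ E]

/-- The two-form `d(df ∘ i)` of `f` at `z`. -/
def leviTwoForm (f : E → ℝ) (z u v : E) : ℝ :=
  fderiv ℝ (fderiv ℝ f) z u (Complex.I • v) - fderiv ℝ (fderiv ℝ f) z v (Complex.I • u)

omit [IsScalarTower ℝ ℂ E] in
theorem leviTwoForm_antisymm (f : E → ℝ) (z u v : E) :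
    leviTwoForm f z u v = -leviTwoForm f z v u := by
  simp [leviTwoForm]

omit [IsScalarTower ℝ ℂ E] in
theorem leviTwoForm_eq {f : E → ℝ} {z : E} (hf : ContDiffAt ℝ 2 f z) (u v : E) :
    leviTwoForm f z u v = leviReal f z u (Complex.I • v) := by
  rw [leviTwoForm, leviReal, I_smul_I_smul, (hf.isSymmSndFDerivAt (by simp)).eq v]
  simp [sub_eq_add_neg]

theorem leviTwoForm_eq_zero_of_mem_nullSpace {f : E → ℝ} {z u v : E} (hf : ContDiffAt ℝ 2 f z)
    (hu : u ∈ nullSpace f z) (hv : theta f z v = 0) : leviTwoForm f z u v = 0 := by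
  rw [leviTwoForm_eq hf]
  exact (mem_nullSpace_iff.1 hu).2 _ (by simp [hv])

theorem hasFDerivAt_smul_I {U : E → E} {U' : E →L[ℝ] E} {q : E} (hU : HasFDerivAt U U' q) :
    HasFDerivAt (fun w => Complex.I • U w) (Complex.I • U') q :=
  hU.const_smul Complex.I

/-- The bracket of two fields of complex tangent vectors is a complex tangent vector wherever the
Levi two-form vanishes on them. -/
theorem theta_lieBracket_eq_zero {f : E → ℝ} {q : E} {U V : E → E} (hf : ContDiffAt ℝ 2 f q)
    (hU : DifferentiableAt ℝ U q) (hV : DifferentiableAt ℝ V q)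
    (hUt : ∀ᶠ w in 𝓝 q, theta f w (U w) = 0) (hVt : ∀ᶠ w in 𝓝 q, theta f w (V w) = 0)
    (h : leviTwoForm f q (U q) (V q) = 0) :
    theta f q (VectorField.lieBracket ℝ U V q) = 0 := by
  have hd : HasFDerivAt (fderiv ℝ f) (fderiv ℝ (fderiv ℝ f) q) q :=
    ((hf.fderiv_right (m := 1) (by norm_num)).differentiableAt (by simp)).hasFDerivAt
  have key : ∀ {U : E → E}, DifferentiableAt ℝ U q → (∀ᶠ w in 𝓝 q, theta f w (U w) = 0) →
      ∀ x, fderiv ℝ (fderiv ℝ f) q x (U q) + fderiv ℝ f q (fderiv ℝ U q x) = 0 ∧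
        fderiv ℝ (fderiv ℝ f) q x (Complex.I • U q) +
          fderiv ℝ f q (Complex.I • fderiv ℝ U q x) = 0 := by
    intro U hU hUt x
    have h1 : HasFDerivAt (fun w => fderiv ℝ f w (U w)) _ q := hd.clm_apply hU.hasFDerivAt
    have h2 : HasFDerivAt (fun w => fderiv ℝ f w (Complex.I • U w)) _ q :=
      hd.clm_apply (hasFDerivAt_smul_I hU.hasFDerivAt)
    have h1' : HasFDerivAt (fun w => fderiv ℝ f w (U w)) (0 : E →L[ℝ] ℝ) q :=
      (hasFDerivAt_const (0 : ℝ) q).congr_of_eventuallyEq (by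
        filter_upwards [hUt] with w hw using (theta_eq_zero_iff.1 hw).1)
    have h2' : HasFDerivAt (fun w => fderiv ℝ f w (Complex.I • U w)) (0 : E →L[ℝ] ℝ) q :=
      (hasFDerivAt_const (0 : ℝ) q).congr_of_eventuallyEq (by
        filter_upwards [hUt] with w hw using (theta_eq_zero_iff.1 hw).2)
    have e1 := congrArg (fun L => L x) (h1.unique h1')
    have e2 := congrArg (fun L => L x) (h2.unique h2')
    simp at e1 e2
    constructor <;> linarith
  have hsym := hf.isSymmSndFDerivAt (by simp)
  obtain ⟨a1, a2⟩ := key hU hUt (V q)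
  obtain ⟨b1, b2⟩ := key hV hVt (U q)
  rw [leviTwoForm] at h
  rw [theta_eq_zero_iff, VectorField.lieBracket, smul_sub, map_sub, map_sub]
  have := hsym.eq (U q) (V q)
  constructor <;> linarith

/-- Differentiating the identity `leviTwoForm (U, V) = 0` along `x`. -/
theorem fderiv_leviTwoForm {f : E → ℝ} {q : E} {U V : E → E} (hf : ContDiffAt ℝ 3 f q)
    (hU : DifferentiableAt ℝ U q) (hV : DifferentiableAt ℝ V q)
    (h : ∀ᶠ w in 𝓝 q, leviTwoForm f w (U w) (V w) = 0) (x : E) :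
    fderiv ℝ (fderiv ℝ (fderiv ℝ f)) q x (U q) (Complex.I • V q)
      - fderiv ℝ (fderiv ℝ (fderiv ℝ f)) q x (V q) (Complex.I • U q)
      + leviTwoForm f q (fderiv ℝ U q x) (V q) + leviTwoForm f q (U q) (fderiv ℝ V q x) = 0 := by
  have hd2 : HasFDerivAt (fderiv ℝ (fderiv ℝ f)) (fderiv ℝ (fderiv ℝ (fderiv ℝ f)) q) q :=
    (((hf.fderiv_right (m := 2) (by norm_num)).fderiv_right (m := 1) (by norm_num)).differentiableAt
      (by simp)).hasFDerivAt
  have h1 := (hd2.clm_apply hU.hasFDerivAt).clm_apply (hasFDerivAt_smul_I hV.hasFDerivAt)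
  have h2 := (hd2.clm_apply hV.hasFDerivAt).clm_apply (hasFDerivAt_smul_I hU.hasFDerivAt)
  have h3 : HasFDerivAt (fun w => leviTwoForm f w (U w) (V w)) _ q := h1.sub h2
  have h4 : HasFDerivAt (fun w => leviTwoForm f w (U w) (V w)) (0 : E →L[ℝ] ℝ) q :=
    (hasFDerivAt_const (0 : ℝ) q).congr_of_eventuallyEq h
  have e := congrArg (fun L => L x) (h3.unique h4)
  simp at e
  simp only [leviTwoForm]
  linarith

theorem differentiableAt_theta {f : E → ℝ} {q : E} (hf : ContDiffAt ℝ 2 f q) (v : E) :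
    DifferentiableAt ℝ (fun w => theta f w v) q := by
  have hd : DifferentiableAt ℝ (fderiv ℝ f) q :=
    (hf.fderiv_right (m := 1) (by norm_num)).differentiableAt (by simp)
  have h : ∀ v, DifferentiableAt ℝ (fun w => (fderiv ℝ f w v : ℂ)) q := fun v =>
    Complex.ofRealCLM.differentiableAt.comp q (hd.clm_apply (differentiableAt_const v))
  exact (h v).sub ((h _).const_mul Complex.I)

/-- The Levi null spaces form an involutive distribution wherever the fields are defined: this is
the closedness of the two-form `d(df ∘ i)`, whose kernel they are. -/
theorem lieBracket_mem_nullSpace {f : E → ℝ} {q e : E} {X Y : E → E} (hf : ContDiffAt ℝ 3 f q)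
    (he : theta f q e ≠ 0) (hX : DifferentiableAt ℝ X q) (hY : DifferentiableAt ℝ Y q)
    (hXn : ∀ᶠ w in 𝓝 q, X w ∈ nullSpace f w) (hYn : ∀ᶠ w in 𝓝 q, Y w ∈ nullSpace f w) :
    VectorField.lieBracket ℝ X Y q ∈ nullSpace f q := by
  have hf2 : ContDiffAt ℝ 2 f q := hf.of_le (by norm_num)
  have hf2' : ∀ᶠ w in 𝓝 q, ContDiffAt ℝ 2 f w := hf2.eventually (by simp)
  have hXt : ∀ᶠ w in 𝓝 q, theta f w (X w) = 0 := hXn.mono fun w hw => hw.1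
  have hYt : ∀ᶠ w in 𝓝 q, theta f w (Y w) = 0 := hYn.mono fun w hw => hw.1
  have hXq := hXn.self_of_nhds
  have hYq := hYn.self_of_nhds
  have hXY : ∀ᶠ w in 𝓝 q, leviTwoForm f w (X w) (Y w) = 0 := by
    filter_upwards [hf2', hXn, hYt] with w h1 h2 h3
    exact leviTwoForm_eq_zero_of_mem_nullSpace h1 h2 h3
  refine mem_nullSpace_iff.2 ⟨theta_lieBracket_eq_zero hf2 hX hY hXt hYt hXY.self_of_nhds,
    fun v hv => ?_⟩
  -- extend `-iv` to a field `W` of complex tangent vectors; it is enough to show that the two-form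
  -- vanishes on `[X, Y]` and `W`
  let W : E → E := fun w => -(Complex.I • v) - (theta f w (-(Complex.I • v)) / theta f w e) • e
  have hθd := fun v => differentiableAt_theta hf2 v
  have hWd : DifferentiableAt ℝ W q := by
    have h1 : DifferentiableAt ℝ (fun w => theta f w (-(Complex.I • v)) / theta f w e) q := by
      simp only [div_eq_mul_inv]
      exact (hθd _).mul ((hθd e).inv he)
    exact (differentiableAt_const _).sub (h1.smul_const e)
  have hWt : ∀ᶠ w in 𝓝 q, theta f w (W w) = 0 := by
    filter_upwards [(hθd e).continuousAt.eventually_ne he] with w hw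
    simp only [W, map_sub, map_smul, smul_eq_mul]
    rw [div_mul_cancel₀ _ hw, sub_self]
  have hWq : W q = -(Complex.I • v) := by
    simp [W, hv]
  have hXW : ∀ᶠ w in 𝓝 q, leviTwoForm f w (X w) (W w) = 0 := by
    filter_upwards [hf2', hXn, hWt] with w h1 h2 h3
    exact leviTwoForm_eq_zero_of_mem_nullSpace h1 h2 h3
  have hYW : ∀ᶠ w in 𝓝 q, leviTwoForm f w (Y w) (W w) = 0 := by
    filter_upwards [hf2', hYn, hWt] with w h1 h2 h3
    exact leviTwoForm_eq_zero_of_mem_nullSpace h1 h2 h3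
  have hWX : ∀ᶠ w in 𝓝 q, leviTwoForm f w (W w) (X w) = 0 := by
    filter_upwards [hXW] with w hw
    rw [leviTwoForm_antisymm, hw, neg_zero]
  -- the brackets `[Y, W]` and `[X, W]` are tangential, so that the two-form vanishes on `X, [Y, W]`
  -- and `Y, [X, W]`; in the cyclic sum of derivatives only the term with `[X, Y]` is left
  have b1 := leviTwoForm_eq_zero_of_mem_nullSpace hf2 hXq
    (theta_lieBracket_eq_zero hf2 hY hWd hYt hWt hYW.self_of_nhds)
  have b2 := leviTwoForm_eq_zero_of_mem_nullSpace hf2 hYq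
    (theta_lieBracket_eq_zero hf2 hX hWd hXt hWt hXW.self_of_nhds)
  have c1 := fderiv_leviTwoForm hf hX hY hXY (W q)
  have c2 := fderiv_leviTwoForm hf hY hWd hYW (X q)
  have c3 := fderiv_leviTwoForm hf hWd hX hWX (Y q)
  -- the third derivatives cancel by symmetry: the two-form is closed
  have hsym1 : ∀ x u v, fderiv ℝ (fderiv ℝ (fderiv ℝ f)) q x u v =
      fderiv ℝ (fderiv ℝ (fderiv ℝ f)) q u x v := fun x u v => by
    rw [((hf.fderiv_right (m := 2) (by norm_num)).isSymmSndFDerivAt (by simp)).eq x u]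
  have d1 := hsym1 (W q) (X q) (Complex.I • Y q)
  have d2 := hsym1 (W q) (Y q) (Complex.I • X q)
  have d3 := hsym1 (X q) (Y q) (Complex.I • W q)
  have e1 := leviTwoForm_antisymm f q (fderiv ℝ X q (W q)) (Y q)
  have e2 := leviTwoForm_antisymm f q (W q) (fderiv ℝ X q (Y q))
  have e3 := leviTwoForm_antisymm f q (fderiv ℝ W q (Y q)) (X q)
  have e4 := leviTwoForm_antisymm f q (W q) (fderiv ℝ Y q (X q))
  have hlin : ∀ u v w, leviTwoForm f q u (v - w) = leviTwoForm f q u v - leviTwoForm f q u w := by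
    intro u v w
    simp only [leviTwoForm, smul_sub, map_sub, sub_apply]
    ring
  have hlin' : ∀ u v w, leviTwoForm f q (v - w) u = leviTwoForm f q v u - leviTwoForm f q w u := by
    intro u v w
    rw [leviTwoForm_antisymm, hlin, leviTwoForm_antisymm f q u v, leviTwoForm_antisymm f q u w]
    ring
  rw [VectorField.lieBracket, hlin] at b1 b2
  have key : leviTwoForm f q (VectorField.lieBracket ℝ X Y q) (W q) = 0 := by
    rw [VectorField.lieBracket, hlin']
    linarith
  rw [leviTwoForm_eq hf2, hWq, smul_neg, I_smul_I_smul, neg_neg] at key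
  exact key

/-- The normalised complex gradient `v ↦ ∂f(v) / ∂f(e)`. -/
def gauss (f : E → ℝ) (e z : E) : E →ₗ[ℂ] ℂ := (theta f z e)⁻¹ • theta f z

theorem gauss_apply (f : E → ℝ) (e z v : E) : gauss f e z v = theta f z v / theta f z e := by
  simp [gauss, div_eq_inv_mul]

theorem gauss_self {f : E → ℝ} {e z : E} (he : theta f z e ≠ 0) : gauss f e z e = 1 := by
  rw [gauss_apply, div_self he]

theorem theta_sub_gauss {f : E → ℝ} {e z : E} (he : theta f z e ≠ 0) (v : E) :
    theta f z (v - gauss f e z v • e) = 0 := by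
  rw [map_sub, map_smul, gauss_apply, smul_eq_mul, div_mul_cancel₀ _ he, sub_self]

/-- The normalised complex gradient satisfies the Cauchy–Riemann equations along the Levi null
directions: the complex tangent spaces vary holomorphically along the leaves. -/
theorem fderiv_gauss_I_smul {f : E → ℝ} {e q X : E} (hf : ContDiffAt ℝ 2 f q)
    (he : theta f q e ≠ 0) (hX : X ∈ nullSpace f q) (u : E) :
    fderiv ℝ (fun w => gauss f e w u) q (Complex.I • X) =
      Complex.I * fderiv ℝ (fun w => gauss f e w u) q X := by
  have hd : HasFDerivAt (fderiv ℝ f) (fderiv ℝ (fderiv ℝ f) q) q :=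
    ((hf.fderiv_right (m := 1) (by norm_num)).differentiableAt (by simp)).hasFDerivAt
  have hval : ∀ v x, fderiv ℝ (fun w => theta f w v) q x =
      (fderiv ℝ (fderiv ℝ f) q x v : ℂ) -
        Complex.I * fderiv ℝ (fderiv ℝ f) q x (Complex.I • v) := by
    intro v x
    have h2 : ∀ v : E, HasFDerivAt (fun w => (fderiv ℝ f w v : ℂ)) _ q := fun v =>
      Complex.ofRealCLM.hasFDerivAt.comp q (hd.clm_apply (hasFDerivAt_const v q))
    have h3 : HasFDerivAt (fun w => theta f w v) _ q :=
      (h2 v).sub ((h2 (Complex.I • v)).const_mul Complex.I)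
    rw [h3.fderiv]
    simp
  -- the antiholomorphic derivative of `theta · v`
  have hbar : ∀ v, fderiv ℝ (fun w => theta f w v) q X +
      Complex.I * fderiv ℝ (fun w => theta f w v) q (Complex.I • X) =
        4 * conj (leviSesq f q X v) := by
    intro v
    have h2 : conj (1 / 4 : ℂ) = 1 / 4 := by
      have := Complex.conj_ofReal (1 / 4)
      push_cast at this
      exact this
    rw [hval, hval, leviSesq_apply, leviReal, leviReal, I_smul_I_smul]
    simp only [map_mul, map_add, Complex.conj_ofReal, Complex.conj_I, h2, map_neg]
    push_cast
    linear_combination (-(fderiv ℝ (fderiv ℝ f) q (Complex.I • X) (Complex.I • v) : ℂ)) *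
      Complex.I_sq
  -- as `X` is a null vector, the Levi form `L(X, v)` depends only on the transversal part of `v`
  have hprop : ∀ v, leviSesq f q X v = conj (gauss f e q v) * leviSesq f q X e := by
    intro v
    have h1 := hX.2 _ (theta_sub_gauss he v)
    rw [map_sub, LinearMap.map_smulₛₗ, smul_eq_mul, sub_eq_zero] at h1
    exact h1
  have hdiv : ∀ x, fderiv ℝ (fun w => gauss f e w u) q x =
      (fderiv ℝ (fun w => theta f w u) q x * theta f q e -
        theta f q u * fderiv ℝ (fun w => theta f w e) q x) / theta f q e ^ 2 := by
    intro x
    have h1 := (differentiableAt_theta hf u).hasFDerivAt.mul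
      ((hasFDerivAt_inv' (𝕜 := ℝ) he).comp q (differentiableAt_theta hf e).hasFDerivAt)
    have h2 : HasFDerivAt (fun w => gauss f e w u) _ q :=
      h1.congr_of_eventuallyEq (Eventually.of_forall fun w => by
        refine (gauss_apply f e w u).trans ((div_eq_mul_inv _ _).trans ?_)
        rfl)
    rw [h2.fderiv]
    simp
    field_simp
    ring
  have k1 := hbar u
  have k2 := hbar e
  rw [hprop u] at k1
  rw [hdiv, hdiv]
  simp only [map_mul, Complex.conj_conj, gauss_apply] at k1
  have k1' : fderiv ℝ (fun w => theta f w u) q (Complex.I • X) = Complex.I *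
      (fderiv ℝ (fun w => theta f w u) q X -
        4 * (theta f q u / theta f q e * conj (leviSesq f q X e))) := by
    linear_combination (-Complex.I) * k1 +
      fderiv ℝ (fun w => theta f w u) q (Complex.I • X) * Complex.I_sq
  have k2' : fderiv ℝ (fun w => theta f w e) q (Complex.I • X) = Complex.I *
      (fderiv ℝ (fun w => theta f w e) q X - 4 * conj (leviSesq f q X e)) := by
    linear_combination (-Complex.I) * k2 +
      fderiv ℝ (fun w => theta f w e) q (Complex.I • X) * Complex.I_sq
  rw [k1', k2']
  field_simp
  ring

end Involutivity

/-! ### Smooth dependence of the forms on parameters, and coordinate projections -/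

section SmoothForms

variable {E X : Type*} [NormedAddCommGroup E] [NormedSpace ℂ E] [NormedSpace ℝ E]
  [IsScalarTower ℝ ℂ E] [NormedAddCommGroup X] [NormedSpace ℝ X]

theorem contDiffAt_I_smul {u : X → E} {x : X} (hu : ContDiffAt ℝ ∞ u x) :
    ContDiffAt ℝ ∞ (fun y => Complex.I • u y) x :=
  hu.const_smul Complex.I

theorem contDiffAt_ofReal {h : X → ℝ} {x : X} (hh : ContDiffAt ℝ ∞ h x) :
    ContDiffAt ℝ ∞ (fun y => (h y : ℂ)) x :=
  Complex.ofRealCLM.contDiff.contDiffAt.comp x hh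

omit [NormedSpace ℂ E] [IsScalarTower ℝ ℂ E] in
theorem contDiffAt_fderiv_apply {f : E → ℝ} {q u : X → E} {x : X} (hf : ContDiffAt ℝ ∞ f (q x))
    (hq : ContDiffAt ℝ ∞ q x) (hu : ContDiffAt ℝ ∞ u x) :
    ContDiffAt ℝ ∞ (fun y => fderiv ℝ f (q y) (u y)) x :=
  ((hf.fderiv_right (m := ∞) (by simp)).comp x hq).clm_apply hu

omit [NormedSpace ℂ E] [IsScalarTower ℝ ℂ E] in
theorem contDiffAt_fderiv_fderiv_apply {f : E → ℝ} {q u v : X → E} {x : X}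
    (hf : ContDiffAt ℝ ∞ f (q x)) (hq : ContDiffAt ℝ ∞ q x) (hu : ContDiffAt ℝ ∞ u x)
    (hv : ContDiffAt ℝ ∞ v x) :
    ContDiffAt ℝ ∞ (fun y => fderiv ℝ (fderiv ℝ f) (q y) (u y) (v y)) x :=
  ((((hf.fderiv_right (m := ∞) (by simp)).fderiv_right (m := ∞) (by simp)).comp x
    hq).clm_apply hu).clm_apply hv

theorem contDiffAt_theta {f : E → ℝ} {q u : X → E} {x : X} (hf : ContDiffAt ℝ ∞ f (q x))
    (hq : ContDiffAt ℝ ∞ q x) (hu : ContDiffAt ℝ ∞ u x) :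
    ContDiffAt ℝ ∞ (fun y => theta f (q y) (u y)) x := by
  simp only [theta_apply]
  exact (contDiffAt_ofReal (contDiffAt_fderiv_apply hf hq hu)).sub
    (contDiffAt_const.mul
      (contDiffAt_ofReal (contDiffAt_fderiv_apply hf hq (contDiffAt_I_smul hu))))

theorem contDiffAt_gauss {f : E → ℝ} {e : E} {q u : X → E} {x : X} (hf : ContDiffAt ℝ ∞ f (q x))
    (he : theta f (q x) e ≠ 0) (hq : ContDiffAt ℝ ∞ q x) (hu : ContDiffAt ℝ ∞ u x) :
    ContDiffAt ℝ ∞ (fun y => gauss f e (q y) (u y)) x := by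
  simp only [gauss_apply, div_eq_mul_inv]
  exact (contDiffAt_theta hf hq hu).mul ((contDiffAt_theta hf hq contDiffAt_const).inv he)

omit [IsScalarTower ℝ ℂ E] in
theorem contDiffAt_leviReal {f : E → ℝ} {q u v : X → E} {x : X} (hf : ContDiffAt ℝ ∞ f (q x))
    (hq : ContDiffAt ℝ ∞ q x) (hu : ContDiffAt ℝ ∞ u x) (hv : ContDiffAt ℝ ∞ v x) :
    ContDiffAt ℝ ∞ (fun y => leviReal f (q y) (u y) (v y)) x := by
  simp only [leviReal]
  exact (contDiffAt_fderiv_fderiv_apply hf hq hu hv).add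
    (contDiffAt_fderiv_fderiv_apply hf hq (contDiffAt_I_smul hu) (contDiffAt_I_smul hv))

theorem contDiffAt_leviSesq {f : E → ℝ} {q u v : X → E} {x : X} (hf : ContDiffAt ℝ ∞ f (q x))
    (hq : ContDiffAt ℝ ∞ q x) (hu : ContDiffAt ℝ ∞ u x) (hv : ContDiffAt ℝ ∞ v x) :
    ContDiffAt ℝ ∞ (fun y => leviSesq f (q y) (u y) (v y)) x := by
  simp only [leviSesq_apply]
  exact contDiffAt_const.mul ((contDiffAt_ofReal (contDiffAt_leviReal hf hq hu hv)).add
    (contDiffAt_const.mul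
      (contDiffAt_ofReal (contDiffAt_leviReal hf hq hu (contDiffAt_I_smul hv)))))

theorem contDiffAt_holHess {f : E → ℝ} {q u v : X → E} {x : X} (hf : ContDiffAt ℝ ∞ f (q x))
    (hq : ContDiffAt ℝ ∞ q x) (hu : ContDiffAt ℝ ∞ u x) (hv : ContDiffAt ℝ ∞ v x) :
    ContDiffAt ℝ ∞ (fun y => holHess f (q y) (u y) (v y)) x := by
  have hiu := contDiffAt_I_smul hu
  have hiv := contDiffAt_I_smul hv
  simp only [holHess_apply]
  exact contDiffAt_const.mul (((contDiffAt_ofReal (contDiffAt_fderiv_fderiv_apply hf hq hu hv)).sub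
    (contDiffAt_ofReal (contDiffAt_fderiv_fderiv_apply hf hq hiu hiv))).sub
    (contDiffAt_const.mul ((contDiffAt_ofReal (contDiffAt_fderiv_fderiv_apply hf hq hu hiv)).add
      (contDiffAt_ofReal (contDiffAt_fderiv_fderiv_apply hf hq hiu hv)))))

/-- A real differentiable map is complex differentiable if its derivative commutes with `i`. -/
theorem differentiableAt_complex_of_fderiv_I {F G : Type*} [NormedAddCommGroup F]
    [NormedSpace ℂ F] [NormedAddCommGroup G] [NormedSpace ℂ G] {h : F → G} {x : F}
    (hh : DifferentiableAt ℝ h x)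
    (hI : ∀ v, fderiv ℝ h x (Complex.I • v) = Complex.I • fderiv ℝ h x v) :
    DifferentiableAt ℂ h x := by
  rw [differentiableAt_iff_restrictScalars ℝ hh]
  refine ⟨{ toFun := fderiv ℝ h x, map_add' := map_add _, map_smul' := fun c v => ?_,
            cont := (fderiv ℝ h x).continuous }, rfl⟩
  have h1 : c • v = c.re • v + c.im • (Complex.I • v) := complex_smul_eq c v
  have h2 := complex_smul_eq c (fderiv ℝ h x v)
  rw [h1, map_add, map_smul, map_smul, hI, RingHom.id_apply, h2]

end SmoothForms

section CoordinateProjections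

variable {n l : ℕ}

/-- The `j`-th coordinate vector of `ℂⁿ`. -/
abbrev stdVec (j : Fin n) : Cn n := EuclideanSpace.single j 1

/-- The orthogonal projection onto the span of the coordinate vectors at the positions in `s`. -/
def coordProj (s : Finset (Fin n)) : Cn n →L[ℂ] Cn n :=
  ∑ j ∈ s, (EuclideanSpace.proj j : Cn n →L[ℂ] ℂ).smulRight (stdVec j)

theorem coordProj_eq_sum (s : Finset (Fin n)) (ζ : Cn n) :
    coordProj s ζ = ∑ j ∈ s, ζ j • stdVec j := by
  simp [coordProj]

theorem coordProj_apply (s : Finset (Fin n)) (ζ : Cn n) (k : Fin n) :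
    coordProj s ζ k = if k ∈ s then ζ k else 0 := by
  rw [coordProj_eq_sum]
  simp [Finset.sum_apply, Pi.single_apply]

theorem coordProj_coordProj (s t : Finset (Fin n)) (ζ : Cn n) :
    coordProj s (coordProj t ζ) = coordProj (s ∩ t) ζ := by
  ext k
  simp only [coordProj_apply, Finset.mem_inter]
  split_ifs <;> tauto

theorem norm_coordProj (s : Finset (Fin n)) (ζ : Cn n) : ‖coordProj s ζ‖ = partNorm s ζ := by
  rw [EuclideanSpace.norm_eq, partNorm]
  congr 1
  rw [← Finset.sum_subset (Finset.subset_univ s)]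
  · exact Finset.sum_congr rfl fun j hj => by rw [coordProj_apply, if_pos hj]
  · intro j _ hj
    rw [coordProj_apply, if_neg hj]
    simp

theorem finrank_range_comp_coordProj_le (s : Finset (Fin n)) (A : Cn n →L[ℂ] Cn n) :
    finrank ℂ (LinearMap.range (A ∘L coordProj s : Cn n →ₗ[ℂ] Cn n)) ≤ s.card := by
  have h : LinearMap.range (A ∘L coordProj s : Cn n →ₗ[ℂ] Cn n) ≤
      Submodule.span ℂ ((s.image fun j => A (stdVec j) : Finset (Cn n)) : Set (Cn n)) := by
    rintro _ ⟨ζ, rfl⟩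
    change A (coordProj s ζ) ∈ _
    rw [coordProj_eq_sum, map_sum]
    refine Submodule.sum_mem _ fun j hj => ?_
    rw [map_smul]
    exact Submodule.smul_mem _ _ (Submodule.subset_span
      (Finset.mem_coe.2 (Finset.mem_image_of_mem _ hj)))
  exact (Submodule.finrank_mono h).trans ((finrank_span_finset_le_card _).trans
    Finset.card_image_le)

theorem contDiffAt_toContinuousLinearMap {X : Type*} [NormedAddCommGroup X] [NormedSpace ℝ X]
    {A : X → Cn n →ₗ[ℂ] Cn n} {x : X} (h : ∀ k, ContDiffAt ℝ ∞ (fun y => A y (stdVec k)) x) :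
    ContDiffAt ℝ ∞ (fun y => LinearMap.toContinuousLinearMap (A y)) x := by
  have h1 : (fun y => LinearMap.toContinuousLinearMap (A y)) = fun y =>
      ∑ k, ((ContinuousLinearMap.smulRightL ℂ (Cn n) (Cn n)
        (EuclideanSpace.proj k : Cn n →L[ℂ] ℂ)).restrictScalars ℝ) (A y (stdVec k)) := by
    funext y
    ext1 ζ
    have h2 : ζ = ∑ k, ζ k • stdVec k := by
      ext j
      simp [Finset.sum_apply, Pi.single_apply]
    conv_lhs => rw [h2]
    simp
  rw [h1]
  exact ContDiffAt.sum fun k _ => (ContinuousLinearMap.contDiff _).contDiffAt.comp x (h k)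

theorem disjoint_primeIdx_doublePrimeIdx : Disjoint (primeIdx n l) (doublePrimeIdx n l) := by
  rw [Finset.disjoint_left]
  intro j h1 h2
  rw [mem_primeIdx] at h1
  rw [mem_doublePrimeIdx] at h2
  omega

theorem coord_decomposition (hl : l < n) {i₀ : Fin n} (hi₀ : i₀.val = 0) (ζ : Cn n) :
    ζ = ζ i₀ • stdVec i₀ + coordProj (primeIdx n l) ζ + coordProj (doublePrimeIdx n l) ζ := by
  ext k
  simp only [PiLp.add_apply, PiLp.smul_apply, coordProj_apply, mem_primeIdx, mem_doublePrimeIdx,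
    PiLp.single_apply, smul_eq_mul]
  by_cases hk : k = i₀
  · subst hk
    simp [hi₀, hl]
  · have : k.val ≠ 0 := fun h => hk (Fin.ext (h.trans hi₀.symm))
    split_ifs <;> first | omega | simp

end CoordinateProjections

/-! ### A smooth frame of the Levi null spaces -/

section Frame

variable {n l : ℕ} {i₀ : Fin n} {f : Cn n → ℝ}

/-- A function near the origin of `ℂⁿ` whose Levi null spaces have constant dimension `l`, in linear
coordinates adapted to its complex tangent space, its Levi null space and its Levi form at `0`. The
first coordinate is the one at the position `i₀`. -/
structure IsAdapted (l : ℕ) (i₀ : Fin n) (f : Cn n → ℝ) : Prop where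
  index_eq : i₀.val = 0
  lt : l < n
  value_zero : f 0 = 0
  smooth : ∀ᶠ z in 𝓝 0, ContDiffAt ℝ ∞ f z
  theta_stdVec_iff : ∀ j, theta f 0 (stdVec j) = 0 ↔ j.val ≠ 0
  stdVec_mem_nullSpace : ∀ j ∈ doublePrimeIdx n l, stdVec j ∈ nullSpace f 0
  leviSesq_stdVec : ∀ j ∈ primeIdx n l, ∀ k ∈ primeIdx n l,
    leviSesq f 0 (stdVec j) (stdVec k) = if j = k then 1 else 0
  finrank_eq : ∀ᶠ z in 𝓝 0, finrank ℂ (nullSpace f z) = l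

namespace IsAdapted

theorem theta_stdVec_ne (hf : IsAdapted l i₀ f) : theta f 0 (stdVec i₀) ≠ 0 := by
  rw [Ne, hf.theta_stdVec_iff]
  simp [hf.index_eq]

theorem eventually_theta_ne (hf : IsAdapted l i₀ f) : ∀ᶠ z in 𝓝 0, theta f z (stdVec i₀) ≠ 0 := by
  have h : ContDiffAt ℝ ∞ (fun z => theta f z (stdVec i₀)) 0 :=
    contDiffAt_theta hf.smooth.self_of_nhds contDiffAt_id contDiffAt_const
  exact h.continuousAt.eventually_ne hf.theta_stdVec_ne

/-- At the origin the complex tangent space is `{ζ₁ = 0}`. -/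
theorem theta_zero_apply (hf : IsAdapted l i₀ f) (ζ : Cn n) :
    theta f 0 ζ = ζ i₀ * theta f 0 (stdVec i₀) := by
  have h : ∀ s : Finset (Fin n), (∀ j ∈ s, j.val ≠ 0) → theta f 0 (coordProj s ζ) = 0 := by
    intro s hs
    rw [coordProj_eq_sum, map_sum]
    refine Finset.sum_eq_zero fun j hj => ?_
    rw [map_smul, (hf.theta_stdVec_iff j).2 (hs j hj), smul_zero]
  have hlt := hf.lt
  conv_lhs => rw [coord_decomposition hf.lt hf.index_eq ζ]
  rw [map_add, map_add, h, h, map_smul, smul_eq_mul, add_zero, add_zero]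
  · intro j hj
    rw [mem_doublePrimeIdx] at hj
    omega
  · intro j hj
    rw [mem_primeIdx] at hj
    omega

theorem gauss_zero_apply (hf : IsAdapted l i₀ f) (ζ : Cn n) : gauss f (stdVec i₀) 0 ζ = ζ i₀ := by
  rw [gauss_apply, hf.theta_zero_apply, mul_div_cancel_right₀ _ hf.theta_stdVec_ne]

end IsAdapted

/-- The complex tangential part of `u` at `z`, obtained by projecting along `e`. -/
def tangential {E : Type*} [NormedAddCommGroup E] [NormedSpace ℂ E] [NormedSpace ℝ E]
    [IsScalarTower ℝ ℂ E] (f : E → ℝ) (e z : E) : E →ₗ[ℂ] E :=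
  LinearMap.id - (gauss f e z).smulRight e

section

variable {E : Type*} [NormedAddCommGroup E] [NormedSpace ℂ E] [NormedSpace ℝ E]
    [IsScalarTower ℝ ℂ E]

theorem tangential_apply (f : E → ℝ) (e z u : E) :
    tangential f e z u = u - gauss f e z u • e := rfl

theorem theta_tangential {f : E → ℝ} {e z : E} (he : theta f z e ≠ 0) (u : E) :
    theta f z (tangential f e z u) = 0 := theta_sub_gauss he u

theorem contDiffAt_tangential {X : Type*} [NormedAddCommGroup X] [NormedSpace ℝ X]
    {f : E → ℝ} {e : E} {q u : X → E} {x : X} (hf : ContDiffAt ℝ ∞ f (q x))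
    (he : theta f (q x) e ≠ 0) (hq : ContDiffAt ℝ ∞ q x) (hu : ContDiffAt ℝ ∞ u x) :
    ContDiffAt ℝ ∞ (fun y => tangential f e (q y) (u y)) x := by
  simp only [tangential_apply]
  exact hu.sub ((contDiffAt_gauss hf he hq hu).smul contDiffAt_const)

end

/-- The linear map `B_q : X ↦ 2∂f(X) e₁ + ∑ L(X, e_jᵀ) e_j + X''`, where `j` runs through the
positions of `ζ'` and `e_jᵀ` is the tangential part of `e_j` at `q`. It is designed such that every
Levi null vector `X` at `q` satisfies `B_q X = X''`; since `B_q` is invertible near the origin, `X`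
can be recovered smoothly from `X''`. -/
def nullOperator (l : ℕ) (i₀ : Fin n) (f : Cn n → ℝ) (q : Cn n) : Cn n →ₗ[ℂ] Cn n :=
  (theta f q).smulRight (stdVec i₀)
    + ∑ j ∈ primeIdx n l,
      ((leviSesq f q).flip (tangential f (stdVec i₀) q (stdVec j))).smulRight (stdVec j)
    + (coordProj (doublePrimeIdx n l) : Cn n →ₗ[ℂ] Cn n)

theorem nullOperator_apply (q X : Cn n) : nullOperator l i₀ f q X =
    theta f q X • stdVec i₀
    + ∑ j ∈ primeIdx n l, leviSesq f q X (tangential f (stdVec i₀) q (stdVec j)) • stdVec j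
    + coordProj (doublePrimeIdx n l) X := by
  simp [nullOperator]

theorem nullOperator_of_mem_nullSpace {q X : Cn n} (he : theta f q (stdVec i₀) ≠ 0)
    (hX : X ∈ nullSpace f q) : nullOperator l i₀ f q X = coordProj (doublePrimeIdx n l) X := by
  rw [nullOperator_apply, hX.1, zero_smul, zero_add, Finset.sum_eq_zero, zero_add]
  intro j _
  rw [hX.2 _ (theta_tangential he _), zero_smul]

theorem IsAdapted.tangential_zero_stdVec (hf : IsAdapted l i₀ f) {j : Fin n}
    (hj : j ∈ primeIdx n l) : tangential f (stdVec i₀) 0 (stdVec j) = stdVec j := by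
  have hi := hf.index_eq
  rw [mem_primeIdx] at hj
  have : i₀ ≠ j := fun h => by rw [← h] at hj; omega
  rw [tangential_apply, hf.gauss_zero_apply]
  simp [this]

theorem IsAdapted.leviSesq_zero_coordProj (hf : IsAdapted l i₀ f) {k : Fin n}
    (hk : k ∈ primeIdx n l) (ζ : Cn n) :
    leviSesq f 0 (coordProj (primeIdx n l) ζ) (stdVec k) = ζ k := by
  rw [coordProj_eq_sum, map_sum]
  simp only [LinearMap.sum_apply, map_smul, LinearMap.smul_apply]
  have hs : ∀ j ∈ primeIdx n l, ζ j • leviSesq f 0 (stdVec j) (stdVec k) =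
      if j = k then ζ k else 0 := by
    intro j hj
    rw [hf.leviSesq_stdVec j hj k hk]
    split_ifs with hjk
    · rw [hjk, smul_eq_mul, mul_one]
    · rw [smul_zero]
  rw [Finset.sum_congr rfl hs]
  simp [hk]

theorem IsAdapted.injective_nullOperator (hf : IsAdapted l i₀ f) :
    Function.Injective (nullOperator l i₀ f 0) := by
  rw [injective_iff_map_eq_zero]
  intro X hX
  rw [nullOperator_apply] at hX
  have hlt := hf.lt
  have hi := hf.index_eq
  have hc : ∀ k : Fin n, (theta f 0 X * if k = i₀ then 1 else 0) +
      (if k ∈ primeIdx n l then leviSesq f 0 X (stdVec k) else 0) +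
      (if k ∈ doublePrimeIdx n l then X k else 0) = 0 := by
    intro k
    have h := congrArg (fun v : Cn n => v k) hX
    rw [Finset.sum_congr rfl fun j hj => by rw [hf.tangential_zero_stdVec hj]] at h
    have hs : (∑ j ∈ primeIdx n l, leviSesq f 0 X (stdVec j) • stdVec j) k =
        if k ∈ primeIdx n l then leviSesq f 0 X (stdVec k) else 0 := by
      simp [Finset.sum_apply, Pi.single_apply]
    simp only [PiLp.add_apply, hs, PiLp.smul_apply, PiLp.single_apply, coordProj_apply,
      smul_eq_mul, PiLp.zero_apply] at h
    exact h
  have h0 : X i₀ = 0 := by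
    have h := hc i₀
    have h1 : i₀ ∉ primeIdx n l := by rw [mem_primeIdx]; omega
    have h2 : i₀ ∉ doublePrimeIdx n l := by rw [mem_doublePrimeIdx]; omega
    rw [if_pos rfl, if_neg h1, if_neg h2, hf.theta_zero_apply] at h
    simpa [hf.theta_stdVec_ne] using h
  have h'' : coordProj (doublePrimeIdx n l) X = 0 := by
    ext k
    rw [coordProj_apply]
    split_ifs with hk
    · have h := hc k
      have h1 : k ∉ primeIdx n l := Finset.disjoint_right.1 disjoint_primeIdx_doublePrimeIdx hk
      have h2 : k ≠ i₀ := by rw [mem_doublePrimeIdx] at hk; rintro rfl; omega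
      rw [if_neg h2, if_neg h1, if_pos hk] at h
      simpa using h
    · rfl
  have hX' : X = coordProj (primeIdx n l) X := by
    conv_lhs => rw [coord_decomposition hf.lt hf.index_eq X, h0, h'']
    simp
  rw [hX']
  ext k
  rw [coordProj_apply]
  split_ifs with hk
  · have h := hc k
    have h1 : k ∉ doublePrimeIdx n l := Finset.disjoint_left.1 disjoint_primeIdx_doublePrimeIdx hk
    have h2 : k ≠ i₀ := by rw [mem_primeIdx] at hk; rintro rfl; omega
    rwa [if_neg h2, if_pos hk, if_neg h1, mul_zero, zero_add, add_zero, hX',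
      hf.leviSesq_zero_coordProj hk] at h
  · rfl

/-- A smooth family of complex linear maps onto the Levi null spaces, inverting the projection
`X ↦ X''` there. -/
theorem IsAdapted.exists_null_frame (hf : IsAdapted l i₀ f) :
    ∃ F : Cn n → Cn n →L[ℂ] Cn n, (∀ᶠ q in 𝓝 0, ContDiffAt ℝ ∞ F q) ∧
      ∀ᶠ q in 𝓝 0, (∀ v, F q v ∈ nullSpace f q) ∧
        (∀ v, coordProj (doublePrimeIdx n l) (F q v) = coordProj (doublePrimeIdx n l) v) ∧
        (∀ v, F q (coordProj (doublePrimeIdx n l) v) = F q v) ∧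
        ∀ X ∈ nullSpace f q, F q X = X := by
  set P := coordProj (doublePrimeIdx n l) with hP
  let B : Cn n → Cn n →L[ℂ] Cn n := fun q => LinearMap.toContinuousLinearMap (nullOperator l i₀ f q)
  have hBs : ∀ᶠ q in 𝓝 0, ContDiffAt ℝ ∞ B q := by
    filter_upwards [hf.smooth, hf.eventually_theta_ne] with q hq hq'
    refine contDiffAt_toContinuousLinearMap fun k => ?_
    simp only [nullOperator_apply]
    refine ((contDiffAt_theta hq contDiffAt_id contDiffAt_const).smul contDiffAt_const).add
      (ContDiffAt.sum fun j _ => ?_) |>.add contDiffAt_const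
    exact (contDiffAt_leviSesq hq contDiffAt_id contDiffAt_const
      (contDiffAt_tangential hq hq' contDiffAt_id contDiffAt_const)).smul contDiffAt_const
  have hB0 : IsUnit (B 0) := by
    rw [ContinuousLinearMap.isUnit_iff_bijective]
    exact ⟨hf.injective_nullOperator,
      (LinearMap.injective_iff_surjective (f := nullOperator l i₀ f 0)).1 hf.injective_nullOperator⟩
  have hBu : ∀ᶠ q in 𝓝 0, IsUnit (B q) :=
    hBs.self_of_nhds.continuousAt.eventually (Units.isOpen.mem_nhds hB0)
  refine ⟨fun q => Ring.inverse (B q) * P, ?_, ?_⟩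
  · filter_upwards [hBs, hBu] with q hq ⟨u, hu⟩
    have h1 : ContDiffAt ℝ ∞ Ring.inverse (B q) := by
      rw [← hu]
      exact (contDiffAt_ringInverse ℂ u).restrict_scalars ℝ
    exact (h1.comp q hq).mul contDiffAt_const
  · filter_upwards [hBu, hf.eventually_theta_ne, hf.finrank_eq] with q hq hθ hrk
    have hfix : ∀ X ∈ nullSpace f q, Ring.inverse (B q) (P X) = X := by
      intro X hX
      have h1 : B q X = P X := nullOperator_of_mem_nullSpace hθ hX
      rw [← h1, ← mul_apply_eq_comp, Ring.inverse_mul_cancel _ hq]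
      rfl
    -- the null space is contained in the range of `v ↦ B⁻¹ v''`, whose dimension is at most `l`
    have heq : nullSpace f q =
        LinearMap.range (Ring.inverse (B q) ∘L P : Cn n →ₗ[ℂ] Cn n) := by
      refine Submodule.eq_of_le_of_finrank_le (fun X hX => ⟨X, hfix X hX⟩) ?_
      rw [hrk]
      exact (finrank_range_comp_coordProj_le _ _).trans (card_doublePrimeIdx hf.lt.le).le
    have hmem : ∀ v, Ring.inverse (B q) (P v) ∈ nullSpace f q := by
      intro v
      rw [heq]
      exact ⟨v, rfl⟩
    have hPP : ∀ v, P (P v) = P v := fun v => by rw [hP, coordProj_coordProj, Finset.inter_self]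
    refine ⟨hmem, fun v => ?_, fun v => ?_, hfix⟩
    · have h1 : B q (Ring.inverse (B q) (P v)) = P (Ring.inverse (B q) (P v)) :=
        nullOperator_of_mem_nullSpace hθ (hmem v)
      rw [← mul_apply_eq_comp, Ring.mul_inverse_cancel _ hq] at h1
      exact h1.symm
    · change Ring.inverse (B q) (P (P v)) = Ring.inverse (B q) (P v)
      rw [hPP]

end Frame

/-! ### The leaves of the Levi foliation -/

section Leaves

variable {n l : ℕ} {i₀ : Fin n} {f : Cn n → ℝ}

/-- Germs in two variables with vanishing partial derivative in the second one do not depend on it.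
-/
theorem eventually_eq_of_hasFDerivAt_zero {E H : Type*} [NormedAddCommGroup E] [NormedSpace ℝ E]
    [NormedAddCommGroup H] [NormedSpace ℝ H] {h : E × E → H} {z : E}
    (hh : ∀ᶠ x in 𝓝 (z, (0 : E)), HasFDerivAt (fun v => h (x.1, v)) (0 : E →L[ℝ] H) x.2) :
    ∀ᶠ x in 𝓝 (z, (0 : E)), h x = h (x.1, 0) := by
  rw [nhds_prod_eq] at hh ⊢
  obtain ⟨p, hp, q, hq, hpq⟩ := eventually_prod_iff.1 hh
  obtain ⟨δ, hδ, hball⟩ := Metric.eventually_nhds_iff_ball.1 hq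
  filter_upwards [prod_mem_prod hp (ball_mem_nhds (0 : E) hδ)] with x hx
  have hd : ∀ v ∈ ball (0 : E) δ, HasFDerivAt (fun v => h (x.1, v)) (0 : E →L[ℝ] H) v :=
    fun v hv => hpq hx.1 (hball v hv)
  exact isOpen_ball.is_const_of_fderiv_eq_zero (convex_ball (0 : E) δ).isPreconnected
    (fun v hv => (hd v hv).differentiableAt.differentiableWithinAt)
    (fun v hv => (hd v hv).fderiv) hx.2 (mem_ball_self hδ)

/-- The leaves of the Levi foliation: through every `p` near the origin there passes a complex
manifold `v ↦ G (p, v)`, parametrised by `v''`, that is contained in a level set of `f` and along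
which the complex tangent spaces vary holomorphically. -/
theorem IsAdapted.exists_leaves (hf : IsAdapted l i₀ f) :
    ∃ G : Cn n × Cn n → Cn n, (∀ᶠ x in 𝓝 (0, 0), ContDiffAt ℝ ∞ G x) ∧
      (∀ᶠ p in 𝓝 0, G (p, 0) = p) ∧
      (∀ p v, G (p, coordProj (doublePrimeIdx n l) v) = G (p, v)) ∧
      (∀ᶠ x in 𝓝 (0, 0), DifferentiableAt ℂ (fun v => G (x.1, v)) x.2) ∧
      (∀ᶠ x in 𝓝 (0, 0), f (G x) = f x.1) ∧
      (∀ᶠ x in 𝓝 (0, 0), coordProj (doublePrimeIdx n l) (G x) =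
        coordProj (doublePrimeIdx n l) (x.1 + x.2)) ∧
      ∀ᶠ x in 𝓝 (0, 0), ∀ u,
        DifferentiableAt ℂ (fun v => gauss f (stdVec i₀) (G (x.1, v)) u) x.2 := by
  set P := coordProj (doublePrimeIdx n l) with hP
  have hPP : ∀ v, P (P v) = P v := fun v => by rw [hP, coordProj_coordProj, Finset.inter_self]
  obtain ⟨Fc, hFs, hF⟩ := hf.exists_null_frame
  let F : Cn n → Cn n →L[ℝ] Cn n := fun q => (Fc q).restrictScalars ℝ
  have hFs' : ∀ᶠ q in 𝓝 0, ContDiffAt ℝ ∞ F q := by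
    filter_upwards [hFs] with q hq
    exact (ContinuousLinearMap.restrictScalarsL ℂ (Cn n) (Cn n) ℝ ℝ).contDiff.contDiffAt.comp q hq
  have hcomm : ∀ᶠ q in 𝓝 0, ∀ v w, fderiv ℝ F q (F q v) w = fderiv ℝ F q (F q w) v := by
    filter_upwards [hf.smooth, hf.eventually_theta_ne, hFs', hF.eventually_nhds]
      with q hfq hθ hFq hFe v w
    have hd : HasFDerivAt F (fderiv ℝ F q) q := (hFq.differentiableAt (by simp)).hasFDerivAt
    have hdv : ∀ v, HasFDerivAt (fun y => F y v) ((fderiv ℝ F q).flip v) q := fun v => by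
      have := hd.clm_apply (hasFDerivAt_const v q)
      simpa using this
    have hZ := lieBracket_mem_nullSpace (by exact_mod_cast contDiffAt_infty.1 hfq 3) hθ
      (hdv v).differentiableAt (hdv w).differentiableAt
      (hFe.mono fun y hy => hy.1 v) (hFe.mono fun y hy => hy.1 w)
    have hZ' : VectorField.lieBracket ℝ (fun y => F y v) (fun y => F y w) q =
        fderiv ℝ F q (F q v) w - fderiv ℝ F q (F q w) v := by
      rw [VectorField.lieBracket, (hdv v).fderiv, (hdv w).fderiv]
      rfl
    -- the last coordinates of the frame fields are constant
    have hPd : ∀ w x, P (fderiv ℝ F q x w) = 0 := by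
      intro w x
      have h1 : HasFDerivAt (fun y => P (F y w))
          ((P.restrictScalars ℝ) ∘L (fderiv ℝ F q).flip w) q :=
        (P.restrictScalars ℝ).hasFDerivAt.comp q (hdv w)
      have h2 : HasFDerivAt (fun y => P (F y w)) (0 : Cn n →L[ℝ] Cn n) q :=
        (hasFDerivAt_const (P w) q).congr_of_eventuallyEq (hFe.mono fun y hy => hy.2.1 w)
      exact congrArg (fun L => L x) (h1.unique h2)
    -- hence the bracket is a null vector `Z` with `Z'' = 0`, and vanishes
    rw [hZ'] at hZ
    obtain ⟨-, -, h3, h4⟩ := hFe.self_of_nhds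
    rw [← sub_eq_zero, ← h4 _ hZ, ← h3, map_sub, hPd, hPd, sub_zero, map_zero]
  obtain ⟨G₀, hGs, hG0, hGd⟩ := exists_leaf_parametrization hFs' hcomm
  -- make the parametrisation depend on `v''` only
  let ι : Cn n × Cn n → Cn n × Cn n := fun x => (x.1, P x.2)
  have hι : ContDiff ℝ ∞ ι :=
    contDiff_fst.prodMk ((P.restrictScalars ℝ).contDiff.comp contDiff_snd)
  have hιt : Tendsto ι (𝓝 (0, 0)) (𝓝 (0, 0)) := hι.continuous.tendsto' _ _ (by simp [ι])
  let G : Cn n × Cn n → Cn n := fun x => G₀ (ι x)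
  have hGs' : ∀ᶠ x in 𝓝 (0, 0), ContDiffAt ℝ ∞ G x := by
    filter_upwards [hιt.eventually hGs] with x hx
    exact hx.comp x hι.contDiffAt
  have hG00 : G (0, 0) = 0 := by
    simp only [G, ι, map_zero]
    exact hG0.self_of_nhds
  have hGt : Tendsto G (𝓝 (0, 0)) (𝓝 0) := by
    have := hGs'.self_of_nhds.continuousAt
    rwa [ContinuousAt, hG00] at this
  have hGd' : ∀ᶠ x in 𝓝 (0, 0), HasFDerivAt (fun v => G (x.1, v)) (F (G x)) x.2 := by
    filter_upwards [hιt.eventually hGd, hGt.eventually hF] with x hx hFx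
    have h1 : HasFDerivAt (fun v => G (x.1, v)) (F (G x) ∘L P.restrictScalars ℝ) x.2 :=
      HasFDerivAt.comp x.2 (g := fun v => G₀ (x.1, v)) hx (P.restrictScalars ℝ).hasFDerivAt
    convert h1 using 1
    ext1 v
    exact (hFx.2.2.1 v).symm
  have hfst : Tendsto (fun x : Cn n × Cn n => x.1) (𝓝 (0, 0)) (𝓝 0) :=
    continuous_fst.tendsto' _ _ rfl
  have hG0' : ∀ᶠ x : Cn n × Cn n in 𝓝 (0, 0), G (x.1, 0) = x.1 := by
    filter_upwards [hfst.eventually hG0] with x hx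
    simp only [G, ι, map_zero]
    exact hx
  refine ⟨G, hGs', ?_, fun p v => ?_, ?_, ?_, ?_, ?_⟩
  · filter_upwards [hG0] with x hx
    simp only [G, ι, map_zero]
    exact hx
  · simp only [G, ι, hPP]
  · filter_upwards [hGd'] with x hx
    exact HasFDerivAt.differentiableAt (𝕜 := ℂ) (f' := Fc (G x))
      (hasFDerivAt_of_restrictScalars ℝ hx rfl)
  · have h1 : ∀ᶠ x in 𝓝 (0, 0), HasFDerivAt (fun v => f (G (x.1, v))) (0 : Cn n →L[ℝ] ℝ) x.2 := by
      filter_upwards [hGd', hGt.eventually hF, hGt.eventually hf.smooth] with x hx hFx hfx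
      have h2 : HasFDerivAt (fun v => f (G (x.1, v))) (fderiv ℝ f (G x) ∘L F (G x)) x.2 :=
        HasFDerivAt.comp x.2 (hfx.differentiableAt (by simp)).hasFDerivAt hx
      convert h2 using 1
      ext1 v
      exact (theta_eq_zero_iff.1 (hFx.1 v).1).1.symm
    filter_upwards [eventually_eq_of_hasFDerivAt_zero (h := fun x => f (G x)) h1, hG0'] with x hx h0
    rw [hx, h0]
  · have h1 : ∀ᶠ x in 𝓝 (0, 0),
        HasFDerivAt (fun v => P (G (x.1, v)) - P v) (0 : Cn n →L[ℝ] Cn n) x.2 := by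
      filter_upwards [hGd', hGt.eventually hF] with x hx hFx
      have h2 : HasFDerivAt (fun v => P (G (x.1, v)) - P v)
          (P.restrictScalars ℝ ∘L F (G x) - P.restrictScalars ℝ) x.2 :=
        ((P.restrictScalars ℝ).hasFDerivAt.comp x.2 hx).sub (P.restrictScalars ℝ).hasFDerivAt
      convert h2 using 1
      ext1 v
      exact (sub_eq_zero.2 (hFx.2.1 v)).symm
    filter_upwards [eventually_eq_of_hasFDerivAt_zero (h := fun x => P (G x) - P x.2) h1, hG0']
      with x hx h0
    rw [h0, map_zero, sub_zero, sub_eq_iff_eq_add] at hx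
    rw [hx, map_add]
  · filter_upwards [hGd', hGt.eventually hF, hGt.eventually hf.smooth,
      hGt.eventually hf.eventually_theta_ne] with x hx hFx hfx hθ u
    have h1 : ContDiffAt ℝ ∞ (fun y => gauss f (stdVec i₀) y u) (G x) :=
      contDiffAt_gauss hfx hθ contDiffAt_id contDiffAt_const
    have h2 : HasFDerivAt (fun v => gauss f (stdVec i₀) (G (x.1, v)) u) _ x.2 :=
      HasFDerivAt.comp x.2 (g := fun y => gauss f (stdVec i₀) y u)
        (h1.differentiableAt (by simp)).hasFDerivAt hx
    refine differentiableAt_complex_of_fderiv_I h2.differentiableAt fun v => ?_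
    rw [h2.fderiv]
    change fderiv ℝ _ (G x) (Fc (G x) (Complex.I • v)) = _ • fderiv ℝ _ (G x) (Fc (G x) v)
    rw [map_smul]
    exact fderiv_gauss_I_smul (hfx.of_le ENat.LEInfty.out) hθ (hFx.1 v) u

end Leaves

/-! ### Smooth normalisation of the Levi form -/

section SquareRoot

variable {A : Type*} [NormedRing A] [NormedAlgebra ℝ A] [CompleteSpace A]

/-- A smooth square root near `1` in a Banach algebra. It is unique there, and therefore invariant
under the continuous symmetries of the squaring map. -/
theorem exists_smooth_sqrt : ∃ s : A → A, s 1 = 1 ∧ (∀ᶠ a in 𝓝 1, ContDiffAt ℝ ∞ s a) ∧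
    (∀ᶠ a in 𝓝 1, s a * s a = a) ∧
    ∀ T : A → A, Continuous T → T 1 = 1 → (∀ x, T (x * x) = T x * T x) →
      ∀ᶠ a in 𝓝 1, T a = a → T (s a) = s a := by
  have hsq : ContDiff ℝ ∞ fun x : A => x * x := contDiff_id.mul contDiff_id
  have hd : HasFDerivAt (fun x : A => x * x)
      ((ContinuousLinearEquiv.smulLeft (Units.mk0 (2 : ℝ) two_ne_zero) : A ≃L[ℝ] A) : A →L[ℝ] A)
      1 := by
    have h := (hasFDerivAt_id (𝕜 := ℝ) (1 : A)).mul' (hasFDerivAt_id (1 : A))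
    have h2 : ((ContinuousLinearEquiv.smulLeft (Units.mk0 (2 : ℝ) two_ne_zero) : A ≃L[ℝ] A) :
        A →L[ℝ] A) = (1 : A) • ContinuousLinearMap.id ℝ A +
          MulOpposite.op (1 : A) • ContinuousLinearMap.id ℝ A := by
      ext x
      simpa using two_smul ℝ x
    rw [h2]
    exact h
  obtain ⟨e, he, hef, hs⟩ := exists_smooth_inverse
    (Eventually.of_forall fun x => hsq.contDiffAt) hd
  have hef' : ∀ x, e x = x * x := fun x => by rw [hef]
  have he1 : e 1 = 1 := by rw [hef', mul_one]
  simp only [mul_one] at hs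
  have hs1 : e.symm 1 = 1 := by
    conv_lhs => rw [← he1]
    exact e.left_inv he
  have htgt : e.target ∈ 𝓝 (1 : A) := by
    have h1 := e.map_source he
    rw [he1] at h1
    exact e.open_target.mem_nhds h1
  have hst : Tendsto e.symm (𝓝 1) (𝓝 1) := by
    have := hs.self_of_nhds.continuousAt
    rwa [ContinuousAt, hs1] at this
  have hmul : ∀ᶠ a in 𝓝 1, e.symm a * e.symm a = a := by
    filter_upwards [htgt] with a ha
    rw [← hef', e.right_inv ha]
  refine ⟨e.symm, hs1, hs, hmul, fun T hT hT1 hTm => ?_⟩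
  have hTt : Tendsto (fun a => T (e.symm a)) (𝓝 1) (𝓝 1) := by
    have h := hT.tendsto 1
    rw [hT1] at h
    exact h.comp hst
  filter_upwards [hmul, hTt.eventually (e.open_source.mem_nhds he)] with a ha hTa h
  have h1 : e (T (e.symm a)) = a := by rw [hef', ← hTm, ha, h]
  rw [← e.left_inv hTa, h1]

end SquareRoot

section Normalization

variable {n l : ℕ} {i₀ : Fin n} {f : Cn n → ℝ}

/-- The Gram operator of the Levi form at `p` on the tangential parts of the vectors `P'ζ`, extended
by the identity. -/
def leviGram (l : ℕ) (i₀ : Fin n) (f : Cn n → ℝ) (p : Cn n) : Cn n →ₗ[ℂ] Cn n :=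
  LinearMap.id - (coordProj (primeIdx n l) : Cn n →ₗ[ℂ] Cn n) +
    ∑ j ∈ primeIdx n l, ((leviSesq f p).flip (tangential f (stdVec i₀) p (stdVec j)) ∘ₗ
      tangential f (stdVec i₀) p ∘ₗ
        (coordProj (primeIdx n l) : Cn n →ₗ[ℂ] Cn n)).smulRight (stdVec j)

theorem leviGram_apply (p ζ : Cn n) : leviGram l i₀ f p ζ =
    ζ - coordProj (primeIdx n l) ζ + ∑ j ∈ primeIdx n l,
      leviSesq f p (tangential f (stdVec i₀) p (coordProj (primeIdx n l) ζ))
        (tangential f (stdVec i₀) p (stdVec j)) • stdVec j := by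
  simp [leviGram]

theorem inner_coordProj (s : Finset (Fin n)) (x y : Cn n) :
    inner ℂ x (coordProj s y) = inner ℂ (coordProj s x) y := by
  rw [PiLp.inner_apply, PiLp.inner_apply]
  refine Finset.sum_congr rfl fun j _ => ?_
  rw [coordProj_apply, coordProj_apply]
  split_ifs <;> simp

theorem inner_leviGram (p x y : Cn n) : inner ℂ x (leviGram l i₀ f p y) =
    inner ℂ x (y - coordProj (primeIdx n l) y) +
      leviSesq f p (tangential f (stdVec i₀) p (coordProj (primeIdx n l) y))
        (tangential f (stdVec i₀) p (coordProj (primeIdx n l) x)) := by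
  rw [leviGram_apply, inner_add_right, inner_sum]
  congr 1
  rw [coordProj_eq_sum _ x, map_sum, map_sum]
  refine Finset.sum_congr rfl fun j _ => ?_
  rw [inner_smul_right, map_smul, LinearMap.map_smulₛₗ, EuclideanSpace.inner_single_right, one_mul,
    smul_eq_mul, mul_comm]

theorem coordProj_stdVec_sum (s : Finset (Fin n)) (c : Fin n → ℂ) :
    coordProj s (∑ j ∈ s, c j • stdVec j) = ∑ j ∈ s, c j • stdVec j := by
  ext k
  rw [coordProj_apply]
  split_ifs with hk
  · rfl
  · simp [Finset.sum_apply, Pi.single_apply, hk]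

theorem coordProj_leviGram (p ζ : Cn n) : coordProj (primeIdx n l) (leviGram l i₀ f p ζ) =
    leviGram l i₀ f p (coordProj (primeIdx n l) ζ) := by
  rw [leviGram_apply, leviGram_apply, map_add, coordProj_stdVec_sum, map_sub,
    coordProj_coordProj, Finset.inter_self, sub_self]

theorem IsAdapted.leviGram_zero (hf : IsAdapted l i₀ f) : leviGram l i₀ f 0 = LinearMap.id := by
  have hi := hf.index_eq
  have h1 : i₀ ∉ primeIdx n l := by rw [mem_primeIdx]; omega
  refine LinearMap.ext fun ζ => ?_
  rw [leviGram_apply, tangential_apply, hf.gauss_zero_apply, coordProj_apply, if_neg h1, zero_smul,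
    sub_zero, Finset.sum_congr rfl fun j hj => by
      rw [hf.tangential_zero_stdVec hj, hf.leviSesq_zero_coordProj hj],
    ← coordProj_eq_sum, sub_add_cancel, LinearMap.id_apply]

/-- A smooth family of changes of the coordinates `ζ'` that turns the Levi form at `p` into
`|ζ'|²`. -/
theorem IsAdapted.exists_levi_normalization (hf : IsAdapted l i₀ f) :
    ∃ M N : Cn n → Cn n →L[ℂ] Cn n, (∀ᶠ p in 𝓝 0, ContDiffAt ℝ ∞ M p) ∧
      (∀ᶠ p in 𝓝 0, ContDiffAt ℝ ∞ N p) ∧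
      ∀ᶠ p in 𝓝 0, (∀ x, N p (M p x) = x) ∧ (∀ x, M p (N p x) = x) ∧
        (∀ x, coordProj (primeIdx n l) (M p x) = M p (coordProj (primeIdx n l) x)) ∧
        (∀ x, coordProj (primeIdx n l) (N p x) = N p (coordProj (primeIdx n l) x)) ∧
        ∀ x, 1 / 4 * leviReal f p
            (tangential f (stdVec i₀) p (M p (coordProj (primeIdx n l) x)))
            (tangential f (stdVec i₀) p (M p (coordProj (primeIdx n l) x))) =
          ‖coordProj (primeIdx n l) x‖ ^ 2 := by
  set P := coordProj (primeIdx n l) with hP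
  have hPP : ∀ v, P (P v) = P v := fun v => by rw [hP, coordProj_coordProj, Finset.inter_self]
  obtain ⟨s, hs1, hss, hsm, hsT⟩ := exists_smooth_sqrt (A := Cn n →L[ℂ] Cn n)
  let L : Cn n → Cn n →L[ℂ] Cn n := fun p => LinearMap.toContinuousLinearMap (leviGram l i₀ f p)
  have hL0 : L 0 = 1 := by
    simp only [L, hf.leviGram_zero]
    rfl
  have hLs : ∀ᶠ p in 𝓝 0, ContDiffAt ℝ ∞ L p := by
    filter_upwards [hf.smooth, hf.eventually_theta_ne] with p hp hp'
    refine contDiffAt_toContinuousLinearMap fun k => ?_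
    simp only [leviGram_apply]
    refine contDiffAt_const.add (ContDiffAt.sum fun j _ => ?_)
    exact (contDiffAt_leviSesq hp contDiffAt_id
      (contDiffAt_tangential hp hp' contDiffAt_id contDiffAt_const)
      (contDiffAt_tangential hp hp' contDiffAt_id contDiffAt_const)).smul contDiffAt_const
  have hLt : Tendsto L (𝓝 0) (𝓝 1) := by
    have := hLs.self_of_nhds.continuousAt
    rwa [ContinuousAt, hL0] at this
  let N : Cn n → Cn n →L[ℂ] Cn n := fun p => s (L p)
  have hNs : ∀ᶠ p in 𝓝 0, ContDiffAt ℝ ∞ N p := by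
    filter_upwards [hLs, hLt.eventually hss] with p h1 h2
    exact h2.comp p h1
  have hN0 : N 0 = 1 := by simp only [N, hL0, hs1]
  have hNt : Tendsto N (𝓝 0) (𝓝 1) := by
    have := hNs.self_of_nhds.continuousAt
    rwa [ContinuousAt, hN0] at this
  have hNu : ∀ᶠ p in 𝓝 0, IsUnit (N p) := hNt.eventually (Units.isOpen.mem_nhds isUnit_one)
  -- the root commutes with `P'` because it is invariant under conjugation by the reflection `1 -
  -- 2P'`
  let U : Cn n →L[ℂ] Cn n := 1 - (2 : ℂ) • P
  have hUU : U * U = 1 := by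
    ext1 x
    simp only [U, mul_apply_eq_comp, sub_apply, one_apply_eq_self,
      smul_apply, map_sub, map_smul, hPP]
    module
  -- the root of a self-adjoint operator is self-adjoint
  have hstar := hLt.eventually (hsT (fun a => ContinuousLinearMap.adjoint a)
    (ContinuousLinearMap.adjoint (𝕜 := ℂ) (E := Cn n) (F := Cn n)).continuous
    (ContinuousLinearMap.adjoint_id) fun x => ContinuousLinearMap.adjoint_comp x x)
  have hconj := hLt.eventually (hsT (fun a => U * a * U) (by fun_prop) (by rw [mul_one, hUU])
    fun x => by
      have : U * x * U * (U * x * U) = U * x * (U * U) * x * U := by noncomm_ring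
      rw [this, hUU, mul_one]
      noncomm_ring)
  refine ⟨fun p => Ring.inverse (N p), N, ?_, hNs, ?_⟩
  · filter_upwards [hNs, hNu] with p hp ⟨u, hu⟩
    have h1 : ContDiffAt ℝ ∞ Ring.inverse (N p) := by
      rw [← hu]
      exact (contDiffAt_ringInverse ℂ u).restrict_scalars ℝ
    exact h1.comp p hp
  filter_upwards [hf.smooth, hNu, hstar, hconj, hLt.eventually hsm] with p hfp hu h1 h2 h3
  have hNM : ∀ x, N p (Ring.inverse (N p) x) = x := fun x => by
    rw [← mul_apply_eq_comp, Ring.mul_inverse_cancel _ hu]; rfl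
  have hMN : ∀ x, Ring.inverse (N p) (N p x) = x := fun x => by
    rw [← mul_apply_eq_comp, Ring.inverse_mul_cancel _ hu]; rfl
  have hself : ContinuousLinearMap.adjoint (L p) = L p := by
    refine ContinuousLinearMap.ext fun x => ext_inner_right ℂ fun y => ?_
    rw [ContinuousLinearMap.adjoint_inner_left, ← inner_conj_symm _ y]
    change inner ℂ x (leviGram l i₀ f p y) = conj (inner ℂ y (leviGram l i₀ f p x))
    rw [inner_leviGram, inner_leviGram, map_add, inner_conj_symm,
      ← leviSesq_comm (hfp.of_le ENat.LEInfty.out), inner_sub_right, inner_sub_left,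
      inner_coordProj]
  have hNself : ∀ x y, inner ℂ (N p x) y = inner ℂ x (N p y) := by
    intro x y
    have h4 : ContinuousLinearMap.adjoint (N p) = N p := h1 hself
    conv_lhs => rw [← h4]
    rw [ContinuousLinearMap.adjoint_inner_left]
  have hLP : ∀ x, P (L p x) = L p (P x) := coordProj_leviGram p
  have hULU : U * L p * U = L p := by
    have h4 : U * L p = L p * U := by
      ext1 x
      simp only [U, mul_apply_eq_comp, sub_apply, one_apply_eq_self,
        smul_apply, map_sub, map_smul, hLP]
    rw [h4, mul_assoc, hUU, mul_one]
  have hNP : ∀ x, P (N p x) = N p (P x) := by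
    intro x
    have h4 : U * N p = N p * U := by
      have := congrArg (· * U) (h2 hULU)
      simp only [mul_assoc, hUU, mul_one] at this
      exact this
    have h5 := congrArg (fun B => B x) h4
    simp only [U, mul_apply_eq_comp, sub_apply, one_apply_eq_self,
      smul_apply, map_sub, map_smul] at h5
    have h6 := sub_right_injective h5
    exact smul_right_injective _ two_ne_zero h6
  have hMP : ∀ x, P (Ring.inverse (N p) x) = Ring.inverse (N p) (P x) := by
    intro x
    rw [← hMN (P (Ring.inverse (N p) x)), ← hNP, hNM]
  refine ⟨hNM, hMN, hMP, hNP, fun x => ?_⟩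
  set y := Ring.inverse (N p) (P x) with hy
  have hPy : P y = y := by rw [hy, hMP, hPP]
  have h4 : inner ℂ y (L p y) = inner ℂ (P x) (P x) := by
    have h5 : L p y = N p (N p y) := by
      conv_lhs => rw [← h3]
      rfl
    rw [h5, ← hNself, hy, hNM]
  change inner ℂ y (leviGram l i₀ f p y) = _ at h4
  rw [inner_leviGram, ← hP, hPy, sub_self, inner_zero_right, zero_add] at h4
  rw [← leviSesq_re, h4, inner_self_eq_norm_sq_to_K]
  norm_cast

end Normalization

/-! ### The charts -/

section Charts

variable {n l : ℕ} {i₀ : Fin n} {f : Cn n → ℝ} {G : Cn n × Cn n → Cn n}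
  {M N : Cn n → Cn n →L[ℂ] Cn n}

/-- Parametrisations `G` of the leaves of the Levi foliation of `f` near the origin, together with
linear maps `M p`, with inverses `N p`, that normalise the Levi form at `p`. -/
structure IsLeafFrame (l : ℕ) (i₀ : Fin n) (f : Cn n → ℝ) (G : Cn n × Cn n → Cn n)
    (M N : Cn n → Cn n →L[ℂ] Cn n) : Prop where
  leaf_smooth : ∀ᶠ x in 𝓝 (0, 0), ContDiffAt ℝ ∞ G x
  leaf_zero : ∀ᶠ p in 𝓝 0, G (p, 0) = p
  leaf_coordProj : ∀ p v, G (p, coordProj (doublePrimeIdx n l) v) = G (p, v)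
  leaf_holomorphic : ∀ᶠ x in 𝓝 (0, 0), DifferentiableAt ℂ (fun v => G (x.1, v)) x.2
  leaf_level : ∀ᶠ x in 𝓝 (0, 0), f (G x) = f x.1
  coordProj_leaf : ∀ᶠ x in 𝓝 (0, 0), coordProj (doublePrimeIdx n l) (G x) =
    coordProj (doublePrimeIdx n l) (x.1 + x.2)
  gauss_holomorphic : ∀ᶠ x in 𝓝 (0, 0), ∀ u,
    DifferentiableAt ℂ (fun v => gauss f (stdVec i₀) (G (x.1, v)) u) x.2
  smooth_M : ∀ᶠ p in 𝓝 0, ContDiffAt ℝ ∞ M p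
  smooth_N : ∀ᶠ p in 𝓝 0, ContDiffAt ℝ ∞ N p
  N_M : ∀ᶠ p in 𝓝 0, ∀ x, N p (M p x) = x
  M_N : ∀ᶠ p in 𝓝 0, ∀ x, M p (N p x) = x
  coordProj_M : ∀ᶠ p in 𝓝 0, ∀ x,
    coordProj (primeIdx n l) (M p x) = M p (coordProj (primeIdx n l) x)
  coordProj_N : ∀ᶠ p in 𝓝 0, ∀ x,
    coordProj (primeIdx n l) (N p x) = N p (coordProj (primeIdx n l) x)
  leviReal_M : ∀ᶠ p in 𝓝 0, ∀ x, 1 / 4 * leviReal f p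
      (tangential f (stdVec i₀) p (M p (coordProj (primeIdx n l) x)))
      (tangential f (stdVec i₀) p (M p (coordProj (primeIdx n l) x))) =
    ‖coordProj (primeIdx n l) x‖ ^ 2

theorem IsAdapted.exists_isLeafFrame (hf : IsAdapted l i₀ f) :
    ∃ G M N, IsLeafFrame l i₀ f G M N := by
  obtain ⟨G, h1, h2, h3, h4, h5, h6, h7⟩ := hf.exists_leaves
  obtain ⟨M, N, k1, k2, k3⟩ := hf.exists_levi_normalization
  exact ⟨G, M, N, h1, h2, h3, h4, h5, h6, h7, k1, k2, k3.mono fun p h => h.1,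
    k3.mono fun p h => h.2.1, k3.mono fun p h => h.2.2.1, k3.mono fun p h => h.2.2.2.1,
    k3.mono fun p h => h.2.2.2.2⟩

/-- The coefficient of `e₁` that removes the complex bilinear part of the Hessian of `f` at `p` on
the tangential part of `M ζ'`. -/
def quadraticShift (l : ℕ) (i₀ : Fin n) (f : Cn n → ℝ) (M : Cn n → Cn n →L[ℂ] Cn n)
    (p ζ : Cn n) : ℂ :=
  -holHess f p (tangential f (stdVec i₀) p (M p (coordProj (primeIdx n l) ζ)))
    (tangential f (stdVec i₀) p (M p (coordProj (primeIdx n l) ζ))) / theta f p (stdVec i₀)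

/-- The parametrisation `(p, ζ) ↦ Ψ_p(ζ)` of a neighbourhood of `p`: the coordinates `ζ''` move
along the leaf through `p`, the coordinates `ζ'` in the complex tangent space at the point reached
on that leaf, and `ζ₁` in the transversal direction. -/
def chartInverse (l : ℕ) (i₀ : Fin n) (f : Cn n → ℝ) (G : Cn n × Cn n → Cn n)
    (M : Cn n → Cn n →L[ℂ] Cn n) (x : Cn n × Cn n) : Cn n :=
  G x + tangential f (stdVec i₀) (G x) (M x.1 (coordProj (primeIdx n l) x.2)) +
    (x.2 i₀ / theta f x.1 (stdVec i₀) + quadraticShift l i₀ f M x.1 x.2) • stdVec i₀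

/-- The chart `(p, z) ↦ Φ_p(z)` around `p`, inverse to `chartInverse`. -/
def chart (l : ℕ) (i₀ : Fin n) (f : Cn n → ℝ) (G : Cn n × Cn n → Cn n)
    (M N : Cn n → Cn n →L[ℂ] Cn n) (x : Cn n × Cn n) : Cn n :=
  coordProj (doublePrimeIdx n l) (x.2 - x.1) +
    N x.1 (coordProj (primeIdx n l) (x.2 - G (x.1, x.2 - x.1))) +
    (theta f x.1 (stdVec i₀) *
      (gauss f (stdVec i₀) (G (x.1, x.2 - x.1)) (x.2 - G (x.1, x.2 - x.1)) -
        quadraticShift l i₀ f M x.1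
          (N x.1 (coordProj (primeIdx n l) (x.2 - G (x.1, x.2 - x.1)))))) • stdVec i₀

theorem coordProj_self (s : Finset (Fin n)) (ζ : Cn n) :
    coordProj s (coordProj s ζ) = coordProj s ζ := by
  rw [coordProj_coordProj, Finset.inter_self]

theorem coordProj_of_disjoint {s t : Finset (Fin n)} (h : Disjoint s t) (ζ : Cn n) :
    coordProj s (coordProj t ζ) = 0 := by
  rw [coordProj_coordProj, Finset.disjoint_iff_inter_eq_empty.1 h]
  simp [coordProj]

theorem coordProj_stdVec_of_notMem {s : Finset (Fin n)} {i : Fin n} (h : i ∉ s) :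
    coordProj s (stdVec i) = 0 := by
  ext k
  rw [coordProj_apply]
  split_ifs with hk
  · have : k ≠ i := fun h' => h (h' ▸ hk)
    simp [this]
  · rfl

theorem coordProj_apply_of_notMem {s : Finset (Fin n)} {i : Fin n} (h : i ∉ s) (ζ : Cn n) :
    coordProj s ζ i = 0 := by
  rw [coordProj_apply, if_neg h]

theorem IsAdapted.notMem_primeIdx (hf : IsAdapted l i₀ f) : i₀ ∉ primeIdx n l := by
  have := hf.index_eq
  rw [mem_primeIdx]
  omega

theorem IsAdapted.notMem_doublePrimeIdx (hf : IsAdapted l i₀ f) : i₀ ∉ doublePrimeIdx n l := by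
  have := hf.index_eq
  have := hf.lt
  rw [mem_doublePrimeIdx]
  omega

theorem quadraticShift_coordProj (p ζ : Cn n) :
    quadraticShift l i₀ f M p (coordProj (primeIdx n l) ζ) = quadraticShift l i₀ f M p ζ := by
  simp only [quadraticShift, coordProj_self]

namespace IsLeafFrame

theorem G_zero (hF : IsLeafFrame l i₀ f G M N) : G (0, 0) = 0 := hF.leaf_zero.self_of_nhds

theorem tendsto_G (hF : IsLeafFrame l i₀ f G M N) : Tendsto G (𝓝 (0, 0)) (𝓝 0) := by
  have := hF.leaf_smooth.self_of_nhds.continuousAt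
  rwa [ContinuousAt, hF.G_zero] at this

end IsLeafFrame

theorem tendsto_fst_zero : Tendsto (fun x : Cn n × Cn n => x.1) (𝓝 (0, 0)) (𝓝 0) :=
  continuous_fst.tendsto' _ _ rfl

/-- The change of variables `(p, z) ↦ (p, z - p)`. -/
def relative (x : Cn n × Cn n) : Cn n × Cn n := (x.1, x.2 - x.1)

theorem contDiff_relative : ContDiff ℝ ∞ (relative : Cn n × Cn n → Cn n × Cn n) :=
  contDiff_fst.prodMk (contDiff_snd.sub contDiff_fst)

theorem tendsto_relative : Tendsto (relative : Cn n × Cn n → Cn n × Cn n) (𝓝 (0, 0)) (𝓝 (0, 0)) :=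
  contDiff_relative.continuous.tendsto' _ _ (by simp [relative])

theorem chart_chartInverse (hf : IsAdapted l i₀ f) (hF : IsLeafFrame l i₀ f G M N) :
    ∀ᶠ x in 𝓝 (0, 0), chart l i₀ f G M N (x.1, chartInverse l i₀ f G M x) = x.2 := by
  filter_upwards [hF.coordProj_leaf, tendsto_fst_zero.eventually hf.eventually_theta_ne,
    hF.tendsto_G.eventually hf.eventually_theta_ne, tendsto_fst_zero.eventually hF.N_M,
    tendsto_fst_zero.eventually hF.coordProj_M] with x hG hθp hθG hNM hPM
  obtain ⟨p, ζ⟩ := x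
  simp only at *
  have hdisj := disjoint_primeIdx_doublePrimeIdx (n := n) (l := l)
  set y := M p (coordProj (primeIdx n l) ζ) with hy
  have hPy : coordProj (primeIdx n l) y = y := by rw [hy, hPM, coordProj_self]
  have hPy'' : coordProj (doublePrimeIdx n l) y = 0 := by
    rw [← hPy, coordProj_of_disjoint hdisj.symm]
  set s := ζ i₀ / theta f p (stdVec i₀) + quadraticShift l i₀ f M p ζ with hs
  set g := G (p, ζ) with hg
  have hz : chartInverse l i₀ f G M (p, ζ) = g + tangential f (stdVec i₀) g y + s • stdVec i₀ := rfl
  set z := chartInverse l i₀ f G M (p, ζ)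
  have hv : coordProj (doublePrimeIdx n l) (z - p) = coordProj (doublePrimeIdx n l) ζ := by
    rw [hz, tangential_apply]
    simp only [map_add, map_sub, map_smul, hG, hPy'',
      coordProj_stdVec_of_notMem hf.notMem_doublePrimeIdx]
    simp
  have hGz : G (p, z - p) = g := by
    rw [← hF.leaf_coordProj, hv, hF.leaf_coordProj]
  have hw : z - g = tangential f (stdVec i₀) g y + s • stdVec i₀ := by rw [hz]; abel
  have hx : N p (coordProj (primeIdx n l) (z - g)) = coordProj (primeIdx n l) ζ := by
    have h : coordProj (primeIdx n l) (z - g) = y := by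
      rw [hw, tangential_apply]
      simp only [map_add, map_sub, map_smul, hPy, coordProj_stdVec_of_notMem hf.notMem_primeIdx]
      simp
    rw [h, hy, hNM]
  have hgw : gauss f (stdVec i₀) g (z - g) = s := by
    rw [hw, tangential_apply, map_add, map_sub, map_smul, map_smul, gauss_self hθG]
    simp
  rw [chart]
  simp only [hGz, hx, hgw, hv, quadraticShift_coordProj]
  rw [hs, add_sub_cancel_right, mul_div_cancel₀ _ hθp]
  conv_rhs => rw [coord_decomposition hf.lt hf.index_eq ζ]
  abel

theorem chartInverse_chart (hf : IsAdapted l i₀ f) (hF : IsLeafFrame l i₀ f G M N) :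
    ∀ᶠ x in 𝓝 (0, 0), chartInverse l i₀ f G M (x.1, chart l i₀ f G M N x) = x.2 := by
  filter_upwards [tendsto_relative.eventually hF.coordProj_leaf,
    tendsto_fst_zero.eventually hf.eventually_theta_ne,
    tendsto_relative.eventually (hF.tendsto_G.eventually hf.eventually_theta_ne),
    tendsto_fst_zero.eventually hF.M_N,
    tendsto_fst_zero.eventually hF.coordProj_N] with x hG hθp hθG hMN hPN
  obtain ⟨p, z⟩ := x
  simp only [relative] at *
  have hdisj := disjoint_primeIdx_doublePrimeIdx (n := n) (l := l)
  set g := G (p, z - p) with hg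
  set w := z - g with hw
  have hPw'' : coordProj (doublePrimeIdx n l) w = 0 := by
    rw [hw, map_sub, hG, add_sub_cancel, sub_self]
  set x := N p (coordProj (primeIdx n l) w) with hx
  have hPx : coordProj (primeIdx n l) x = x := by rw [hx, hPN, coordProj_self]
  have hPx'' : coordProj (doublePrimeIdx n l) x = 0 := by
    rw [← hPx, coordProj_of_disjoint hdisj.symm]
  set t := theta f p (stdVec i₀) * (gauss f (stdVec i₀) g w - quadraticShift l i₀ f M p x) with ht
  have hζ : chart l i₀ f G M N (p, z) =
      coordProj (doublePrimeIdx n l) (z - p) + x + t • stdVec i₀ := rfl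
  set ζ := chart l i₀ f G M N (p, z)
  have h0 : ζ i₀ = t := by
    rw [hζ, ← hPx]
    simp [coordProj_apply_of_notMem hf.notMem_primeIdx,
      coordProj_apply_of_notMem hf.notMem_doublePrimeIdx]
  have h1 : coordProj (primeIdx n l) ζ = x := by
    rw [hζ]
    simp only [map_add, map_smul, coordProj_of_disjoint hdisj, hPx,
      coordProj_stdVec_of_notMem hf.notMem_primeIdx]
    simp
  have h2 : coordProj (doublePrimeIdx n l) ζ = coordProj (doublePrimeIdx n l) (z - p) := by
    rw [hζ]
    simp only [map_add, map_smul, coordProj_self, hPx'',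
      coordProj_stdVec_of_notMem hf.notMem_doublePrimeIdx]
    simp
  have hGζ : G (p, ζ) = g := by rw [← hF.leaf_coordProj, h2, hF.leaf_coordProj]
  have hw' : w = w i₀ • stdVec i₀ + coordProj (primeIdx n l) w := by
    conv_lhs => rw [coord_decomposition hf.lt hf.index_eq w, hPw'', add_zero]
  have hgw : gauss f (stdVec i₀) g w =
      w i₀ + gauss f (stdVec i₀) g (coordProj (primeIdx n l) w) := by
    conv_lhs => rw [hw', map_add, map_smul, gauss_self hθG, smul_eq_mul, mul_one]
  rw [chartInverse]
  simp only [hGζ, h0, h1]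
  rw [← quadraticShift_coordProj p ζ, h1, ht, mul_div_cancel_left₀ _ hθp, sub_add_cancel, hgw,
    tangential_apply, hx, hMN]
  have : z = g + w := by rw [hw]; abel
  conv_rhs => rw [this, hw']
  module

theorem contDiffAt_quadraticShift (hf : IsAdapted l i₀ f) (hF : IsLeafFrame l i₀ f G M N) :
    ∀ᶠ p in 𝓝 0, ∀ ζ,
      ContDiffAt ℝ ∞ (fun x : Cn n × Cn n => quadraticShift l i₀ f M x.1 x.2) (p, ζ) := by
  filter_upwards [hf.smooth, hf.eventually_theta_ne, hF.smooth_M] with p hp hθ hM ζ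
  simp only [quadraticShift, div_eq_mul_inv]
  have hT : ContDiffAt ℝ ∞ (fun x : Cn n × Cn n => tangential f (stdVec i₀) x.1
      (M x.1 (coordProj (primeIdx n l) x.2))) (p, ζ) := by
    refine contDiffAt_tangential hp hθ contDiffAt_fst ?_
    exact (((ContinuousLinearMap.restrictScalarsL ℂ (Cn n) (Cn n) ℝ ℝ).contDiff.contDiffAt.comp _
      (hM.comp (p, ζ) contDiffAt_fst)).clm_apply
      (((coordProj (primeIdx n l)).restrictScalars ℝ).contDiff.contDiffAt.comp _ contDiffAt_snd))
  exact ((contDiffAt_holHess hp contDiffAt_fst hT hT).neg).mul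
    ((contDiffAt_theta hp contDiffAt_fst contDiffAt_const).inv hθ)

theorem contDiffAt_complex_clm_apply {X : Type*} [NormedAddCommGroup X] [NormedSpace ℝ X]
    {A : X → Cn n →L[ℂ] Cn n} {u : X → Cn n} {x : X} (hA : ContDiffAt ℝ ∞ A x)
    (hu : ContDiffAt ℝ ∞ u x) : ContDiffAt ℝ ∞ (fun y => A y (u y)) x :=
  ((ContinuousLinearMap.restrictScalarsL ℂ (Cn n) (Cn n) ℝ ℝ).contDiff.contDiffAt.comp x
    hA).clm_apply hu

theorem contDiffAt_coordProj {X : Type*} [NormedAddCommGroup X] [NormedSpace ℝ X]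
    {u : X → Cn n} {x : X} (s : Finset (Fin n)) (hu : ContDiffAt ℝ ∞ u x) :
    ContDiffAt ℝ ∞ (fun y => coordProj s (u y)) x :=
  ((coordProj s).restrictScalars ℝ).contDiff.contDiffAt.comp x hu

theorem contDiffAt_coord {X : Type*} [NormedAddCommGroup X] [NormedSpace ℝ X]
    {u : X → Cn n} {x : X} (j : Fin n) (hu : ContDiffAt ℝ ∞ u x) :
    ContDiffAt ℝ ∞ (fun y => u y j) x :=
  ((EuclideanSpace.proj j : Cn n →L[ℂ] ℂ).restrictScalars ℝ).contDiff.contDiffAt.comp x hu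

theorem contDiffAt_chartInverse (hf : IsAdapted l i₀ f) (hF : IsLeafFrame l i₀ f G M N) :
    ∀ᶠ x in 𝓝 (0, 0), ContDiffAt ℝ ∞ (chartInverse l i₀ f G M) x := by
  filter_upwards [hF.leaf_smooth, tendsto_fst_zero.eventually hf.smooth,
    tendsto_fst_zero.eventually hf.eventually_theta_ne, hF.tendsto_G.eventually hf.smooth,
    hF.tendsto_G.eventually hf.eventually_theta_ne, tendsto_fst_zero.eventually hF.smooth_M,
    tendsto_fst_zero.eventually (contDiffAt_quadraticShift hf hF)] with x hG hp hθp hg hθg hM hq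
  have hM' : ContDiffAt ℝ ∞ (fun x : Cn n × Cn n => M x.1) x := hM.comp x contDiffAt_fst
  have h1 : ContDiffAt ℝ ∞ (fun x : Cn n × Cn n => x.2 i₀ / theta f x.1 (stdVec i₀)) x := by
    simp only [div_eq_mul_inv]
    exact (contDiffAt_coord i₀ contDiffAt_snd).mul
      ((contDiffAt_theta hp contDiffAt_fst contDiffAt_const).inv hθp)
  exact (hG.add (contDiffAt_tangential hg hθg hG
    (contDiffAt_complex_clm_apply hM' (contDiffAt_coordProj _ contDiffAt_snd)))).add
    ((h1.add (hq x.2)).smul contDiffAt_const)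

theorem contDiffAt_chart (hf : IsAdapted l i₀ f) (hF : IsLeafFrame l i₀ f G M N) :
    ∀ᶠ x in 𝓝 (0, 0), ContDiffAt ℝ ∞ (chart l i₀ f G M N) x := by
  filter_upwards [tendsto_relative.eventually hF.leaf_smooth, tendsto_fst_zero.eventually hf.smooth,
    tendsto_relative.eventually (hF.tendsto_G.eventually hf.smooth),
    tendsto_relative.eventually (hF.tendsto_G.eventually hf.eventually_theta_ne),
    tendsto_fst_zero.eventually hF.smooth_N,
    tendsto_fst_zero.eventually (contDiffAt_quadraticShift hf hF)] with x hG hp hg hθg hN hq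
  have hG' : ContDiffAt ℝ ∞ (fun x : Cn n × Cn n => G (x.1, x.2 - x.1)) x :=
    hG.comp x contDiff_relative.contDiffAt
  have hw : ContDiffAt ℝ ∞ (fun x : Cn n × Cn n => x.2 - G (x.1, x.2 - x.1)) x :=
    contDiffAt_snd.sub hG'
  have hN' : ContDiffAt ℝ ∞ (fun x : Cn n × Cn n => N x.1) x := hN.comp x contDiffAt_fst
  have hx : ContDiffAt ℝ ∞ (fun x : Cn n × Cn n =>
      N x.1 (coordProj (primeIdx n l) (x.2 - G (x.1, x.2 - x.1)))) x :=
    contDiffAt_complex_clm_apply hN' (contDiffAt_coordProj (primeIdx n l) hw)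
  have hx' := contDiffAt_fst.prodMk hx
  have hq' := (hq (N x.1 (coordProj (primeIdx n l) (x.2 - G (x.1, x.2 - x.1))))).comp x hx'
  have hP : ContDiffAt ℝ ∞ (fun x : Cn n × Cn n => coordProj (doublePrimeIdx n l) (x.2 - x.1)) x :=
    contDiffAt_coordProj _ (contDiffAt_snd.sub contDiffAt_fst)
  have hgw : ContDiffAt ℝ ∞ (fun x : Cn n × Cn n => gauss f (stdVec i₀) (G (x.1, x.2 - x.1))
      (x.2 - G (x.1, x.2 - x.1))) x := contDiffAt_gauss hg hθg hG' hw
  have hθ : ContDiffAt ℝ ∞ (fun x : Cn n × Cn n => theta f x.1 (stdVec i₀)) x :=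
    contDiffAt_theta hp contDiffAt_fst contDiffAt_const
  have hlast := (hθ.mul (hgw.sub hq')).smul (contDiffAt_const (c := stdVec i₀))
  exact (hP.add hx).add hlast

/-- Expansion in coordinates, which separates the dependence on the point `z` from that on `u`. -/
theorem gauss_eq_sum (e z u : Cn n) : gauss f e z u = ∑ j, u j * gauss f e z (stdVec j) := by
  have h : u = ∑ j, u j • stdVec j := by
    ext k
    simp [Finset.sum_apply, Pi.single_apply]
  conv_lhs => rw [h, map_sum]
  simp

theorem differentiableAt_quadraticShift (p ζ : Cn n) :
    DifferentiableAt ℂ (quadraticShift l i₀ f M p) ζ := by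
  have hT : DifferentiableAt ℂ (fun ζ => tangential f (stdVec i₀) p
      (M p (coordProj (primeIdx n l) ζ))) ζ :=
    (LinearMap.toContinuousLinearMap (tangential f (stdVec i₀) p ∘ₗ
      (M p ∘L coordProj (primeIdx n l) : Cn n →ₗ[ℂ] Cn n))).differentiableAt
  have hB : ∀ u : Cn n, holHess f p u u =
      ∑ j, ∑ k, u j * (u k * holHess f p (stdVec j) (stdVec k)) := by
    intro u
    have h : u = ∑ j, u j • stdVec j := by
      ext k
      simp [Finset.sum_apply, Pi.single_apply]
    conv_lhs => rw [h]
    simp only [map_sum, LinearMap.sum_apply, map_smul, LinearMap.smul_apply, smul_eq_mul,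
      Finset.mul_sum]
    rw [Finset.sum_comm]
    refine Finset.sum_congr rfl fun j _ => Finset.sum_congr rfl fun k _ => ?_
    ring
  have hc : ∀ j, DifferentiableAt ℂ (fun ζ => tangential f (stdVec i₀) p
      (M p (coordProj (primeIdx n l) ζ)) j) ζ := fun j =>
    (EuclideanSpace.proj j : Cn n →L[ℂ] ℂ).differentiableAt.comp ζ hT
  have hH : DifferentiableAt ℂ (fun ζ => holHess f p
      (tangential f (stdVec i₀) p (M p (coordProj (primeIdx n l) ζ)))
      (tangential f (stdVec i₀) p (M p (coordProj (primeIdx n l) ζ)))) ζ := by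
    simp only [hB]
    refine DifferentiableAt.fun_sum fun j _ => DifferentiableAt.fun_sum fun k _ => ?_
    exact (hc j).mul ((hc k).mul_const _)
  have h : quadraticShift l i₀ f M p = fun ζ => -(theta f p (stdVec i₀))⁻¹ * holHess f p
      (tangential f (stdVec i₀) p (M p (coordProj (primeIdx n l) ζ)))
      (tangential f (stdVec i₀) p (M p (coordProj (primeIdx n l) ζ))) := by
    funext ζ
    rw [quadraticShift, div_eq_mul_inv]
    ring
  rw [h]
  exact hH.const_mul _

theorem differentiableAt_chartInverse (hF : IsLeafFrame l i₀ f G M N) :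
    ∀ᶠ x in 𝓝 (0, 0), DifferentiableAt ℂ (fun ζ => chartInverse l i₀ f G M (x.1, ζ)) x.2 := by
  filter_upwards [hF.leaf_holomorphic, hF.gauss_holomorphic] with x hG hg
  obtain ⟨p, ζ⟩ := x
  simp only at *
  have hy : DifferentiableAt ℂ (fun ζ => M p (coordProj (primeIdx n l) ζ)) ζ :=
    (M p ∘L coordProj (primeIdx n l)).differentiableAt
  have hyc : ∀ j, DifferentiableAt ℂ (fun ζ => M p (coordProj (primeIdx n l) ζ) j) ζ := fun j =>
    (EuclideanSpace.proj j : Cn n →L[ℂ] ℂ).differentiableAt.comp ζ hy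
  have hgy : DifferentiableAt ℂ (fun ζ => gauss f (stdVec i₀) (G (p, ζ))
      (M p (coordProj (primeIdx n l) ζ))) ζ := by
    rw [funext fun ζ => gauss_eq_sum (f := f) (stdVec i₀) (G (p, ζ))
      (M p (coordProj (primeIdx n l) ζ))]
    exact DifferentiableAt.fun_sum fun j _ => (hyc j).mul (hg _)
  have h0 : DifferentiableAt ℂ (fun ζ : Cn n => ζ i₀ / theta f p (stdVec i₀)) ζ := by
    simp only [div_eq_mul_inv]
    exact (EuclideanSpace.proj i₀ : Cn n →L[ℂ] ℂ).differentiableAt.mul_const _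
  simp only [chartInverse, tangential_apply]
  exact (hG.add (hy.sub (hgy.smul_const _))).add
    ((h0.add (differentiableAt_quadraticShift p ζ)).smul_const _)

theorem differentiableAt_chart (hF : IsLeafFrame l i₀ f G M N) :
    ∀ᶠ x in 𝓝 (0, 0), DifferentiableAt ℂ (fun z => chart l i₀ f G M N (x.1, z)) x.2 := by
  filter_upwards [tendsto_relative.eventually hF.leaf_holomorphic,
    tendsto_relative.eventually hF.gauss_holomorphic] with x hG hg
  obtain ⟨p, z⟩ := x
  simp only [relative] at *
  have hrel : DifferentiableAt ℂ (fun z : Cn n => z - p) z := differentiableAt_id.sub_const p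
  have hG' : DifferentiableAt ℂ (fun z => G (p, z - p)) z :=
    DifferentiableAt.comp z (g := fun v => G (p, v)) hG hrel
  have hg' : ∀ u, DifferentiableAt ℂ (fun z => gauss f (stdVec i₀) (G (p, z - p)) u) z := fun u =>
    DifferentiableAt.comp z (g := fun v => gauss f (stdVec i₀) (G (p, v)) u) (hg u) hrel
  have hw : DifferentiableAt ℂ (fun z => z - G (p, z - p)) z := differentiableAt_id.sub hG'
  have hwc : ∀ j, DifferentiableAt ℂ (fun z => (z - G (p, z - p)) j) z := fun j =>
    (EuclideanSpace.proj j : Cn n →L[ℂ] ℂ).differentiableAt.comp z hw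
  have hgw : DifferentiableAt ℂ (fun z => gauss f (stdVec i₀) (G (p, z - p))
      (z - G (p, z - p))) z := by
    rw [funext fun z => gauss_eq_sum (f := f) (stdVec i₀) (G (p, z - p)) (z - G (p, z - p))]
    exact DifferentiableAt.fun_sum fun j _ => (hwc j).mul (hg' _)
  have hx : DifferentiableAt ℂ (fun z => N p (coordProj (primeIdx n l) (z - G (p, z - p)))) z :=
    (N p ∘L coordProj (primeIdx n l)).differentiableAt.comp z hw
  have hq : DifferentiableAt ℂ (fun z => quadraticShift l i₀ f M p
      (N p (coordProj (primeIdx n l) (z - G (p, z - p))))) z :=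
    (differentiableAt_quadraticShift p _).comp z hx
  have hP : DifferentiableAt ℂ (fun z => coordProj (doublePrimeIdx n l) (z - p)) z :=
    (coordProj (doublePrimeIdx n l)).differentiableAt.comp z hrel
  simp only [chart]
  exact (hP.add hx).add (((hgw.sub hq).const_mul _).smul_const _)

theorem quadraticShift_zero (p : Cn n) : quadraticShift l i₀ f M p 0 = 0 := by
  simp [quadraticShift]

theorem chartInverse_zero (hF : IsLeafFrame l i₀ f G M N) :
    ∀ᶠ p in 𝓝 0, chartInverse l i₀ f G M (p, 0) = p := by
  filter_upwards [hF.leaf_zero] with p hp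
  simp [chartInverse, hp, quadraticShift_zero]

theorem chart_self (hF : IsLeafFrame l i₀ f G M N) :
    ∀ᶠ p in 𝓝 0, chart l i₀ f G M N (p, p) = 0 := by
  filter_upwards [hF.leaf_zero] with p hp
  simp [chart, hp, quadraticShift_zero]

end Charts

/-! ### The third order estimate -/

section SecondOrderEstimate

/-- Comparison of the second order expansions `A + ½ Qg(Y + u, Y + u)` and `A₀ + ½ Qp(Y₀, Y₀)`, in
terms of the sizes `t` of `ζ'` and `d` of `ζ''`. -/
theorem abs_le_of_second_order {E : Type*} [NormedAddCommGroup E] [NormedSpace ℝ E]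
    {Qg Qp : E →L[ℝ] E →L[ℝ] ℝ} {Y Y₀ u : E} {a t d v A A₀ : ℝ} (ha : 1 ≤ a) (ht : 0 ≤ t)
    (ht1 : t ≤ 1) (hd : 0 ≤ d) (hQg : ‖Qg‖ ≤ a) (hQp : ‖Qp‖ ≤ a) (hQ : ‖Qg - Qp‖ ≤ a * d)
    (hY : ‖Y‖ ≤ a * t) (hY₀ : ‖Y₀‖ ≤ a * t) (hYY : ‖Y - Y₀‖ ≤ a * d * t) (hu : ‖u‖ ≤ a * t ^ 2)
    (hA : |A - A₀| ≤ a * t ^ 2 * d) (h0 : A₀ + 1 / 2 * Qp Y₀ Y₀ = 0)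
    (hv : |v - A - 1 / 2 * Qg (Y + u) (Y + u)| ≤ a * ‖Y + u‖ ^ 3) :
    |v| ≤ 12 * a ^ 4 * (t ^ 2 * d + t ^ 3) := by
  have hQv : ∀ (Q : E →L[ℝ] E →L[ℝ] ℝ) (x y : E) (q b c : ℝ), ‖Q‖ ≤ q → ‖x‖ ≤ b → ‖y‖ ≤ c →
      |Q x y| ≤ q * b * c := by
    intro Q x y q b c h1 h2 h3
    have hq : 0 ≤ q := (norm_nonneg Q).trans h1
    have hb : 0 ≤ b := (norm_nonneg _).trans h2
    calc |Q x y| ≤ ‖Q‖ * ‖x‖ * ‖y‖ := Q.le_opNorm₂ x y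
      _ ≤ q * b * c := by gcongr
  have e1 := hQv _ _ _ _ _ _ hQ hY hY
  have e2 := hQv _ _ _ _ _ _ hQp hYY hY
  have e3 := hQv _ _ _ _ _ _ hQp hY₀ hYY
  have e4 := hQv _ _ _ _ _ _ hQg hY hu
  have e5 := hQv _ _ _ _ _ _ hQg hu hY
  have e6 := hQv _ _ _ _ _ _ hQg hu hu
  have hYu : ‖Y + u‖ ≤ 2 * a * t := by
    refine (norm_add_le _ _).trans ?_
    have : a * t ^ 2 ≤ a * t := by
      gcongr
      exact pow_le_of_le_one ht ht1 two_ne_zero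
    linarith
  have e7 : a * ‖Y + u‖ ^ 3 ≤ a * (2 * a * t) ^ 3 := by gcongr
  have hsplit : Qg (Y + u) (Y + u) - Qp Y₀ Y₀ = (Qg - Qp) Y Y + Qp (Y - Y₀) Y + Qp Y₀ (Y - Y₀) +
      Qg Y u + Qg u Y + Qg u u := by
    simp only [map_add, map_sub, add_apply, sub_apply]
    ring
  have ht4 : t ^ 4 ≤ t ^ 3 := pow_le_pow_of_le_one ht ht1 (by norm_num)
  have hat : 0 ≤ t ^ 2 * d := by positivity
  have hat' : 0 ≤ t ^ 3 := by positivity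
  have ha34 : a ^ 3 ≤ a ^ 4 := pow_le_pow_right₀ ha (by norm_num)
  have ha14 : a ≤ a ^ 4 := le_self_pow₀ ha (by norm_num)
  have b1 : a ^ 3 * (t ^ 2 * d) ≤ a ^ 4 * (t ^ 2 * d) := by gcongr
  have b2 : a ^ 3 * t ^ 3 ≤ a ^ 4 * t ^ 3 := by gcongr
  have b3 : a ^ 3 * t ^ 4 ≤ a ^ 4 * t ^ 3 := by gcongr
  have b4 : a * (t ^ 2 * d) ≤ a ^ 4 * (t ^ 2 * d) := by gcongr
  have hc1 : 0 ≤ a ^ 4 * (t ^ 2 * d) := by positivity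
  have hc2 : 0 ≤ a ^ 4 * t ^ 3 := by positivity
  rw [abs_le] at *
  constructor <;> nlinarith

theorem norm_holHess_le {E : Type*} [NormedAddCommGroup E] [NormedSpace ℂ E] [NormedSpace ℝ E]
    [IsScalarTower ℝ ℂ E] (f : E → ℝ) (z u v : E) :
    ‖holHess f z u v‖ ≤ ‖fderiv ℝ (fderiv ℝ f) z‖ * ‖u‖ * ‖v‖ := by
  have hQ := (fderiv ℝ (fderiv ℝ f) z).le_opNorm₂
  have hI : ∀ w : E, ‖Complex.I • w‖ = ‖w‖ := fun w => by rw [norm_smul, Complex.norm_I, one_mul]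
  have h1 := hQ u v
  have h2 := hQ (Complex.I • u) (Complex.I • v)
  have h3 := hQ u (Complex.I • v)
  have h4 := hQ (Complex.I • u) v
  rw [hI] at h3 h4
  rw [hI, hI] at h2
  rw [holHess_apply, norm_mul]
  set q := ‖fderiv ℝ (fderiv ℝ f) z‖ * ‖u‖ * ‖v‖
  have hc : ∀ x : ℝ, ‖x‖ ≤ q → ‖(x : ℂ)‖ ≤ q := fun x hx => by rwa [Complex.norm_real]
  have h5 := norm_sub_le (fderiv ℝ (fderiv ℝ f) z u v : ℂ)
    (fderiv ℝ (fderiv ℝ f) z (Complex.I • u) (Complex.I • v))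
  have h6 := norm_add_le (fderiv ℝ (fderiv ℝ f) z u (Complex.I • v) : ℂ)
    (fderiv ℝ (fderiv ℝ f) z (Complex.I • u) v)
  have h7 := norm_sub_le ((fderiv ℝ (fderiv ℝ f) z u v : ℂ) -
    fderiv ℝ (fderiv ℝ f) z (Complex.I • u) (Complex.I • v))
    (Complex.I * (fderiv ℝ (fderiv ℝ f) z u (Complex.I • v) +
      fderiv ℝ (fderiv ℝ f) z (Complex.I • u) v))
  rw [norm_mul, Complex.norm_I, one_mul] at h7
  have h8 : ‖(1 / 4 : ℂ)‖ = 1 / 4 := by norm_num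
  rw [h8]
  linarith [hc _ h1, hc _ h2, hc _ h3, hc _ h4]

theorem eventually_norm_le {X Y : Type*} [TopologicalSpace X] [NormedAddCommGroup Y] {h : X → Y}
    {x₀ : X} (hh : ContinuousAt h x₀) : ∀ᶠ a in atTop, ∀ᶠ x in 𝓝 x₀, ‖h x‖ ≤ a := by
  filter_upwards [eventually_gt_atTop ‖h x₀‖] with a ha
  exact (hh.norm.eventually (gt_mem_nhds ha)).mono fun x hx => hx.le

/-- The third order bound at one point `g + (Y + s e)`, where the transversal component `s` is
chosen to cancel `|ζ'|²` and the complex bilinear part of the Hessian at `p`. -/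
theorem abs_le_of_normalized {E : Type*} [NormedAddCommGroup E] [NormedSpace ℂ E] [NormedSpace ℝ E]
    [IsScalarTower ℝ ℂ E] {f : E → ℝ} {e p g Y Y₀ : E} {s : ℂ} {a t d : ℝ} (ha : 1 ≤ a)
    (ht : 0 ≤ t) (ht1 : t ≤ 1) (hd : 0 ≤ d) (hQg : ‖fderiv ℝ (fderiv ℝ f) g‖ ≤ a)
    (hQp : ‖fderiv ℝ (fderiv ℝ f) p‖ ≤ a)
    (hQ : ‖fderiv ℝ (fderiv ℝ f) g - fderiv ℝ (fderiv ℝ f) p‖ ≤ a * d)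
    (hY : ‖Y‖ ≤ a ^ 2 * t) (hY₀ : ‖Y₀‖ ≤ a ^ 2 * t) (hYY : ‖Y - Y₀‖ ≤ a ^ 2 * d * t)
    (hθi : ‖(theta f p e)⁻¹‖ ≤ a) (hθθ : ‖theta f g e - theta f p e‖ ≤ a * d)
    (hθ : theta f p e ≠ 0) (he : ‖e‖ = 1)
    (hs : s * theta f p e = -((t ^ 2 : ℝ) : ℂ) - holHess f p Y₀ Y₀)
    (hlevi : 1 / 4 * leviReal f p Y₀ Y₀ = t ^ 2) (hθY : theta f g Y = 0) (hfg : f g = 0)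
    (hTaylor : |f (g + (Y + s • e)) - f g - fderiv ℝ f g (Y + s • e) -
      1 / 2 * fderiv ℝ (fderiv ℝ f) g (Y + s • e) (Y + s • e)| ≤ a * ‖Y + s • e‖ ^ 3) :
    |f (g + (Y + s • e))| ≤ 12 * (2 * a ^ 7) ^ 4 * (t ^ 2 * d + t ^ 3) := by
  have ha0 : 0 ≤ a := zero_le_one.trans ha
  have hapow : ∀ k, k ≤ 7 → a ^ k ≤ 2 * a ^ 7 := fun k hk => by
    have := pow_le_pow_right₀ ha hk
    nlinarith [pow_nonneg ha0 7]
  have ha7 : a ≤ 2 * a ^ 7 := by simpa using hapow 1 (by norm_num)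
  have ha2 := hapow 2 (by norm_num)
  -- the transversal component is of second order
  have hsn : ‖s‖ ≤ 2 * a ^ 6 * t ^ 2 := by
    have h1 : s = (-((t ^ 2 : ℝ) : ℂ) - holHess f p Y₀ Y₀) * (theta f p e)⁻¹ := by
      rw [← hs, mul_inv_cancel_right₀ hθ]
    have h2 : ‖holHess f p Y₀ Y₀‖ ≤ a * (a ^ 2 * t) * (a ^ 2 * t) :=
      (norm_holHess_le _ _ _ _).trans (by gcongr)
    have h3 : ‖(-((t ^ 2 : ℝ) : ℂ) - holHess f p Y₀ Y₀)‖ ≤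
        t ^ 2 + a * (a ^ 2 * t) * (a ^ 2 * t) := by
      refine (norm_sub_le _ _).trans (add_le_add ?_ h2)
      rw [norm_neg, Complex.norm_real, Real.norm_eq_abs, abs_of_nonneg (by positivity)]
    rw [h1, norm_mul]
    calc _ ≤ (t ^ 2 + a * (a ^ 2 * t) * (a ^ 2 * t)) * a := by gcongr
      _ = (a + a ^ 6) * t ^ 2 := by ring
      _ ≤ _ := by
        have : a ≤ a ^ 6 := le_self_pow₀ ha (by norm_num)
        gcongr
        linarith
  refine abs_le_of_second_order (u := s • e) (A := (s * theta f g e).re)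
    (A₀ := (s * theta f p e).re) (ha.trans ha7) ht ht1 hd (hQg.trans ha7) (hQp.trans ha7)
    (hQ.trans (by gcongr)) (hY.trans (by gcongr)) (hY₀.trans (by gcongr)) (hYY.trans (by gcongr))
    ?_ ?_ ?_ ?_
  · rw [norm_smul, he, mul_one]
    refine hsn.trans ?_
    gcongr 2 * ?_ * _
    exact pow_le_pow_right₀ ha (by norm_num)
  · rw [← Complex.sub_re, ← mul_sub]
    refine (Complex.abs_re_le_norm _).trans ?_
    rw [norm_mul]
    calc _ ≤ 2 * a ^ 6 * t ^ 2 * (a * d) := by gcongr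
      _ = _ := by ring
  · rw [half_hessian_eq, hlevi, hs, Complex.sub_re, Complex.neg_re, Complex.ofReal_re]
    ring
  · have h1 : fderiv ℝ f g (Y + s • e) = (s * theta f g e).re := by
      rw [← theta_re, map_add, map_smul, smul_eq_mul, hθY, zero_add]
    rw [h1, hfg, sub_zero] at hTaylor
    exact hTaylor.trans (by gcongr)

variable {n l : ℕ} {i₀ : Fin n} {f : Cn n → ℝ} {G : Cn n × Cn n → Cn n}
  {M N : Cn n → Cn n →L[ℂ] Cn n}

/-- A smooth quantity varies by `O(|ζ''|)` along the leaves. -/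
theorem eventually_norm_leaf_sub_le (hF : IsLeafFrame l i₀ f G M N) {Y : Type*}
    [NormedAddCommGroup Y] [NormedSpace ℝ Y] {h : Cn n → Y} (hh : ContDiffAt ℝ ∞ h 0) :
    ∀ᶠ a in atTop, ∀ᶠ x in 𝓝 (0, 0),
      ‖h (G x) - h x.1‖ ≤ a * ‖coordProj (doublePrimeIdx n l) x.2‖ := by
  have hk : ContDiffAt ℝ 1 (fun x => h (G x)) (0, 0) := by
    refine ContDiffAt.of_le ?_ (m := 1) (n := ∞) (by simp)
    rw [← hF.G_zero] at hh
    exact hh.comp (0, 0) hF.leaf_smooth.self_of_nhds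
  obtain ⟨K, s, hs, hK⟩ := hk.exists_lipschitzOnWith
  have t1 : Tendsto (fun x : Cn n × Cn n => (x.1, coordProj (doublePrimeIdx n l) x.2)) (𝓝 (0, 0))
      (𝓝 (0, 0)) := Continuous.tendsto' (by fun_prop) _ _ (by simp)
  have t2 : Tendsto (fun x : Cn n × Cn n => (x.1, (0 : Cn n))) (𝓝 (0, 0)) (𝓝 (0, 0)) :=
    Continuous.tendsto' (by fun_prop) _ _ rfl
  filter_upwards [eventually_ge_atTop (K : ℝ)] with a ha
  filter_upwards [t1 hs, t2 hs, tendsto_fst_zero.eventually hF.leaf_zero] with x h1 h2 h3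
  have h4 := hK.dist_le_mul _ h1 _ h2
  rw [dist_eq_norm, hF.leaf_coordProj, h3] at h4
  refine h4.trans ?_
  rw [dist_eq_norm]
  simp only [Prod.mk_sub_mk, sub_self, sub_zero, Prod.norm_mk, norm_zero]
  rw [max_eq_right (norm_nonneg _)]
  gcongr

/-- On the hypersurface `ζ₁ = -|ζ'|²`, which osculates `{f ∘ Ψ_p = 0}`, the pullback of `f` is small
of third order: along the leaf through `p` the function `f` is constant, and its second order
expansion in the directions `ζ'` has been normalised at `p`. -/
theorem exists_third_order_bound (hf : IsAdapted l i₀ f) (hF : IsLeafFrame l i₀ f G M N) :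
    ∃ C > 0, ∀ᶠ x in 𝓝 (0, 0), f x.1 = 0 →
      x.2 i₀ = -((‖coordProj (primeIdx n l) x.2‖ ^ 2 : ℝ) : ℂ) →
      |f (chartInverse l i₀ f G M x)| ≤ C * (‖coordProj (primeIdx n l) x.2‖ ^ 2 *
        ‖coordProj (doublePrimeIdx n l) x.2‖ + ‖coordProj (primeIdx n l) x.2‖ ^ 3) := by
  have hf0 := hf.smooth.self_of_nhds
  have hθ0 := hf.theta_stdVec_ne
  obtain ⟨T, hT, hTs⟩ : ∃ T : Cn n → Cn n →L[ℂ] Cn n,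
      (∀ z v, T z v = tangential f (stdVec i₀) z v) ∧ ContDiffAt ℝ ∞ T 0 :=
    ⟨fun z => LinearMap.toContinuousLinearMap (tangential f (stdVec i₀) z), fun _ _ => rfl,
      contDiffAt_toContinuousLinearMap fun k =>
        contDiffAt_tangential hf0 hθ0 contDiffAt_id contDiffAt_const⟩
  have hQs : ContDiffAt ℝ ∞ (fderiv ℝ (fderiv ℝ f)) 0 :=
    (hf0.fderiv_right (m := ∞) (by simp)).fderiv_right (m := ∞) (by simp)
  have hθs : ContDiffAt ℝ ∞ (fun z => theta f z (stdVec i₀)) 0 :=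
    contDiffAt_theta hf0 contDiffAt_id contDiffAt_const
  have hGc : ContinuousAt G (0, 0) := hF.leaf_smooth.self_of_nhds.continuousAt
  have hfst : ContinuousAt (fun x : Cn n × Cn n => x.1) (0, 0) := continuous_fst.continuousAt
  have atG : ∀ {Y : Type} [TopologicalSpace Y] {h : Cn n → Y}, ContinuousAt h 0 →
      ContinuousAt (fun x => h (G x)) (0, 0) := fun {Y} _ {h} hh =>
    ContinuousAt.comp (g := h) (by rwa [hF.G_zero]) hGc
  have at1 : ∀ {Y : Type} [TopologicalSpace Y] {h : Cn n → Y}, ContinuousAt h 0 →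
      ContinuousAt (fun x : Cn n × Cn n => h x.1) (0, 0) := fun {Y} _ {h} hh =>
    ContinuousAt.comp (g := h) (f := fun x : Cn n × Cn n => x.1) hh hfst
  have hΨc : ContinuousAt (chartInverse l i₀ f G M) (0, 0) :=
    (contDiffAt_chartInverse hf hF).self_of_nhds.continuousAt
  have hΨ0 : chartInverse l i₀ f G M (0, 0) = 0 := (chartInverse_zero hF).self_of_nhds
  obtain ⟨C, hC, hTaylor⟩ := exists_taylor_bound hf0
  have hgt : Tendsto (fun x => (G x, chartInverse l i₀ f G M x - G x)) (𝓝 (0, 0)) (𝓝 (0, 0)) := by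
    have : ContinuousAt (fun x => (G x, chartInverse l i₀ f G M x - G x)) (0, 0) :=
      hGc.prodMk (hΨc.sub hGc)
    rw [ContinuousAt, hΨ0, hF.G_zero, sub_zero] at this
    exact this
  have hPc : Tendsto (fun x : Cn n × Cn n => ‖coordProj (primeIdx n l) x.2‖) (𝓝 (0, 0)) (𝓝 0) :=
    Continuous.tendsto' (by fun_prop) _ _ (by simp)
  -- one constant `a` for all the bounds near the origin
  obtain ⟨a, ⟨⟨⟨⟨⟨⟨⟨⟨⟨⟨ha1, haC⟩, hQg⟩, hQp⟩, hQ⟩, hTg⟩, hTp⟩, hTT⟩, hM⟩, hθi⟩, hθθ⟩⟩ :=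
    ((((((((((eventually_ge_atTop (1 : ℝ)).and (eventually_ge_atTop C)).and
      (eventually_norm_le (atG hQs.continuousAt))).and
      (eventually_norm_le (at1 hQs.continuousAt))).and (eventually_norm_leaf_sub_le hF hQs)).and
      (eventually_norm_le (atG hTs.continuousAt))).and
      (eventually_norm_le (at1 hTs.continuousAt))).and (eventually_norm_leaf_sub_le hF hTs)).and
      (eventually_norm_le (at1 hF.smooth_M.self_of_nhds.continuousAt))).and
      (eventually_norm_le (at1 (hθs.continuousAt.inv₀ hθ0)))).and
      (eventually_norm_leaf_sub_le hF hθs) |>.exists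
  have ha0 : 0 ≤ a := zero_le_one.trans ha1
  refine ⟨12 * (2 * a ^ 7) ^ 4, by positivity, ?_⟩
  filter_upwards [hQg, hQp, hQ, hTg, hTp, hTT, hM, hθi, hθθ, hgt.eventually hTaylor, hF.leaf_level,
    hPc.eventually (ge_mem_nhds one_pos), tendsto_fst_zero.eventually hf.eventually_theta_ne,
    hF.tendsto_G.eventually hf.eventually_theta_ne, tendsto_fst_zero.eventually hF.leviReal_M]
    with x hQg hQp hQ hTg hTp hTT hM hθi hθθ hTay hlev ht1 hθp hθg hnorm hfp hx0
  obtain ⟨p, ζ⟩ := x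
  simp only at *
  set t := ‖coordProj (primeIdx n l) ζ‖ with ht
  set g := G (p, ζ) with hg
  set y := M p (coordProj (primeIdx n l) ζ) with hy
  set s := ζ i₀ / theta f p (stdVec i₀) + quadraticShift l i₀ f M p ζ with hs
  have ht0 : 0 ≤ t := norm_nonneg _
  have hΨ : chartInverse l i₀ f G M (p, ζ) = g + (T g y + s • stdVec i₀) := by
    rw [← add_assoc, hT]
    rfl
  rw [hΨ, add_sub_cancel_left] at hTay
  rw [hΨ]
  have hyn : ‖y‖ ≤ a * t := ((M p).le_opNorm _).trans (by gcongr)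
  have hYb : ∀ B : Cn n →L[ℂ] Cn n, ∀ b, ‖B‖ ≤ b → ‖B y‖ ≤ b * (a * t) := fun B b hB => by
    have hb : 0 ≤ b := (norm_nonneg _).trans hB
    exact (B.le_opNorm _).trans (by gcongr)
  have hsθ : s * theta f p (stdVec i₀) = -((t ^ 2 : ℝ) : ℂ) - holHess f p (T p y) (T p y) := by
    rw [hs, hx0, quadraticShift, add_mul, div_mul_cancel₀ _ hθp, div_mul_cancel₀ _ hθp, hT,
      sub_eq_add_neg]
  have h1 := hnorm ζ
  rw [← hy, ← hT, ← ht] at h1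
  refine abs_le_of_normalized ha1 ht0 ht1 (norm_nonneg _) hQg hQp hQ ((hYb _ _ hTg).trans_eq
    (by ring)) ((hYb _ _ hTp).trans_eq (by ring)) ((hYb _ _ hTT).trans_eq (by ring)) hθi hθθ hθp
    (by simp) hsθ h1 ?_ (hlev.trans hfp) (hTay.trans (by gcongr))
  rw [hT, theta_tangential hθg]

end SecondOrderEstimate

/-! ### The defining function in the charts -/

section NormalForm

/-- A smooth function changes little in a direction `w` in which its derivative vanishes at a nearby
point. -/
theorem exists_bound_of_fderiv_eq_zero {X : Type*} [NormedAddCommGroup X] [NormedSpace ℝ X]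
    {τ : X → ℝ} {x₀ : X} (hτ : ContDiffAt ℝ ∞ τ x₀) : ∃ K ≥ 0, ∃ r > 0, ∀ x ∈ ball x₀ r,
      ∀ y ∈ ball x₀ r, ∀ w, y + w ∈ ball x₀ r → fderiv ℝ τ x w = 0 →
        |τ (y + w) - τ y| ≤ K * (‖y - x‖ + ‖w‖) * ‖w‖ := by
  have h2 : ∀ᶠ z in 𝓝 x₀, ContDiffAt ℝ 2 τ z :=
    ContDiffAt.eventually (hτ.of_le ENat.LEInfty.out) (by simp)
  have hd : ContDiffAt ℝ 1 (fderiv ℝ τ) x₀ := h2.self_of_nhds.fderiv_right (by norm_num)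
  obtain ⟨K, s, hs, hK⟩ := hd.exists_lipschitzOnWith
  obtain ⟨r, hr, hball⟩ := Metric.eventually_nhds_iff_ball.1 (h2.and hs)
  refine ⟨K, K.2, r, hr, fun x hx y hy w hyw h0 => ?_⟩
  obtain ⟨z, hz, hz'⟩ := domain_mvt (f := τ) (f' := fderiv ℝ τ) (s := ball x₀ r)
    (x := y) (y := y + w)
    (fun z hz => ((hball z hz).1.differentiableAt (by simp)).hasFDerivAt.hasFDerivWithinAt)
    (convex_ball x₀ r) hy hyw
  have hzb := (convex_ball x₀ r).segment_subset hy hyw hz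
  have hzy : ‖z - y‖ ≤ ‖w‖ := by
    rw [segment_eq_image'] at hz
    obtain ⟨θ, hθ, rfl⟩ := hz
    simp only [add_sub_cancel_left, norm_smul, Real.norm_eq_abs, abs_of_nonneg hθ.1]
    exact mul_le_of_le_one_left (norm_nonneg _) hθ.2
  have hzx : ‖z - x‖ ≤ ‖y - x‖ + ‖w‖ := by
    have := norm_add_le (z - y) (y - x)
    rw [sub_add_sub_cancel] at this
    linarith
  rw [hz', add_sub_cancel_left]
  have h3 : fderiv ℝ τ z w = (fderiv ℝ τ z - fderiv ℝ τ x) w := by rw [sub_apply, h0, sub_zero]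
  rw [h3, ← Real.norm_eq_abs]
  refine ((fderiv ℝ τ z - fderiv ℝ τ x).le_opNorm w).trans ?_
  have h4 := hK.dist_le_mul z (hball z hzb).2 x (hball x hx).2
  rw [dist_eq_norm, dist_eq_norm] at h4
  exact mul_le_mul_of_nonneg_right (h4.trans (by gcongr)) (norm_nonneg _)

variable {n l : ℕ} {i₀ : Fin n} {f : Cn n → ℝ} {G : Cn n × Cn n → Cn n}
  {M N : Cn n → Cn n →L[ℂ] Cn n}

theorem tendsto_chartInverse (hf : IsAdapted l i₀ f) (hF : IsLeafFrame l i₀ f G M N) :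
    Tendsto (chartInverse l i₀ f G M) (𝓝 (0, 0)) (𝓝 0) := by
  have h := (contDiffAt_chartInverse hf hF).self_of_nhds.continuousAt
  rwa [ContinuousAt, (chartInverse_zero hF).self_of_nhds] at h

theorem eventually_contDiffAt_pullback (hf : IsAdapted l i₀ f) (hF : IsLeafFrame l i₀ f G M N) :
    ∀ᶠ x in 𝓝 (0, 0), ContDiffAt ℝ ∞ (fun x => f (chartInverse l i₀ f G M x)) x := by
  filter_upwards [contDiffAt_chartInverse hf hF,
    (tendsto_chartInverse hf hF).eventually hf.smooth] with x h1 h2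
  exact h2.comp x h1

/-- At `ζ = 0` the derivative of the pullback of `f` along the `ζ₁` axis is `Re ζ₁`. -/
theorem fderiv_pullback (hf : IsAdapted l i₀ f) (hF : IsLeafFrame l i₀ f G M N) :
    ∀ᶠ p in 𝓝 0, ∀ c : ℂ, fderiv ℝ (fun x => f (chartInverse l i₀ f G M x)) (p, 0)
      (0, c • stdVec i₀) = c.re := by
  have ht : Tendsto (fun p : Cn n => (p, (0 : Cn n))) (𝓝 0) (𝓝 (0, 0)) :=
    Continuous.tendsto' (by fun_prop) _ _ rfl
  filter_upwards [ht.eventually (eventually_contDiffAt_pullback hf hF), hf.smooth,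
    hf.eventually_theta_ne, hF.leaf_zero] with p hR hfp hθ hG c
  have h1 : HasDerivAt (fun s : ℝ => (p, s • c • stdVec i₀)) ((0 : Cn n), c • stdVec i₀) 0 := by
    refine (hasDerivAt_const (0 : ℝ) p).prodMk ?_
    simpa using (hasDerivAt_id (0 : ℝ)).smul_const (c • (stdVec i₀ : Cn n))
  have h2 : HasFDerivAt (fun x => f (chartInverse l i₀ f G M x))
      (fderiv ℝ (fun x => f (chartInverse l i₀ f G M x)) (p, 0))
      ((fun s : ℝ => (p, s • c • stdVec i₀)) 0) := by
    simp only [zero_smul]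
    exact (hR.differentiableAt (by simp)).hasFDerivAt
  have h3 := h2.comp_hasDerivAt (0 : ℝ) h1
  have hcurve : ∀ s : ℝ, chartInverse l i₀ f G M (p, s • c • stdVec i₀) =
      p + s • (c / theta f p (stdVec i₀)) • stdVec i₀ := by
    intro s
    have e0 : s • c • (stdVec i₀ : Cn n) = ((s : ℂ) * c) • stdVec i₀ := by
      rw [mul_smul]
      exact (algebraMap_smul ℂ s (c • (stdVec i₀ : Cn n))).symm
    have e1 : coordProj (primeIdx n l) (s • c • stdVec i₀) = 0 := by
      rw [e0, map_smul, coordProj_stdVec_of_notMem hf.notMem_primeIdx, smul_zero]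
    have e2 : coordProj (doublePrimeIdx n l) (s • c • stdVec i₀) = 0 := by
      rw [e0, map_smul, coordProj_stdVec_of_notMem hf.notMem_doublePrimeIdx, smul_zero]
    have e3 : G (p, s • c • stdVec i₀) = p := by rw [← hF.leaf_coordProj, e2, hG]
    have e4 : quadraticShift l i₀ f M p (s • c • stdVec i₀) = 0 := by
      rw [← quadraticShift_coordProj, e1, quadraticShift_zero]
    rw [chartInverse]
    simp only [e1, e3, e4, map_zero, add_zero]
    congr 1
    rw [e0, ← algebraMap_smul ℂ s, smul_smul]
    congr 1
    simp
    ring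
  have h4 : HasDerivAt (fun s : ℝ => p + s • (c / theta f p (stdVec i₀)) • stdVec i₀)
      ((c / theta f p (stdVec i₀)) • stdVec i₀) 0 := by
    simpa using ((hasDerivAt_id (0 : ℝ)).smul_const
      ((c / theta f p (stdVec i₀)) • (stdVec i₀ : Cn n))).const_add p
  have h5 : HasFDerivAt f (fderiv ℝ f p)
      ((fun s : ℝ => p + s • (c / theta f p (stdVec i₀)) • stdVec i₀) 0) := by
    simp only [zero_smul, add_zero]
    exact (hfp.differentiableAt (by simp)).hasFDerivAt
  have h6 := h5.comp_hasDerivAt (0 : ℝ) h4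
  have h7 : (fun x => f (chartInverse l i₀ f G M x)) ∘ (fun s : ℝ => (p, s • c • stdVec i₀)) =
      f ∘ fun s : ℝ => p + s • (c / theta f p (stdVec i₀)) • stdVec i₀ := by
    funext s
    exact congrArg f (hcurve s)
  rw [h7] at h3
  have h8 := h3.unique h6
  rw [h8, ← theta_re, map_smul, smul_eq_mul, div_mul_cancel₀ _ hθ]

theorem norm_coordProj_le (s : Finset (Fin n)) (ζ : Cn n) : ‖coordProj s ζ‖ ≤ ‖ζ‖ := by
  rw [norm_coordProj, EuclideanSpace.norm_eq, partNorm]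
  exact Real.sqrt_le_sqrt (Finset.sum_le_sum_of_subset_of_nonneg (Finset.subset_univ _)
    fun _ _ _ => by positivity)

/-- The defining functions `τ(p, ·)` of the hypersurface in the charts, normalised by
`τ(p, ζ + s e₁) = τ(p, ζ) + s`. -/
theorem exists_chart_definingFunction (hf : IsAdapted l i₀ f) (hF : IsLeafFrame l i₀ f G M N) :
    ∃ τ : Cn n × Cn n → ℝ, (∀ᶠ x in 𝓝 (0, 0), ContDiffAt ℝ ∞ τ x) ∧
      (∃ c > 0, ∀ᶠ x in 𝓝 (0, 0), ∃ k, c ≤ k ∧ f (chartInverse l i₀ f G M x) = k * τ x) ∧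
      (∀ᶠ y in 𝓝 (((0 : Cn n), (0 : Cn n)), (0 : ℝ)),
        τ (y.1 + y.2 • (0, stdVec i₀)) = τ y.1 + y.2) ∧
      (∀ᶠ x in 𝓝 (0, 0), fderiv ℝ τ x (0, stdVec i₀) = 1) ∧
      ∀ᶠ p in 𝓝 0, f p = 0 →
        ∀ y : ℝ, fderiv ℝ τ (p, 0) (0, (y * Complex.I) • stdVec i₀) = 0 := by
  set R : Cn n × Cn n → ℝ := fun x => f (chartInverse l i₀ f G M x) with hR
  have hRs : ∀ᶠ x in 𝓝 (0, 0), ContDiffAt ℝ ∞ R x := eventually_contDiffAt_pullback hf hF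
  have hR0 : R (0, 0) = 0 := by
    rw [hR]
    simp only [(chartInverse_zero hF).self_of_nhds, hf.value_zero]
  have hRd : ∀ᶠ p in 𝓝 0, ∀ c : ℂ, fderiv ℝ R (p, 0) (0, c • stdVec i₀) = c.re :=
    fderiv_pullback hf hF
  have hRd1 : ∀ᶠ p in 𝓝 0, fderiv ℝ R (p, 0) (0, stdVec i₀) = 1 := by
    filter_upwards [hRd] with p hp
    simpa using hp 1
  obtain ⟨τ, hτ0, hτs, ⟨c, hc, hk⟩, htr, hτd⟩ := exists_normalized_definingFunction hRs hR0
    (e := (0, stdVec i₀)) (by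
      have := hRd1.self_of_nhds
      rw [this]
      exact one_pos)
  have htr1 : ∀ᶠ x in 𝓝 (0, 0), fderiv ℝ τ x (0, stdVec i₀) = 1 := by
    rw [nhds_prod_eq] at htr
    filter_upwards [hτs, htr.curry] with x hx hx'
    have h1 : HasDerivAt (fun s : ℝ => x + s • ((0 : Cn n), (stdVec i₀ : Cn n)))
        ((0 : Cn n), stdVec i₀) 0 := by
      simpa using ((hasDerivAt_id (0 : ℝ)).smul_const ((0 : Cn n), (stdVec i₀ : Cn n))).const_add x
    have h2 : HasFDerivAt τ (fderiv ℝ τ x)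
        ((fun s : ℝ => x + s • ((0 : Cn n), (stdVec i₀ : Cn n))) 0) := by
      simp only [zero_smul, add_zero]
      exact (hx.differentiableAt (by simp)).hasFDerivAt
    have h3 := h2.comp_hasDerivAt (0 : ℝ) h1
    have h4 : HasDerivAt (fun s : ℝ => τ x + s) 1 0 := (hasDerivAt_id (0 : ℝ)).const_add (τ x)
    exact h3.unique (h4.congr_of_eventuallyEq hx')
  have hpt : Tendsto (fun p : Cn n => (p, (0 : Cn n))) (𝓝 0) (𝓝 (0, 0)) :=
    Continuous.tendsto' (by fun_prop) _ _ rfl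
  refine ⟨τ, hτs, ⟨c, hc, hk⟩, htr, htr1, ?_⟩
  filter_upwards [hpt.eventually hk, hpt.eventually hτd, hRd, hRd1, chartInverse_zero hF]
    with p ⟨k, hck, hkR⟩ hτd hRd hRd1 hΨ hfp y
  have hτp : τ (p, 0) = 0 := by
    have h1 : R (p, 0) = 0 := by rw [hR]; simp only [hΨ, hfp]
    rw [h1] at hkR
    exact (mul_eq_zero.1 hkR.symm).resolve_left (hc.trans_le hck).ne'
  have h1 := hτd hτp (0, (y * Complex.I) • stdVec i₀)
  rw [hRd1, one_mul, hRd] at h1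
  simpa using h1

/-- In the charts the hypersurface is given, up to the stated error, by `Re ζ₁ + |ζ'|² = 0`. -/
theorem normal_form_bound (hf : IsAdapted l i₀ f) (hF : IsLeafFrame l i₀ f G M N)
    {τ : Cn n × Cn n → ℝ} {c : ℝ} (hτs : ∀ᶠ x in 𝓝 (0, 0), ContDiffAt ℝ ∞ τ x) (hc : 0 < c)
    (hk : ∀ᶠ x in 𝓝 (0, 0), ∃ k, c ≤ k ∧ f (chartInverse l i₀ f G M x) = k * τ x)
    (htr : ∀ᶠ y in 𝓝 (((0 : Cn n), (0 : Cn n)), (0 : ℝ)),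
      τ (y.1 + y.2 • (0, stdVec i₀)) = τ y.1 + y.2)
    (hw : ∀ᶠ p in 𝓝 0, f p = 0 →
      ∀ y : ℝ, fderiv ℝ τ (p, 0) (0, (y * Complex.I) • stdVec i₀) = 0) :
    ∃ C > 0, ∀ᶠ x in 𝓝 (0, 0), f x.1 = 0 →
      |τ x - ((x.2 i₀).re + ‖coordProj (primeIdx n l) x.2‖ ^ 2)| ≤
        C * (‖coordProj (primeIdx n l) x.2‖ ^ 2 * ‖coordProj (doublePrimeIdx n l) x.2‖ +
          ‖coordProj (primeIdx n l) x.2‖ ^ 3 + |(x.2 i₀).im| * ‖x.2‖) := by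
  obtain ⟨C, hC, hthird⟩ := exists_third_order_bound hf hF
  obtain ⟨K, hK, r, hr, hKb⟩ := exists_bound_of_fderiv_eq_zero hτs.self_of_nhds
  -- the projection of `ζ` to the model hypersurface in the transversal direction
  let η : Cn n × Cn n → Cn n := fun x => coordProj (primeIdx n l) x.2 +
    coordProj (doublePrimeIdx n l) x.2 -
      ((‖coordProj (primeIdx n l) x.2‖ ^ 2 : ℝ) : ℂ) • stdVec i₀
  have hηt : Tendsto (fun x => (x.1, η x)) (𝓝 (0, 0)) (𝓝 (0, 0)) :=
    Continuous.tendsto' (by fun_prop) _ _ (by simp [η])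
  have hpt : Tendsto (fun x : Cn n × Cn n => (x.1, (0 : Cn n))) (𝓝 (0, 0)) (𝓝 (0, 0)) :=
    Continuous.tendsto' (by fun_prop) _ _ rfl
  have hξt : Tendsto (fun x : Cn n × Cn n =>
      ((x.1, η x + ((x.2 i₀).im * Complex.I) • stdVec i₀),
        (x.2 i₀).re + ‖coordProj (primeIdx n l) x.2‖ ^ 2)) (𝓝 (0, 0)) (𝓝 ((0, 0), 0)) :=
    Continuous.tendsto' (by fun_prop) _ _ (by simp [η])
  have hξt' := (continuous_fst.tendsto' (((0 : Cn n), (0 : Cn n)), (0 : ℝ)) _ rfl).comp hξt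
  have hnt : Tendsto (fun x : Cn n × Cn n => ‖x.2‖) (𝓝 (0, 0)) (𝓝 0) :=
    Continuous.tendsto' (by fun_prop) _ _ (by simp)
  refine ⟨C / c + 4 * K, by positivity, ?_⟩
  filter_upwards [hηt.eventually hk, hηt.eventually hthird, tendsto_fst_zero.eventually hw,
    hξt.eventually htr,
    hηt.eventually (ball_mem_nhds _ hr), hpt.eventually (ball_mem_nhds _ hr),
    hξt'.eventually (ball_mem_nhds _ hr), hnt.eventually (ge_mem_nhds one_pos)]
    with x hkη hthird hw htr hbη hb0 hbξ hn1 hfp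
  obtain ⟨p, ζ⟩ := x
  simp only [Function.comp] at *
  have hdisj := disjoint_primeIdx_doublePrimeIdx (n := n) (l := l)
  have hη' : η (p, ζ) = coordProj (primeIdx n l) ζ + coordProj (doublePrimeIdx n l) ζ -
      ((‖coordProj (primeIdx n l) ζ‖ ^ 2 : ℝ) : ℂ) • stdVec i₀ := rfl
  set v := η (p, ζ)
  set t := ‖coordProj (primeIdx n l) ζ‖ with ht
  set d := ‖coordProj (doublePrimeIdx n l) ζ‖ with hd
  have hv1 : coordProj (primeIdx n l) v = coordProj (primeIdx n l) ζ := by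
    rw [hη', map_sub, map_add, map_smul, coordProj_self, coordProj_of_disjoint hdisj,
      coordProj_stdVec_of_notMem hf.notMem_primeIdx, smul_zero, add_zero, sub_zero]
  have hv2 : coordProj (doublePrimeIdx n l) v = coordProj (doublePrimeIdx n l) ζ := by
    rw [hη', map_sub, map_add, map_smul, coordProj_self, coordProj_of_disjoint hdisj.symm,
      coordProj_stdVec_of_notMem hf.notMem_doublePrimeIdx, smul_zero, zero_add, sub_zero]
  have hv0 : v i₀ = -((t ^ 2 : ℝ) : ℂ) := by
    rw [hη']
    simp [coordProj_apply_of_notMem hf.notMem_primeIdx,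
      coordProj_apply_of_notMem hf.notMem_doublePrimeIdx]
  have ht0 : 0 ≤ t := norm_nonneg _
  have hd0 : 0 ≤ d := norm_nonneg _
  have htn : t ≤ ‖ζ‖ := norm_coordProj_le _ _
  have hdn : d ≤ ‖ζ‖ := norm_coordProj_le _ _
  -- the part on the model hypersurface
  have hA : |τ (p, v)| ≤ C / c * (t ^ 2 * d + t ^ 3) := by
    obtain ⟨k, hck, hkR⟩ := hkη
    rw [hv1, hv2] at hthird
    have h1 := hthird hfp hv0
    rw [hkR, abs_mul, abs_of_pos (hc.trans_le hck)] at h1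
    rw [div_mul_eq_mul_div, le_div_iff₀ hc]
    calc |τ (p, v)| * c ≤ k * |τ (p, v)| := by
          rw [mul_comm]; exact mul_le_mul_of_nonneg_right hck (abs_nonneg _)
      _ ≤ _ := h1
  -- the part along the imaginary axis
  have hw0 := hw hfp (ζ i₀).im
  have hwn : ‖((0 : Cn n), ((ζ i₀).im * Complex.I) • (stdVec i₀ : Cn n))‖ = |(ζ i₀).im| := by
    simp [Prod.norm_mk, norm_smul]
  have hB := hKb (p, 0) hb0 (p, v) hbη (0, ((ζ i₀).im * Complex.I) • stdVec i₀)
    (by simpa using hbξ) hw0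
  rw [hwn] at hB
  have himn : |(ζ i₀).im| ≤ ‖ζ‖ :=
    (Complex.abs_im_le_norm _).trans (PiLp.norm_apply_le ζ i₀)
  have hvn : ‖((p, v) : Cn n × Cn n) - (p, 0)‖ ≤ 3 * ‖ζ‖ := by
    have h1 : ‖((p, v) : Cn n × Cn n) - (p, 0)‖ = ‖v‖ := by simp [Prod.norm_mk]
    rw [h1, hη']
    have h2 : ‖((t ^ 2 : ℝ) : ℂ) • (stdVec i₀ : Cn n)‖ = t ^ 2 := by
      rw [norm_smul, Complex.norm_real, Real.norm_eq_abs, abs_of_nonneg (pow_nonneg ht0 2)]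
      simp
    have h3 := norm_sub_le (coordProj (primeIdx n l) ζ + coordProj (doublePrimeIdx n l) ζ)
      (((t ^ 2 : ℝ) : ℂ) • (stdVec i₀ : Cn n))
    have h4 := norm_add_le (coordProj (primeIdx n l) ζ) (coordProj (doublePrimeIdx n l) ζ)
    have h5 : t ^ 2 ≤ ‖ζ‖ := (pow_le_of_le_one ht0 (htn.trans hn1) two_ne_zero).trans htn
    rw [h2] at h3
    linarith
  -- the translation in the direction `e₁`
  have hζ : (p, v + ((ζ i₀).im * Complex.I) • stdVec i₀) + ((ζ i₀).re + t ^ 2) •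
      ((0 : Cn n), (stdVec i₀ : Cn n)) = (p, ζ) := by
    refine Prod.ext (by simp) ?_
    simp only [Prod.snd_add, Prod.smul_snd]
    conv_rhs => rw [coord_decomposition hf.lt hf.index_eq ζ, ← Complex.re_add_im (ζ i₀)]
    rw [hη', ← algebraMap_smul ℂ ((ζ i₀).re + t ^ 2), Complex.coe_algebraMap]
    push_cast
    module
  rw [hζ] at htr
  have hsplit : τ (p, ζ) - ((ζ i₀).re + t ^ 2) =
      (τ ((p, v) + (0, ((ζ i₀).im * Complex.I) • stdVec i₀)) - τ (p, v)) + τ (p, v) := by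
    rw [htr]
    simp only [Prod.mk_add_mk, add_zero]
    ring
  rw [hsplit]
  refine (abs_add_le _ _).trans ((add_le_add hB hA).trans ?_)
  have h1 : K * (‖((p, v) : Cn n × Cn n) - (p, 0)‖ + |(ζ i₀).im|) * |(ζ i₀).im| ≤
      K * (3 * ‖ζ‖ + ‖ζ‖) * |(ζ i₀).im| :=
    mul_le_mul_of_nonneg_right (mul_le_mul_of_nonneg_left (add_le_add hvn himn) hK) (abs_nonneg _)
  have h2 : 0 ≤ C / c * (|(ζ i₀).im| * ‖ζ‖) :=
    mul_nonneg (div_nonneg hC.le hc.le) (mul_nonneg (abs_nonneg _) (norm_nonneg _))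
  have h3 : 0 ≤ 4 * K * (t ^ 2 * d + t ^ 3) :=
    mul_nonneg (mul_nonneg (by norm_num) hK)
      (add_nonneg (mul_nonneg (pow_nonneg ht0 2) hd0) (pow_nonneg ht0 3))
  linarith

end NormalForm

/-! ### Rescaling to the unit ball -/

section ScaledCharts

variable {n l : ℕ} {i₀ : Fin n} {f : Cn n → ℝ}

theorem real_smul_coord (δ : ℝ) (ζ : Cn n) (j : Fin n) : (δ • ζ) j = (δ : ℂ) * ζ j := by
  simp

theorem coordProj_real_smul (s : Finset (Fin n)) (δ : ℝ) (ζ : Cn n) :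
    coordProj s (δ • ζ) = δ • coordProj s ζ := by
  rw [← algebraMap_smul ℂ δ ζ, map_smul, algebraMap_smul]

/-- Rescaling of the normal form: the coefficients of `|ζ_j|²` become `δ`. -/
theorem abs_le_of_rescaled_normal_form {s s' : Finset (Fin n)} {τ δ C : ℝ} {ζ : Cn n}
    (hδ : 0 < δ) (hδ1 : δ ≤ 1) (hC : 0 ≤ C)
    (h : |τ - (((δ • ζ) i₀).re + ‖coordProj s (δ • ζ)‖ ^ 2)| ≤
      C * (‖coordProj s (δ • ζ)‖ ^ 2 * ‖coordProj s' (δ • ζ)‖ + ‖coordProj s (δ • ζ)‖ ^ 3 +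
        |((δ • ζ) i₀).im| * ‖δ • ζ‖)) :
    |δ⁻¹ * τ - ((ζ i₀).re + ∑ j ∈ s, δ * ‖ζ j‖ ^ 2)| ≤
      C * (partNorm s ζ ^ 2 * partNorm s' ζ + partNorm s ζ ^ 3 + |(ζ i₀).im| * ‖ζ‖) := by
  have hs : ∑ j ∈ s, δ * ‖ζ j‖ ^ 2 = δ * partNorm s ζ ^ 2 := by
    rw [← Finset.mul_sum, partNorm, Real.sq_sqrt (Finset.sum_nonneg fun _ _ => by positivity)]
  rw [coordProj_real_smul, coordProj_real_smul, real_smul_coord, norm_smul, norm_smul,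
    norm_smul, norm_coordProj, norm_coordProj, Complex.re_ofReal_mul, Complex.im_ofReal_mul,
    Real.norm_eq_abs, abs_mul, abs_of_pos hδ] at h
  rw [hs]
  have ht : 0 ≤ partNorm s ζ := Real.sqrt_nonneg _
  have hd : 0 ≤ partNorm s' ζ := Real.sqrt_nonneg _
  have hy : 0 ≤ |(ζ i₀).im| := abs_nonneg _
  have hz : 0 ≤ ‖ζ‖ := norm_nonneg _
  generalize partNorm s ζ = t at *
  generalize partNorm s' ζ = d at *
  generalize |(ζ i₀).im| = y at *
  generalize ‖ζ‖ = z at *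
  have h1 : δ⁻¹ * τ - ((ζ i₀).re + δ * t ^ 2) = δ⁻¹ * (τ - (δ * (ζ i₀).re + (δ * t) ^ 2)) := by
    field_simp
  rw [h1, abs_mul, abs_of_pos (inv_pos.2 hδ), inv_mul_le_iff₀ hδ]
  refine h.trans ?_
  have h2 : δ ^ 3 ≤ δ := pow_le_of_le_one hδ.le hδ1 (by norm_num)
  have h3 : δ ^ 2 ≤ δ := pow_le_of_le_one hδ.le hδ1 (by norm_num)
  calc _ = C * (δ ^ 3 * (t ^ 2 * d) + δ ^ 3 * t ^ 3 + δ ^ 2 * (y * z)) := by ring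
    _ ≤ C * (δ * (t ^ 2 * d) + δ * t ^ 3 + δ * (y * z)) := by gcongr
    _ = _ := by ring

/-- Local inverses, one of them defined on the ball of radius `δ`, give a biholomorphic map onto the
unit ball after rescaling. -/
theorem isBiholomorphic_scaled {φ ψ : Cn n → Cn n} {a δ : ℝ} (hδ : 0 < δ)
    (h1 : ∀ w ∈ ball 0 a, DifferentiableAt ℂ φ w ∧ ψ (φ w) = w)
    (h2 : ∀ ζ ∈ ball (0 : Cn n) 1, DifferentiableAt ℂ ψ (δ • ζ) ∧ φ (ψ (δ • ζ)) = δ • ζ ∧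
      ψ (δ • ζ) ∈ ball 0 a) :
    IsBiholomorphic (fun w => δ⁻¹ • φ w) (fun ζ => ψ (δ • ζ)) (ball 0 a ∩ φ ⁻¹' ball 0 δ)
      (ball 0 1) := by
  have hscale : ∀ w : Cn n, δ⁻¹ • w ∈ ball (0 : Cn n) 1 ↔ w ∈ ball 0 δ := by
    intro w
    rw [mem_ball_zero_iff, mem_ball_zero_iff, norm_smul, Real.norm_eq_abs,
      abs_of_pos (inv_pos.2 hδ), inv_mul_lt_iff₀ hδ, mul_one]
  refine ⟨?_, isOpen_ball, fun w hw => (hscale _).2 hw.2, fun ζ hζ => ⟨(h2 ζ hζ).2.2, ?_⟩,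
    ⟨fun w hw => ?_, fun ζ hζ => ?_⟩, fun w hw => ?_, fun ζ hζ => ?_⟩
  · exact ContinuousOn.isOpen_inter_preimage
      (fun w hw => (h1 w hw).1.continuousAt.continuousWithinAt) isOpen_ball isOpen_ball
  · rw [mem_preimage, (h2 ζ hζ).2.1, ← hscale, inv_smul_smul₀ hδ.ne']
    exact hζ
  · change ψ (δ • δ⁻¹ • φ w) = w
    rw [smul_inv_smul₀ hδ.ne', (h1 w hw.1).2]
  · change δ⁻¹ • φ (ψ (δ • ζ)) = ζ
    rw [(h2 ζ hζ).2.1, inv_smul_smul₀ hδ.ne']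
  · exact ((h1 w hw.1).1.const_smul δ⁻¹).differentiableWithinAt
  · exact ((h2 ζ hζ).1.comp ζ (differentiableAt_id.const_smul δ)).differentiableWithinAt

theorem contDiffAt_scaled {τ : Cn n × Cn n → ℝ} {p ζ e : Cn n} {δ : ℝ} (hδ : 0 < δ)
    (hτ : ContDiffAt ℝ ∞ τ (p, δ • ζ)) (he : fderiv ℝ τ (p, δ • ζ) (0, e) = 1) :
    ContDiffAt ℝ ∞ (fun ζ => δ⁻¹ * τ (p, δ • ζ)) ζ ∧
      fderiv ℝ (fun ζ => δ⁻¹ * τ (p, δ • ζ)) ζ ≠ 0 := by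
  have h2 : ContDiffAt ℝ ∞ (fun ζ : Cn n => (p, δ • ζ)) ζ :=
    contDiffAt_const.prodMk (contDiffAt_id.const_smul δ)
  refine ⟨contDiffAt_const.mul (ContDiffAt.comp ζ (g := τ) hτ h2), fun h => ?_⟩
  have h1 : HasFDerivAt τ (fderiv ℝ τ (p, δ • ζ)) (p, δ • ζ) :=
    (hτ.differentiableAt (by simp)).hasFDerivAt
  have h2 : HasFDerivAt (fun ζ : Cn n => (p, δ • ζ))
      ((0 : Cn n →L[ℝ] Cn n).prod (δ • ContinuousLinearMap.id ℝ (Cn n))) ζ :=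
    (hasFDerivAt_const p ζ).prodMk ((hasFDerivAt_id ζ).const_smul δ)
  have h3 : HasFDerivAt (fun ζ => δ⁻¹ * τ (p, δ • ζ)) _ ζ :=
    (HasFDerivAt.comp ζ (g := τ) h1 h2).const_mul δ⁻¹
  rw [h3.fderiv] at h
  have h6 := congrArg (fun B => B e) h
  have h7 : ((0 : Cn n), δ • e) = δ • (0, e) := by rw [Prod.smul_mk, smul_zero]
  change δ⁻¹ * fderiv ℝ τ (p, δ • ζ) (0, δ • e) = 0 at h6
  rw [h7, map_smul, he, smul_eq_mul, mul_one, inv_mul_cancel₀ hδ.ne'] at h6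
  exact one_ne_zero h6

/-- The local normal form in adapted coordinates, with the charts rescaled to map onto the unit
ball. -/
theorem IsAdapted.exists_scaled_charts (hf : IsAdapted l i₀ f) {W : Set (Cn n)}
    (hW : W ∈ 𝓝 0) :
    ∃ (u δ C : ℝ) (N : Cn n → Set (Cn n)) (Φ Ψ : Cn n → Cn n → Cn n) (ρ : Cn n → Cn n → ℝ),
      0 < u ∧ 0 < δ ∧
      (∀ p ∈ ball 0 u, ∀ z ∈ N p, ContDiffAt ℝ ∞ (fun x : Cn n × Cn n => Φ x.1 x.2) (p, z)) ∧
      (∀ p ∈ ball 0 u, ∀ ζ ∈ ball 0 1,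
        ContDiffAt ℝ ∞ (fun x : Cn n × Cn n => Ψ x.1 x.2) (p, ζ)) ∧
      ∀ p ∈ ball 0 u, ball 0 u ⊆ N p ∧ N p ⊆ W ∧ IsBiholomorphic (Φ p) (Ψ p) (N p) (ball 0 1) ∧
        Φ p p = 0 ∧
        (∀ ζ ∈ ball 0 1, ContDiffAt ℝ ∞ (ρ p) ζ ∧ fderiv ℝ (ρ p) ζ ≠ 0 ∧
          ∃ k > 0, f (Ψ p ζ) = k * ρ p ζ) ∧
        (f p = 0 → ∀ ζ ∈ ball (0 : Cn n) 1,
          |ρ p ζ - ((ζ i₀).re + ∑ j ∈ primeIdx n l, δ * ‖ζ j‖ ^ 2)| ≤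
            C * (partNorm (primeIdx n l) ζ ^ 2 * partNorm (doublePrimeIdx n l) ζ +
              partNorm (primeIdx n l) ζ ^ 3 + |(ζ i₀).im| * ‖ζ‖)) := by
  obtain ⟨G, M, N, hF⟩ := hf.exists_isLeafFrame
  obtain ⟨τ, hτs, ⟨c, hc, hk⟩, htr, htr1, hw⟩ := exists_chart_definingFunction hf hF
  obtain ⟨C, hC, hbound⟩ := normal_form_bound hf hF hτs hc hk htr hw
  have hA0 := contDiffAt_chart hf hF
  have hA1 := differentiableAt_chart hF
  have hA2 := chartInverse_chart hf hF
  have hB0 := contDiffAt_chartInverse hf hF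
  have hB1 := differentiableAt_chartInverse hF
  have hB2 := chart_chartInverse hf hF
  have hBt := tendsto_chartInverse hf hF
  have hself := chart_self hF
  generalize chart l i₀ f G M N = Φ at *
  generalize chartInverse l i₀ f G M = Ψ at *
  have hΦt : Tendsto Φ (𝓝 (0, 0)) (𝓝 0) := by
    have h := hA0.self_of_nhds.continuousAt
    rwa [ContinuousAt, hself.self_of_nhds] at h
  have hmem : ∀ {r : ℝ} {p w : Cn n}, p ∈ ball 0 r → w ∈ ball 0 r →
      (p, w) ∈ ball ((0 : Cn n), (0 : Cn n)) r := fun hp hw => by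
    rw [← ball_prod_same]
    exact ⟨hp, hw⟩
  obtain ⟨a, ha, hA⟩ := Metric.eventually_nhds_iff_ball.1 ((hA0.and hA1).and hA2)
  obtain ⟨a', ha', hW'⟩ := Metric.mem_nhds_iff.1 (Filter.inter_mem hW (ball_mem_nhds (0 : Cn n) ha))
  obtain ⟨b, hb, hB⟩ := Metric.eventually_nhds_iff_ball.1
    (((((((hB0.and hB1).and hB2).and (hBt.eventually (ball_mem_nhds (0 : Cn n) ha'))).and hτs).and
      hk).and htr1).and hbound)
  -- the scale `δ` also serves as the coefficient of `|ζ_j|²` in the rescaled normal form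
  let δ := min b 1
  have hδ : 0 < δ := lt_min hb one_pos
  have hδ1 : δ ≤ 1 := min_le_right _ _
  obtain ⟨u₀, hu₀, hU₀⟩ := Metric.eventually_nhds_iff_ball.1
    (hΦt.eventually (ball_mem_nhds (0 : Cn n) hδ))
  obtain ⟨u₁, hu₁, hU₁⟩ := Metric.eventually_nhds_iff_ball.1 hself
  let u := min (min u₀ u₁) (min a' b)
  have hu : 0 < u := lt_min (lt_min hu₀ hu₁) (lt_min ha' hb)
  have huu₀ : ball (0 : Cn n) u ⊆ ball 0 u₀ :=
    ball_subset_ball ((min_le_left _ _).trans (min_le_left _ _))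
  have huu₁ : ball (0 : Cn n) u ⊆ ball 0 u₁ :=
    ball_subset_ball ((min_le_left _ _).trans (min_le_right _ _))
  have hua' : ball (0 : Cn n) u ⊆ ball 0 a' :=
    ball_subset_ball ((min_le_right _ _).trans (min_le_left _ _))
  have hub : ball (0 : Cn n) u ⊆ ball 0 b :=
    ball_subset_ball ((min_le_right _ _).trans (min_le_right _ _))
  have hAp : ∀ p ∈ ball (0 : Cn n) u, ∀ w ∈ ball (0 : Cn n) a', _ := fun p hp w hw =>
    hA (p, w) (hmem (hW' (hua' hp)).2 (hW' hw).2)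
  have hδb : ∀ ζ ∈ ball (0 : Cn n) 1, δ • ζ ∈ ball (0 : Cn n) b := by
    intro ζ hζ
    rw [mem_ball_zero_iff] at hζ ⊢
    rw [norm_smul, Real.norm_eq_abs, abs_of_pos hδ]
    have h1 : δ ≤ b := min_le_left _ _
    nlinarith [norm_nonneg ζ]
  have hBp : ∀ p ∈ ball (0 : Cn n) u, ∀ ζ ∈ ball (0 : Cn n) 1, _ := fun p hp ζ hζ =>
    hB (p, δ • ζ) (hmem (hub hp) (hδb ζ hζ))
  refine ⟨u, δ, C, fun p => ball 0 a' ∩ (fun w => Φ (p, w)) ⁻¹' ball 0 δ,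
    fun p w => δ⁻¹ • Φ (p, w), fun p ζ => Ψ (p, δ • ζ), fun p ζ => δ⁻¹ * τ (p, δ • ζ),
    hu, hδ, fun p hp z hz => ?_, fun p hp ζ hζ => ?_, fun p hp => ⟨fun w hw => ?_,
      fun w hw => (hW' hw.1).1, ?_, ?_, fun ζ hζ => ?_, fun hfp ζ hζ => ?_⟩⟩
  · exact (hAp p hp z hz.1).1.1.const_smul δ⁻¹
  · have h1 := (hBp p hp ζ hζ).1.1.1.1.1.1.1
    have h2 : ContDiffAt ℝ ∞ (fun x : Cn n × Cn n => (x.1, δ • x.2)) (p, ζ) :=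
      contDiffAt_fst.prodMk (contDiffAt_snd.const_smul δ)
    exact ContDiffAt.comp (p, ζ) (g := Ψ) h1 h2
  · exact ⟨hua' hw, hU₀ (p, w) (hmem (huu₀ hp) (huu₀ hw))⟩
  · refine isBiholomorphic_scaled (φ := fun w => Φ (p, w)) (ψ := fun w => Ψ (p, w)) hδ
      (fun w hw => ⟨(hAp p hp w hw).1.2, (hAp p hp w hw).2⟩) fun ζ hζ => ?_
    have h1 := (hBp p hp ζ hζ).1.1.1.1
    exact ⟨h1.1.1.2, h1.1.2, h1.2⟩
  · change δ⁻¹ • Φ (p, p) = 0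
    rw [hU₁ p (huu₁ hp), smul_zero]
  · have h1 := hBp p hp ζ hζ
    have h2 := contDiffAt_scaled hδ h1.1.1.1.2 h1.1.2
    refine ⟨h2.1, h2.2, ?_⟩
    obtain ⟨k, hck, hkf⟩ := h1.1.1.2
    refine ⟨k * δ, mul_pos (hc.trans_le hck) hδ, ?_⟩
    rw [hkf, mul_assoc, mul_inv_cancel_left₀ hδ.ne']
  · exact abs_le_of_rescaled_normal_form hδ hδ1 hC.le ((hBp p hp ζ hζ).2 hfp)

end ScaledCharts

/-! ### Affine changes of coordinates and the normal form -/

section AffineChange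

variable {n l : ℕ} {r : Cn n → ℝ} {z₀ : Cn n} {L : Cn n ≃L[ℂ] Cn n}

/-- The affine coordinate change `w ↦ z₀ + L w`. -/
def affineMap (z₀ : Cn n) (L : Cn n ≃L[ℂ] Cn n) (w : Cn n) : Cn n := z₀ + L w

/-- The inverse `z ↦ L⁻¹ (z - z₀)` of `affineMap z₀ L`. -/
def affineInv (z₀ : Cn n) (L : Cn n ≃L[ℂ] Cn n) (z : Cn n) : Cn n := L.symm (z - z₀)

theorem affineMap_affineInv (z : Cn n) : affineMap z₀ L (affineInv z₀ L z) = z := by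
  simp [affineMap, affineInv]

theorem affineInv_affineMap (w : Cn n) : affineInv z₀ L (affineMap z₀ L w) = w := by
  simp [affineMap, affineInv]

theorem hasFDerivAt_affineMap (w : Cn n) :
    HasFDerivAt (affineMap z₀ L) (L : Cn n →L[ℂ] Cn n) w :=
  (L : Cn n →L[ℂ] Cn n).hasFDerivAt.const_add z₀

theorem hasFDerivAt_affineInv (z : Cn n) :
    HasFDerivAt (affineInv z₀ L) (L.symm : Cn n →L[ℂ] Cn n) z := by
  have h := (L.symm : Cn n →L[ℂ] Cn n).hasFDerivAt.comp z ((hasFDerivAt_id (𝕜 := ℂ) z).sub_const z₀)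
  exact h

theorem contDiff_affineMap : ContDiff ℝ ∞ (affineMap z₀ L) :=
  contDiff_const.add ((L : Cn n →L[ℂ] Cn n).restrictScalars ℝ).contDiff

theorem contDiff_affineInv : ContDiff ℝ ∞ (affineInv z₀ L) :=
  ((L.symm : Cn n →L[ℂ] Cn n).restrictScalars ℝ).contDiff.comp (contDiff_id.sub contDiff_const)

theorem tendsto_affineMap : Tendsto (affineMap z₀ L) (𝓝 0) (𝓝 z₀) :=
  contDiff_affineMap.continuous.tendsto' _ _ (by simp [affineMap])

theorem fderiv_comp_affineMap {w : Cn n} (hr : DifferentiableAt ℝ r (affineMap z₀ L w)) :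
    fderiv ℝ (fun w => r (affineMap z₀ L w)) w =
      fderiv ℝ r (affineMap z₀ L w) ∘L (L : Cn n →L[ℂ] Cn n).restrictScalars ℝ :=
  (HasFDerivAt.comp w hr.hasFDerivAt ((hasFDerivAt_affineMap w).restrictScalars ℝ)).fderiv

theorem fderiv_fderiv_comp_affineMap {w : Cn n} (hr : ContDiffAt ℝ 2 r (affineMap z₀ L w))
    (u v : Cn n) : fderiv ℝ (fderiv ℝ (fun w => r (affineMap z₀ L w))) w u v =
      fderiv ℝ (fderiv ℝ r) (affineMap z₀ L w) (L u) (L v) := by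
  have h1 : ∀ᶠ y in 𝓝 w, ContDiffAt ℝ 2 r (affineMap z₀ L y) :=
    contDiff_affineMap.continuous.continuousAt.eventually (hr.eventually (by simp))
  have h2 : fderiv ℝ (fun w => r (affineMap z₀ L w)) =ᶠ[𝓝 w] fun y =>
      (fderiv ℝ r (affineMap z₀ L y)) ∘L (L : Cn n →L[ℂ] Cn n).restrictScalars ℝ := by
    filter_upwards [h1] with y hy using fderiv_comp_affineMap (hy.differentiableAt (by simp))
  have h3 : HasFDerivAt (fderiv ℝ r) (fderiv ℝ (fderiv ℝ r) (affineMap z₀ L w))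
      (affineMap z₀ L w) :=
    ((hr.fderiv_right (m := 1) (by norm_num)).differentiableAt (by simp)).hasFDerivAt
  have h4 := (HasFDerivAt.comp w h3 ((hasFDerivAt_affineMap (L := L) w).restrictScalars ℝ)).clm_comp
    (hasFDerivAt_const ((L : Cn n →L[ℂ] Cn n).restrictScalars ℝ) w)
  rw [h2.fderiv_eq]
  have h5 := h4.fderiv
  simp only [Function.comp_def] at h5
  rw [h5]
  simp

theorem theta_comp_affineMap {w : Cn n} (hr : DifferentiableAt ℝ r (affineMap z₀ L w))
    (v : Cn n) : theta (fun w => r (affineMap z₀ L w)) w v =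
      theta r (affineMap z₀ L w) (L v) := by
  rw [theta_apply, theta_apply, fderiv_comp_affineMap hr]
  simp

theorem leviSesq_comp_affineMap {w : Cn n} (hr : ContDiffAt ℝ 2 r (affineMap z₀ L w))
    (u v : Cn n) : leviSesq (fun w => r (affineMap z₀ L w)) w u v =
      leviSesq r (affineMap z₀ L w) (L u) (L v) := by
  simp only [leviSesq_apply, leviReal, fderiv_fderiv_comp_affineMap hr, map_smul]

theorem mem_nullSpace_comp_affineMap {w : Cn n} (hr : ContDiffAt ℝ 2 r (affineMap z₀ L w))
    (u : Cn n) : u ∈ nullSpace (fun w => r (affineMap z₀ L w)) w ↔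
      L u ∈ nullSpace r (affineMap z₀ L w) := by
  have hd := hr.differentiableAt (by simp)
  change (theta _ w u = 0 ∧ ∀ v, theta _ w v = 0 → leviSesq _ w u v = 0) ↔
    (theta r _ (L u) = 0 ∧ ∀ v, theta r _ v = 0 → leviSesq r _ (L u) v = 0)
  simp only [theta_comp_affineMap hd, leviSesq_comp_affineMap hr]
  refine and_congr_right fun _ => ⟨fun h v hv => ?_, fun h v hv => h _ hv⟩
  have := h (L.symm v)
  simp only [ContinuousLinearEquiv.apply_symm_apply] at this
  exact this hv

theorem finrank_nullSpace_comp_affineMap {w : Cn n} (hr : ContDiffAt ℝ 2 r (affineMap z₀ L w)) :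
    finrank ℂ (nullSpace (fun w => r (affineMap z₀ L w)) w) =
      finrank ℂ (nullSpace r (affineMap z₀ L w)) := by
  have h : (nullSpace (fun w => r (affineMap z₀ L w)) w).map
      (L.toLinearEquiv : Cn n →ₗ[ℂ] Cn n) = nullSpace r (affineMap z₀ L w) := by
    ext v
    rw [Submodule.mem_map]
    constructor
    · rintro ⟨u, hu, rfl⟩
      exact (mem_nullSpace_comp_affineMap hr u).1 hu
    · intro hv
      refine ⟨L.symm v, (mem_nullSpace_comp_affineMap hr _).2 ?_, L.apply_symm_apply v⟩
      rwa [L.apply_symm_apply]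
  rw [← h, LinearEquiv.finrank_map_eq]

/-- After an affine change of coordinates, a pseudoconvex boundary of constant Levi rank has a
defining function in adapted position. -/
theorem exists_isAdapted (hl : l < n) {Ω V : Set (Cn n)} (hΩ : IsPseudoconvex Ω)
    (hz₀ : z₀ ∈ frontier Ω) (hV : IsOpen V) (hz₀V : z₀ ∈ V) (hsmooth : SmoothBoundaryIn Ω V)
    (hrank : ∀ q ∈ frontier Ω ∩ V, HasLeviRank Ω q (n - l - 1)) :
    ∃ (L : Cn n ≃L[ℂ] Cn n) (f : Cn n → ℝ), IsAdapted l ⟨0, Nat.zero_lt_of_lt hl⟩ f ∧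
      (∀ᶠ w in 𝓝 0, affineMap z₀ L w ∈ Ω ↔ f w < 0) ∧
      ∀ᶠ w in 𝓝 0, affineMap z₀ L w ∈ frontier Ω ↔ f w = 0 := by
  obtain ⟨r, e, hr0, hre, hrs, hside, hfront, htr, hfin⟩ :=
    exists_boundary_function hl hz₀ hV hz₀V hsmooth hrank
  have hr := hrs.self_of_nhds
  have hr2 : ContDiffAt ℝ 2 r z₀ := hr.of_le ENat.LEInfty.out
  obtain ⟨L, hL1, hL2, hL3⟩ := exists_adapted_coordinates hl hr2 hre hfin.self_of_nhds
    fun X hX => leviReal_nonneg_of_isPseudoconvex hΩ hz₀ hr hr0 hre hside htr hX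
  have h0 : affineMap z₀ L 0 = z₀ := by simp [affineMap]
  have hr2' : ContDiffAt ℝ 2 r (affineMap z₀ L 0) := by rwa [h0]
  refine ⟨L, fun w => r (affineMap z₀ L w), ⟨rfl, hl, ?_, ?_, fun j => ?_, fun j hj => ?_,
    fun j hj k hk => ?_, ?_⟩, tendsto_affineMap.eventually hside,
    tendsto_affineMap.eventually hfront⟩
  · simp only [h0, hr0]
  · filter_upwards [tendsto_affineMap.eventually hrs] with w hw
    exact hw.comp w contDiff_affineMap.contDiffAt
  · rw [theta_comp_affineMap (hr2'.differentiableAt (by simp)), h0]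
    exact hL1 j
  · rw [mem_nullSpace_comp_affineMap hr2', h0]
    exact hL2 j hj
  · rw [leviSesq_comp_affineMap hr2', h0]
    exact hL3 j hj k hk
  · filter_upwards [tendsto_affineMap.eventually hrs, tendsto_affineMap.eventually hfin]
      with w h1 h2
    rw [finrank_nullSpace_comp_affineMap (h1.of_le ENat.LEInfty.out), h2]

theorem isBiholomorphic_affine {Φ Ψ : Cn n → Cn n} {A B : Set (Cn n)}
    (h : IsBiholomorphic Φ Ψ A B) : IsBiholomorphic (fun z => Φ (affineInv z₀ L z))
      (fun ζ => affineMap z₀ L (Ψ ζ)) (affineInv z₀ L ⁻¹' A) B where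
  isOpen_source := h.isOpen_source.preimage contDiff_affineInv.continuous
  isOpen_target := h.isOpen_target
  mapsTo z hz := h.mapsTo hz
  mapsTo_inv ζ hζ := by
    rw [mem_preimage, affineInv_affineMap]
    exact h.mapsTo_inv hζ
  invOn := by
    refine ⟨fun z hz => ?_, fun ζ hζ => ?_⟩
    · change affineMap z₀ L (Ψ (Φ (affineInv z₀ L z))) = z
      rw [h.invOn.1 hz, affineMap_affineInv]
    · change Φ (affineInv z₀ L (affineMap z₀ L (Ψ ζ))) = ζ
      rw [affineInv_affineMap, h.invOn.2 hζ]
  holomorphic := h.holomorphic.comp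
    (fun z _ => (hasFDerivAt_affineInv z).differentiableAt.differentiableWithinAt) fun z hz => hz
  holomorphic_inv ζ hζ :=
    (hasFDerivAt_affineMap (Ψ ζ)).differentiableAt.comp_differentiableWithinAt
    ζ (h.holomorphic_inv ζ hζ)

theorem mem_image_iff_of_isBiholomorphic {Φ Ψ : Cn n → Cn n} {A B S : Set (Cn n)}
    (h : IsBiholomorphic Φ Ψ A B) {ζ : Cn n} (hζ : ζ ∈ B) : ζ ∈ Φ '' (S ∩ A) ↔ Ψ ζ ∈ S := by
  constructor
  · rintro ⟨z, ⟨hzS, hzA⟩, rfl⟩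
    rwa [h.invOn.1 hzA]
  · intro hS
    exact ⟨Ψ ζ, ⟨hS, h.mapsTo_inv hζ⟩, h.invOn.2 hζ⟩

end AffineChange

end LeviFoliation

end

theorem proposition3p2 {n l : ℕ} (hl : l < n)
    (Ω V : Set (LeviFoliation.Cn n)) (z₀ : LeviFoliation.Cn n)
    (hΩconn : IsConnected Ω) (hΩbdd : Bornology.IsBounded Ω)
    (hΩ : LeviFoliation.IsPseudoconvex Ω)
    (hz₀ : z₀ ∈ frontier Ω) (hV : IsOpen V) (hz₀V : z₀ ∈ V)
    (hsmooth : LeviFoliation.SmoothBoundaryIn Ω V)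
    (hrank : ∀ q ∈ frontier Ω ∩ V, LeviFoliation.HasLeviRank Ω q (n - l - 1)) :
    ∃ (U : Set (LeviFoliation.Cn n)) (N : LeviFoliation.Cn n → Set (LeviFoliation.Cn n))
      (Φ Ψ : LeviFoliation.Cn n → LeviFoliation.Cn n → LeviFoliation.Cn n)
      (lam : Fin n → LeviFoliation.Cn n → ℝ) (C ε : ℝ),
      IsOpen U ∧ z₀ ∈ U ∧ IsCompact (closure U) ∧ closure U ⊆ V ∧ 0 < ε ∧ ε ≤ 1 ∧
      -- smooth dependence on `p` of the maps `Φ p`, of their inverses `Ψ p`, and of the `λ_j`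
      ContDiffOn ℝ ∞ (fun x : LeviFoliation.Cn n × LeviFoliation.Cn n => Φ x.1 x.2)
        {x | x.1 ∈ frontier Ω ∩ U ∧ x.2 ∈ N x.1} ∧
      ContDiffOn ℝ ∞ (fun x : LeviFoliation.Cn n × LeviFoliation.Cn n => Ψ x.1 x.2)
        ((frontier Ω ∩ U) ×ˢ ball 0 1) ∧
      (∀ j ∈ LeviFoliation.primeIdx n l, ContDiffOn ℝ ∞ (lam j) (frontier Ω ∩ U)) ∧
      ∀ p ∈ frontier Ω ∩ U,
        U ⊆ N p ∧ IsCompact (closure (N p)) ∧ closure (N p) ⊆ V ∧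
        LeviFoliation.IsBiholomorphic (Φ p) (Ψ p) (N p) (ball 0 1) ∧
        Φ p p = 0 ∧
        (∀ j ∈ LeviFoliation.primeIdx n l, 0 < lam j p) ∧
        ∃ ρ : LeviFoliation.Cn n → ℝ,
          LeviFoliation.IsDefiningFunctionOn (ball 0 ε)
            (Φ p '' (Ω ∩ N p)) (Φ p '' (frontier Ω ∩ N p)) ρ ∧
          ∀ ζ ∈ ball (0 : LeviFoliation.Cn n) ε,
            |ρ ζ - ((ζ ⟨0, Nat.zero_lt_of_lt hl⟩).re
                + ∑ j ∈ LeviFoliation.primeIdx n l, lam j p * ‖ζ j‖ ^ 2)| ≤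
              C * (LeviFoliation.partNorm (LeviFoliation.primeIdx n l) ζ ^ 2
                    * LeviFoliation.partNorm (LeviFoliation.doublePrimeIdx n l) ζ
                  + LeviFoliation.partNorm (LeviFoliation.primeIdx n l) ζ ^ 3
                  + |(ζ ⟨0, Nat.zero_lt_of_lt hl⟩).im| * ‖ζ‖) := by
  obtain ⟨L, f, hf, hside, hfront⟩ := LeviFoliation.exists_isAdapted hl hΩ hz₀ hV hz₀V hsmooth hrank
  -- a compact neighbourhood of `z₀` in `V` in which `Ω` is given by the defining function
  obtain ⟨r, hr, hrV⟩ := Metric.nhds_basis_closedBall.mem_iff.1 (hV.mem_nhds hz₀V)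
  have hWr : LeviFoliation.affineMap z₀ L ⁻¹' closedBall z₀ r ∈ nhds 0 :=
    LeviFoliation.tendsto_affineMap (closedBall_mem_nhds z₀ hr)
  obtain ⟨u, δ, C, N, Φ, Ψ, ρ, hu, hδ, hΦs, hΨs, hp⟩ :=
    hf.exists_scaled_charts (Filter.inter_mem hWr (hside.and hfront))
  have hcpt : ∀ S : Set (LeviFoliation.Cn n), S ⊆ closedBall z₀ r →
      IsCompact (closure S) ∧ closure S ⊆ V := fun S hS => by
    have h1 : closure S ⊆ closedBall z₀ r := closure_minimal hS isClosed_closedBall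
    exact ⟨(isCompact_closedBall z₀ r).of_isClosed_subset isClosed_closure h1, h1.trans hrV⟩
  have hsub : ∀ p ∈ ball (0 : LeviFoliation.Cn n) u,
      LeviFoliation.affineInv z₀ L ⁻¹' N p ⊆ closedBall z₀ r := by
    intro p hpu z hz
    have h1 := ((hp p hpu).2.1 hz).1
    rwa [mem_preimage, LeviFoliation.affineMap_affineInv] at h1
  have hU := hcpt (LeviFoliation.affineInv z₀ L ⁻¹' ball 0 u) fun z hz =>
    hsub 0 (mem_ball_self hu) ((hp 0 (mem_ball_self hu)).1 hz)
  have hκ : ContDiff ℝ ∞ (LeviFoliation.affineInv z₀ L) := LeviFoliation.contDiff_affineInv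
  refine ⟨LeviFoliation.affineInv z₀ L ⁻¹' ball 0 u,
    fun p => LeviFoliation.affineInv z₀ L ⁻¹' N (LeviFoliation.affineInv z₀ L p),
    fun p z => Φ (LeviFoliation.affineInv z₀ L p) (LeviFoliation.affineInv z₀ L z),
    fun p ζ => LeviFoliation.affineMap z₀ L (Ψ (LeviFoliation.affineInv z₀ L p) ζ),
    fun _ _ => δ, C, 1, isOpen_ball.preimage hκ.continuous, ?_, hU.1, hU.2, one_pos, le_rfl,
    ?_, ?_, fun _ _ => contDiffOn_const, ?_⟩
  · simp [LeviFoliation.affineInv, hu]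
  · rintro ⟨p, z⟩ ⟨⟨-, hpu⟩, hz⟩
    have h1 : ContDiffAt ℝ ∞ (fun x : LeviFoliation.Cn n × LeviFoliation.Cn n =>
        (LeviFoliation.affineInv z₀ L x.1, LeviFoliation.affineInv z₀ L x.2)) (p, z) :=
      ((hκ.comp contDiff_fst).prodMk (hκ.comp contDiff_snd)).contDiffAt
    exact (ContDiffAt.comp (p, z) (g := fun x : LeviFoliation.Cn n × LeviFoliation.Cn n =>
      Φ x.1 x.2) (hΦs _ hpu _ hz) h1).contDiffWithinAt
  · rintro ⟨p, ζ⟩ ⟨⟨-, hpu⟩, hζ⟩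
    have h1 : ContDiffAt ℝ ∞ (fun x : LeviFoliation.Cn n × LeviFoliation.Cn n =>
        (LeviFoliation.affineInv z₀ L x.1, x.2)) (p, ζ) :=
      ((hκ.comp contDiff_fst).prodMk contDiff_snd).contDiffAt
    have h2 := ContDiffAt.comp (p, ζ) (g := fun x : LeviFoliation.Cn n × LeviFoliation.Cn n =>
      Ψ x.1 x.2) (hΨs _ hpu _ hζ) h1
    exact (LeviFoliation.contDiff_affineMap.contDiffAt.comp (p, ζ) h2).contDiffWithinAt
  · rintro p ⟨hpf, hpu⟩
    obtain ⟨h1, h2, h3, h4, h5, h6⟩ := hp _ hpu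
    have hN := hcpt _ (hsub _ hpu)
    have hbih := LeviFoliation.isBiholomorphic_affine (z₀ := z₀) (L := L) h3
    have hfp : f (LeviFoliation.affineInv z₀ L p) = 0 := by
      have h7 := (h2 (h1 hpu)).2.2
      rw [LeviFoliation.affineMap_affineInv] at h7
      exact h7.1 hpf
    have hW : ∀ ζ ∈ ball (0 : LeviFoliation.Cn n) 1, _ := fun ζ hζ =>
      (h2 (h3.mapsTo_inv hζ)).2
    refine ⟨fun z hz => h1 hz, hN.1, hN.2, hbih, h4, fun _ _ => hδ,
      ρ (LeviFoliation.affineInv z₀ L p), ⟨?_, ?_, ?_, ?_⟩, h6 hfp⟩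
    · exact fun ζ hζ => (h5 ζ hζ).1.contDiffWithinAt
    · ext ζ
      rw [mem_inter_iff, and_comm]
      refine and_congr_right fun hζ => ?_
      rw [LeviFoliation.mem_image_iff_of_isBiholomorphic hbih hζ]
      obtain ⟨k, hk, hkf⟩ := (h5 ζ hζ).2.2
      rw [(hW ζ hζ).1, hkf, ← smul_eq_mul, smul_neg_iff_of_pos_left hk]
    · ext ζ
      rw [mem_inter_iff, and_comm]
      refine and_congr_right fun hζ => ?_
      rw [LeviFoliation.mem_image_iff_of_isBiholomorphic hbih hζ]
      obtain ⟨k, hk, hkf⟩ := (h5 ζ hζ).2.2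
      rw [(hW ζ hζ).2, hkf, mul_eq_zero, or_iff_right hk.ne']
    · exact fun ζ hζ => (h5 ζ hζ.2).2.1
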